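/- **Setting.** For $k\ge 0$ let $B_k$ be a set of $k$ marked points on the boundary of a disk with a base point on its boundary (not a marked point). A *smoothing* with boundary $B_k$ is a compact 1-submanifold of the disk with boundary $B_k$, meeting the boundary circle transversely in $B_k$. A *cobordism* $\mathcal O\to\mathcal O'$ of smoothings is a compact surface embedded in $\text{disk}\times[0,1]$ with boundary $\mathcal O\times\{0\}\cup B_k\times[0,1]\cup\mathcal O'\times\{1\}$, considered up to boundary-preserving isotopy. (Submanifolds are locally flat and are products near the boundary; all isotopies are ambient.) Let $\mathrm{Cob}_l(B_k)$ be the preadditive category with smoothings as objects and with formal $\mathbb Z$-linear combinations of cobordisms as morphisms, modulo the local relations * $S$: a cobordism with a component isotopic to a sphere is $0$; * $T$: a component isotopic to a torus may be removed at the cost of a factor $2$; * $4Tu$: if a cobordism $C$ meets a ball in four disks $D_1,\dots,D_4$ in the standard position, and $C_{ij}$ is obtained by replacing $D_i\cup D_j$ by a standard tube in the ball with the same boundary, then $C_{12}+C_{34}=C_{13}+C_{24}$. Composition is vertical stacking. Let $\mathrm{Mat}$ denote the additive closure (finite formal direct sums, matrices of morphisms), and let $\mathrm{Kob}(B_k)$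 be the category of finite-length cochain complexes over $\mathrm{Mat}(\mathrm{Cob}_l(B_k))$ and chain maps. $\mathrm{Kob}_{/h}(B_k)$ is $\mathrm{Kob}(B_k)$ modulo chain homotopy, so that isomorphism of objects in $\mathrm{Kob}_{/h}(B_k)$ is homotopy equivalence. **Planar algebras.** A $d$-input *planar arc diagram* ($d\ge0$) is a based disk with $d$ disjoint based input disks, numbered $1,\dots,d$, removed from its interior, together with a compact 1-submanifold of the remaining region (closed curves and arcs) which meets the boundary circles transversely and exactly in its boundary: $k_i$ marked points on the $i$-th input circle and $k$ marked points on the output circle. Diagrams are considered up to isotopy. A *planar algebra* is a family of sets $(\mathcal P(k))_{k\ge0}$ together with an operation $D:\mathcal P(k_1)\times\dots\times\mathcal P(k_d)\to\mathcal P(k)$ for each planar arc diagram $D$ as above, depending only on the isotopy class of $D$, such that radial one-input diagrams act as identities, and such that, whenever $D_i$ is the result of placing a diagram $D'$ into the $i$-th hole of $D$ (with any numbering of the resulting input disks, and the operation of $D_i$ taking its arguments in the corresponding order), $D_i=D\circ(I\times\dots\times D'\times\dots\times I)$. **The operations.** A planar arc diagram $D$ acts on smoothings by placing them in the holes, and multilinearly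 on morphisms of $\mathrm{Cob}_l$ by placing cobordisms in the cylindrical holes of $D\times[0,1]$. For complexes $(\Omega_i,d_i)\in\mathrm{Kob}(B_{k_i})$ let $D(\Omega_1,\dots,\Omega_d)=(\Omega,\partial)$ with $$\Omega^r=\bigoplus_{r=r_1+\dots+r_d}D(\Omega_1^{r_1},\dots,\Omega_d^{r_d}),\qquad \partial|_{D(\Omega_1^{r_1},\dots,\Omega_d^{r_d})}=\sum_{i=1}^d(-1)^{\sum_{j<i}r_j}\,D(I_{\Omega_1^{r_1}},\dots,d_i,\dots,I_{\Omega_d^{r_d}}).$$ (The action is extended additively to formal direct sums and matrices; this is an object of $\mathrm{Kob}(B_k)$.) **Proposition.** 1. The operations $(\Omega_1,\dots,\Omega_d)\mapsto D(\Omega_1,\dots,\Omega_d)$ are well defined on isomorphism classes of objects of $\mathrm{Kob}(B_k)$ and make these into a planar algebra. 2. If $\Omega_i$ and $\Omega_i'$ are homotopy equivalent for every $i$, then so are $D(\Omega_1,\dots,\Omega_d)$ and $D(\Omega'_1,\dots,\Omega'_d)$. 3. Hence the same operations are well defined on the homotopy equivalence classes of complexes (the isomorphism classes of objects of $\mathrm{Kob}_{/h}(B_k)$)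 and make these into a planar algebra. -/

import Mathlib

open CategoryTheory Topology Set

noncomputable section

namespace BarNatan

/-! ### Locally flat subsets -/

/-- `S` is locally flat at `x`, modelled on `M`: some chart of the ambient space around `x`
carries `S` to `M`. -/
def LocFlatAt {X : Type} [TopologicalSpace X] (M S : Set X) (x : X) : Prop :=
  ∃ e : OpenPartialHomeomorph X X, x ∈ e.source ∧ ∀ y ∈ e.source, (y ∈ S ↔ e y ∈ M)

/-- The straight line in the plane. -/
def flatLine : Set ℂ := {z | z.im = 0}

/-- The flat plane in three-space. -/
def flatPlane : Set (ℂ × ℝ) := {p | p.1.im = 0}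

theorem LocFlatAt.congr {X : Type} [TopologicalSpace X] {M S S' : Set X} {x : X}
    (h : LocFlatAt M S x) (hS : ∀ᶠ y in 𝓝 x, (y ∈ S ↔ y ∈ S')) : LocFlatAt M S' x := by
  obtain ⟨e, hx, he⟩ := h
  obtain ⟨U, hU, hUo, hxU⟩ := eventually_nhds_iff.1 hS
  refine ⟨e.restrOpen U hUo, ⟨hx, hxU⟩, fun y hy => ?_⟩
  have hy' : y ∈ e.source ∩ U := hy
  exact (hU y hy'.2).symm.trans (he y hy'.1)

theorem LocFlatAt.preimage {X : Type} [TopologicalSpace X] {M S : Set X} {x : X} (φ : X ≃ₜ X)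
    (h : LocFlatAt M S (φ x)) : LocFlatAt M (φ ⁻¹' S) x := by
  obtain ⟨e, hx, he⟩ := h
  exact ⟨φ.transOpenPartialHomeomorph e, hx, fun y hy => he (φ y) hy⟩

theorem LocFlatAt.cylinder {O : Set ℂ} {z : ℂ} (h : LocFlatAt flatLine O z) (s : ℝ) :
    LocFlatAt flatPlane {p : ℂ × ℝ | p.1 ∈ O} (z, s) := by
  obtain ⟨e, hx, he⟩ := h
  refine ⟨e.prod (OpenPartialHomeomorph.refl ℝ), ⟨hx, mem_univ _⟩, fun y hy => ?_⟩
  exact he y.1 hy.1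

/-! ### Smoothings -/

/-- The `k` marked points on the unit circle, none of them at the base point `1`. -/
def markedPoints (k : ℕ) : Set ℂ := {b | b ^ k = -1}

/-- The open rays from the centre through the marked points. -/
def rays (k : ℕ) : Set ℂ := {z | ∃ b ∈ markedPoints k, ∃ t : ℝ, 0 < t ∧ z = t * b}

theorem rays_smul {k : ℕ} {z : ℂ} {t : ℝ} (ht : 0 < t) : (t : ℂ) * z ∈ rays k ↔ z ∈ rays k := by
  have key : ∀ {u : ℝ} {y : ℂ}, 0 < u → y ∈ rays k → (u : ℂ) * y ∈ rays k := by
    rintro u y hu ⟨b, hb, v, hv, rfl⟩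
    exact ⟨b, hb, u * v, mul_pos hu hv, by push_cast; ring⟩
  refine ⟨fun h => ?_, key ht⟩
  have := key (inv_pos.2 ht) h
  have ht' : (t : ℂ) ≠ 0 := by exact_mod_cast ht.ne'
  rwa [Complex.ofReal_inv, inv_mul_cancel_left₀ ht'] at this

/-- A smoothing of the unit disk with `k` boundary points: a compact one-dimensional locally flat
submanifold of the disk, meeting the boundary circle transversely (radially near the circle),
exactly in the marked points. -/
structure Smoothing (k : ℕ) where
  carrier : Set ℂ
  subset_disk : carrier ⊆ Metric.closedBall 0 1
  isClosed : IsClosed carrier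
  collar : ∀ᶠ r in 𝓝[≤] (1 : ℝ), ∀ z : ℂ, ‖z‖ = r → (z ∈ carrier ↔ z ∈ rays k)
  flat : ∀ z ∈ carrier, ‖z‖ < 1 → LocFlatAt flatLine carrier z

/-! ### Cobordisms -/

/-- The interior of the cylinder over the disk. -/
def openCyl : Set (ℂ × ℝ) := Metric.ball 0 1 ×ˢ Ioo 0 1

/-- A cobordism between smoothings: a compact locally flat surface in the cylinder
`disk × [0,1]` with boundary `O × {0} ∪ B × [0,1] ∪ O' × {1}`, meeting the boundary of the cylinder
transversely (it is a product near each of the three parts of the boundary). -/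
@[ext]
structure Cobordism {k : ℕ} (O O' : Smoothing k) where
  carrier : Set (ℂ × ℝ)
  subset_cyl : carrier ⊆ Metric.closedBall 0 1 ×ˢ Icc 0 1
  isClosed : IsClosed carrier
  bottom : ∀ᶠ s in 𝓝[≥] (0 : ℝ), ∀ z : ℂ, ((z, s) ∈ carrier ↔ z ∈ O.carrier)
  top : ∀ᶠ s in 𝓝[≤] (1 : ℝ), ∀ z : ℂ, ((z, s) ∈ carrier ↔ z ∈ O'.carrier)
  side : ∀ᶠ r in 𝓝[≤] (1 : ℝ), ∀ z : ℂ, ‖z‖ = r →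
    ∀ s ∈ Icc (0 : ℝ) 1, ((z, s) ∈ carrier ↔ z ∈ rays k)
  flat : ∀ p ∈ carrier, p ∈ openCyl → LocFlatAt flatPlane carrier p

/-- The affine map `(z, s) ↦ (c + w z, α s + β)`. -/
def place (c w : ℂ) (α β : ℝ) (p : ℂ × ℝ) : ℂ × ℝ := (c + w * p.1, α * p.2 + β)

/-- `place` as a homeomorphism. -/
def placeHomeo (c w : ℂ) (α β : ℝ) (hw : w ≠ 0) (hα : α ≠ 0) : ℂ × ℝ ≃ₜ ℂ × ℝ where
  toFun := place c w α β
  invFun p := ((p.1 - c) / w, (p.2 - β) / α)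
  left_inv p := by ext1 <;> simp [place, hw, hα]
  right_inv p := by
    ext1
    · simp [place, mul_div_cancel₀ _ hw]
    · simp [place, mul_div_cancel₀ _ hα]
  continuous_toFun := by unfold place; fun_prop
  continuous_invFun := by fun_prop (disch := assumption)

theorem place_image_mem {c w : ℂ} {α β : ℝ} (hw : w ≠ 0) (hα : α ≠ 0) {S : Set (ℂ × ℝ)}
    {p : ℂ × ℝ} : p ∈ place c w α β '' S ↔ ((p.1 - c) / w, (p.2 - β) / α) ∈ S := by
  have : place c w α β '' S = placeHomeo c w α β hw hα '' S := rfl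
  rw [this, Homeomorph.image_eq_preimage_symm]
  rfl

theorem place_place (c w c' w' : ℂ) (α β α' β' : ℝ) (p : ℂ × ℝ) :
    place c w α β (place c' w' α' β' p) = place (c + w * c') (w * w') (α * α') (α * β' + β) p := by
  ext1 <;> (simp [place]; ring)

theorem LocFlatAt.place_image {c w : ℂ} {α β : ℝ} (hw : w ≠ 0) (hα : α ≠ 0) {S : Set (ℂ × ℝ)}
    {p : ℂ × ℝ} (h : LocFlatAt flatPlane S ((p.1 - c) / w, (p.2 - β) / α)) :
    LocFlatAt flatPlane (place c w α β '' S) p := by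
  have h2 := LocFlatAt.preimage (placeHomeo c w α β hw hα).symm (S := S) (x := p) h
  rwa [← Homeomorph.image_eq_preimage_symm] at h2

/-- The identity cobordism `O × [0,1]`. -/
def Cobordism.id {k : ℕ} (O : Smoothing k) : Cobordism O O where
  carrier := O.carrier ×ˢ Icc 0 1
  subset_cyl := prod_mono O.subset_disk subset_rfl
  isClosed := O.isClosed.prod isClosed_Icc
  bottom := by
    filter_upwards [self_mem_nhdsWithin, nhdsWithin_le_nhds (Iic_mem_nhds one_pos)] with s h0 h1 z
    exact ⟨fun h => h.1, fun h => ⟨h, h0, h1⟩⟩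
  top := by
    filter_upwards [self_mem_nhdsWithin, nhdsWithin_le_nhds (Ici_mem_nhds one_pos)] with s h0 h1 z
    exact ⟨fun h => h.1, fun h => ⟨h, h1, h0⟩⟩
  side := by
    filter_upwards [O.collar] with r hr z hz s hs
    rw [← hr z hz]
    exact ⟨fun h => h.1, fun h => ⟨h, hs⟩⟩
  flat := by
    rintro ⟨z, s⟩ hp hc
    refine ((O.flat z hp.1 (by simpa using hc.1)).cylinder s).congr ?_
    have : Ioo (0 : ℝ) 1 ∈ 𝓝 s := Ioo_mem_nhds hc.2.1 hc.2.2
    filter_upwards [continuous_snd.continuousAt.preimage_mem_nhds this] with y hy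
    exact ⟨fun h => ⟨h, Ioo_subset_Icc_self hy⟩, fun h => h.1⟩

theorem mem_stack {S S' : Set (ℂ × ℝ)} {z : ℂ} {s : ℝ} :
    (z, s) ∈ place 0 1 (1 / 2) 0 '' S ∪ place 0 1 (1 / 2) (1 / 2) '' S' ↔
      (z, 2 * s) ∈ S ∨ (z, 2 * s - 1) ∈ S' := by
  rw [mem_union, place_image_mem one_ne_zero (by norm_num),
    place_image_mem one_ne_zero (by norm_num)]
  have h1 : (s - 0) / (1 / 2) = 2 * s := by ring
  have h2 : (s - 1 / 2) / (1 / 2) = 2 * s - 1 := by ring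
  simp only [sub_zero, div_one]
  rw [h2, show s / (1 / 2) = 2 * s by ring]

theorem Cobordism.mem_bounds {k : ℕ} {O O' : Smoothing k} (S : Cobordism O O') {z : ℂ} {s : ℝ}
    (h : (z, s) ∈ S.carrier) : ‖z‖ ≤ 1 ∧ 0 ≤ s ∧ s ≤ 1 := by
  have := S.subset_cyl h
  exact ⟨by simpa using this.1, this.2.1, this.2.2⟩

theorem Cobordism.bottom_eps {k : ℕ} {O O' : Smoothing k} (S : Cobordism O O') :
    ∃ ε : ℝ, 0 < ε ∧ ε ≤ 1 ∧
      ∀ s, 0 ≤ s → s ≤ ε → ∀ z : ℂ, ((z, s) ∈ S.carrier ↔ z ∈ O.carrier) := by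
  obtain ⟨u, hu, h⟩ := mem_nhdsGE_iff_exists_Icc_subset.1 S.bottom
  exact ⟨min u 1, lt_min hu one_pos, min_le_right _ _,
    fun s h0 h1 => h ⟨h0, h1.trans (min_le_left _ _)⟩⟩

theorem Cobordism.top_eps {k : ℕ} {O O' : Smoothing k} (S : Cobordism O O') :
    ∃ ε : ℝ, 0 < ε ∧ ε ≤ 1 ∧
      ∀ s, 1 - ε ≤ s → s ≤ 1 → ∀ z : ℂ, ((z, s) ∈ S.carrier ↔ z ∈ O'.carrier) := by
  obtain ⟨u, hu, h⟩ := mem_nhdsLE_iff_exists_Icc_subset.1 S.top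
  have hu' : u < 1 := hu
  refine ⟨min (1 - u) 1, lt_min (by linarith) one_pos, min_le_right _ _, fun s h0 h1 => h ⟨?_, h1⟩⟩
  have := min_le_left (1 - u) 1
  linarith

/-- Composition of cobordisms: the second one is put on top of the first one, and the result is
rescaled vertically. -/
def Cobordism.comp {k : ℕ} {O O' O'' : Smoothing k} (S : Cobordism O O') (S' : Cobordism O' O'') :
    Cobordism O O'' where
  carrier := place 0 1 (1 / 2) 0 '' S.carrier ∪ place 0 1 (1 / 2) (1 / 2) '' S'.carrier
  subset_cyl := by
    rintro ⟨z, s⟩ h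
    rcases mem_stack.1 h with h | h
    · obtain ⟨h1, h2, h3⟩ := S.mem_bounds h
      exact ⟨by simpa using h1, by linarith, by linarith⟩
    · obtain ⟨h1, h2, h3⟩ := S'.mem_bounds h
      exact ⟨by simpa using h1, by linarith, by linarith⟩
  isClosed := by
    refine IsClosed.union ?_ ?_
    · exact (placeHomeo 0 1 (1 / 2) 0 one_ne_zero (by norm_num)).isClosed_image.2 S.isClosed
    · exact (placeHomeo 0 1 (1 / 2) (1 / 2) one_ne_zero (by norm_num)).isClosed_image.2 S'.isClosed
  bottom := by
    obtain ⟨ε, h0, h1, h⟩ := S.bottom_eps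
    filter_upwards [self_mem_nhdsWithin, nhdsWithin_le_nhds (Iio_mem_nhds (half_pos h0))]
      with s hs hs' z
    have hs0 : 0 ≤ s := hs
    have hs1 : s < ε / 2 := hs'
    rw [mem_stack, ← h (2 * s) (by linarith) (by linarith)]
    refine or_iff_left fun hh => ?_
    have := S'.mem_bounds hh
    linarith
  top := by
    obtain ⟨ε, h0, h1, h⟩ := S'.top_eps
    filter_upwards [self_mem_nhdsWithin,
      nhdsWithin_le_nhds (Ioi_mem_nhds (show 1 - ε / 2 < 1 by linarith))] with s hs hs' z
    have hs0 : s ≤ 1 := hs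
    have hs1 : 1 - ε / 2 < s := hs'
    rw [mem_stack, ← h (2 * s - 1) (by linarith) (by linarith)]
    refine or_iff_right fun hh => ?_
    have := S.mem_bounds hh
    linarith
  side := by
    filter_upwards [S.side, S'.side] with r h h' z hz s hs
    rw [mem_stack]
    constructor
    · rintro (hh | hh)
      · exact (h z hz _ (S.mem_bounds hh).2).1 hh
      · exact (h' z hz _ (S'.mem_bounds hh).2).1 hh
    · intro hh
      rcases le_total s (1 / 2) with h2 | h2
      · exact Or.inl ((h z hz _ ⟨by linarith [hs.1], by linarith⟩).2 hh)
      · exact Or.inr ((h' z hz _ ⟨by linarith, by linarith [hs.2]⟩).2 hh)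
  flat := by
    rintro ⟨z, s⟩ hp ⟨hz, hs⟩
    have hs0 : 0 < s := hs.1
    have hs1 : s < 1 := hs.2
    rcases lt_trichotomy s (1 / 2) with h2 | h2 | h2
    · have hp' : (z, 2 * s) ∈ S.carrier := by
        refine (mem_stack.1 hp).resolve_right fun hh => ?_
        have := S'.mem_bounds hh
        linarith
      have hf := S.flat _ hp' ⟨hz, by simp; constructor <;> linarith⟩
      have hf' : LocFlatAt flatPlane (place 0 1 (1 / 2) 0 '' S.carrier) (z, s) := by
        refine LocFlatAt.place_image one_ne_zero (by norm_num) ?_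
        convert hf using 2 <;> simp <;> ring
      refine hf'.congr ?_
      filter_upwards [continuous_snd.continuousAt.preimage_mem_nhds (Iio_mem_nhds h2)] with y hy
      refine ⟨Or.inl, fun hh => hh.resolve_right fun hh' => ?_⟩
      obtain ⟨q, hq, rfl⟩ := hh'
      have := S'.mem_bounds (z := q.1) (s := q.2) hq
      have hy' : 1 / 2 * q.2 + 1 / 2 < 1 / 2 := hy
      linarith
    · obtain ⟨ε, e0, e1, he⟩ := S.top_eps
      obtain ⟨δ, d0, d1, hd⟩ := S'.bottom_eps
      have hO : z ∈ O'.carrier := by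
        rcases mem_stack.1 hp with hh | hh
        · exact (he _ (by linarith) (by linarith) z).1 hh
        · exact (hd _ (by linarith) (by linarith) z).1 hh
      refine ((O'.flat z hO (by simpa using hz)).cylinder s).congr ?_
      have : Ioo (1 / 2 - ε / 2) (1 / 2 + δ / 2) ∈ 𝓝 s :=
        Ioo_mem_nhds (by linarith) (by linarith)
      filter_upwards [continuous_snd.continuousAt.preimage_mem_nhds this] with y hy
      obtain ⟨y, t⟩ := y
      have ht0 : 1 / 2 - ε / 2 < t := hy.1
      have ht1 : t < 1 / 2 + δ / 2 := hy.2
      rw [mem_stack]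
      change y ∈ O'.carrier ↔ _
      constructor
      · intro hh
        rcases le_total t (1 / 2) with h3 | h3
        · exact Or.inl ((he _ (by linarith) (by linarith) y).2 hh)
        · exact Or.inr ((hd _ (by linarith) (by linarith) y).2 hh)
      · rintro (hh | hh)
        · exact (he _ (by linarith) (S.mem_bounds hh).2.2 y).1 hh
        · exact (hd _ (S'.mem_bounds hh).2.1 (by linarith) y).1 hh
    · have hp' : (z, 2 * s - 1) ∈ S'.carrier := by
        refine (mem_stack.1 hp).resolve_left fun hh => ?_
        have := S.mem_bounds hh
        linarith
      have hf := S'.flat _ hp' ⟨hz, by simp; constructor <;> linarith⟩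
      have hf' : LocFlatAt flatPlane (place 0 1 (1 / 2) (1 / 2) '' S'.carrier) (z, s) := by
        refine LocFlatAt.place_image one_ne_zero (by norm_num) ?_
        convert hf using 2
        · simp
        · simp only []; ring
      refine hf'.congr ?_
      filter_upwards [continuous_snd.continuousAt.preimage_mem_nhds (Ioi_mem_nhds h2)] with y hy
      refine ⟨Or.inr, fun hh => hh.resolve_left fun hh' => ?_⟩
      obtain ⟨q, hq, rfl⟩ := hh'
      have := S.mem_bounds (z := q.1) (s := q.2) hq
      have hy' : 1 / 2 < 1 / 2 * q.2 + 0 := hy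
      linarith

/-! ### Isotopies -/

/-- Boundary-preserving ambient isotopy of subsets of the cylinder: a continuous family of
self-homeomorphisms fixing the complement of the open cylinder pointwise, starting at the identity
and carrying `S` to `S'` at time `1`. -/
def AmbientIsotopic (S S' : Set (ℂ × ℝ)) : Prop :=
  ∃ H : unitInterval → (ℂ × ℝ ≃ₜ ℂ × ℝ),
    Continuous (fun q : unitInterval × (ℂ × ℝ) => H q.1 q.2) ∧
    (∀ p, H 0 p = p) ∧ (∀ t p, p ∉ openCyl → H t p = p) ∧ H 1 '' S = S'

theorem isHomeomorph_of_support {f : ℂ × ℝ → ℂ × ℝ} (hf : Continuous f)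
    (hb : Function.Bijective f) (hid : ∀ p, p ∉ openCyl → f p = p) : IsHomeomorph f := by
  refine isHomeomorph_iff_continuous_isClosedMap_bijective.2 ⟨hf, fun F hF => ?_, hb⟩
  have hK : IsCompact (Metric.closedBall (0 : ℂ) 1 ×ˢ Icc (0 : ℝ) 1) :=
    (isCompact_closedBall 0 1).prod isCompact_Icc
  have hsub : openCyl ⊆ Metric.closedBall (0 : ℂ) 1 ×ˢ Icc (0 : ℝ) 1 :=
    prod_mono Metric.ball_subset_closedBall Ioo_subset_Icc_self
  have hopen : IsOpen openCyl := Metric.isOpen_ball.prod isOpen_Ioo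
  have h1 : f '' F = f '' (F ∩ Metric.closedBall (0 : ℂ) 1 ×ˢ Icc (0 : ℝ) 1) ∪ F \ openCyl := by
    ext p
    constructor
    · rintro ⟨q, hq, rfl⟩
      by_cases hqc : q ∈ openCyl
      · exact Or.inl ⟨q, ⟨hq, hsub hqc⟩, rfl⟩
      · exact Or.inr (by rw [hid q hqc]; exact ⟨hq, hqc⟩)
    · rintro (⟨q, hq, rfl⟩ | ⟨hp, hpc⟩)
      · exact ⟨q, hq.1, rfl⟩
      · exact ⟨p, hp, hid p hpc⟩
  rw [h1]
  exact ((hK.inter_left hF).image hf).isClosed.union (hF.sdiff hopen)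

theorem AmbientIsotopic.of_reparam {k : ℕ} {O O' : Smoothing k} (S S' : Cobordism O O')
    (φ : ℝ → ℝ) (hφ : Continuous φ) (hmono : StrictMono φ) (h0 : ∀ s, s ≤ 0 → φ s = s)
    (h1 : ∀ s, 1 ≤ s → φ s = s)
    (h : ∀ (z : ℂ) (s : ℝ), (z, s) ∈ S.carrier ↔ (z, φ s) ∈ S'.carrier) :
    AmbientIsotopic S.carrier S'.carrier := by
  obtain ⟨u, hu, hside⟩ := mem_nhdsLE_iff_exists_Icc_subset.1 (S.side.and S'.side)
  have hu1 : u < 1 := hu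
  let l : ℂ → ℝ := fun z => max 0 (min 1 ((1 - ‖z‖) / (1 - u)))
  have hl : Continuous l := by
    have : Continuous fun z : ℂ => (1 - ‖z‖) / (1 - u) := by fun_prop
    exact continuous_const.max (continuous_const.min this)
  have hl0 : ∀ z, 0 ≤ l z := fun z => le_max_left _ _
  have hl1 : ∀ z, l z ≤ 1 := fun z => max_le zero_le_one (min_le_left _ _)
  have hlin : ∀ z : ℂ, ‖z‖ ≤ u → l z = 1 := fun z hz => by
    have : 1 ≤ (1 - ‖z‖) / (1 - u) := by rw [le_div_iff₀ (by linarith)]; linarith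
    simp only [l]
    rw [min_eq_left this, max_eq_right zero_le_one]
  have hlout : ∀ z : ℂ, 1 ≤ ‖z‖ → l z = 0 := fun z hz => by
    have : (1 - ‖z‖) / (1 - u) ≤ 0 := div_nonpos_of_nonpos_of_nonneg (by linarith) (by linarith)
    simp only [l]
    exact max_eq_left ((min_le_right _ _).trans this)
  let g : ℝ → ℝ → ℝ := fun m s => (1 - m) * s + m * φ s
  have hgmono : ∀ m, 0 ≤ m → m ≤ 1 → StrictMono (g m) := fun m hm0 hm1 a b hab => by
    have hab' := hmono hab
    simp only [g]
    rcases hm0.eq_or_lt with rfl | hm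
    · simpa using hab
    · have := mul_lt_mul_of_pos_left hab' hm
      have := mul_le_mul_of_nonneg_left hab.le (sub_nonneg.2 hm1)
      linarith
  have hg0 : ∀ m s, s ≤ 0 → g m s = s := fun m s hs => by simp only [g]; rw [h0 s hs]; ring
  have hg1 : ∀ m s, 1 ≤ s → g m s = s := fun m s hs => by simp only [g]; rw [h1 s hs]; ring
  have hgcont : ∀ m, Continuous (g m) := fun m => by simp only [g]; fun_prop
  have hgsurj : ∀ m, Function.Surjective (g m) := fun m => by
    refine (hgcont m).surjective ?_ ?_
    · refine Filter.tendsto_id.congr' ?_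
      filter_upwards [Filter.eventually_ge_atTop 1] with s hs using (hg1 m s hs).symm
    · refine Filter.tendsto_id.congr' ?_
      filter_upwards [Filter.eventually_le_atBot 0] with s hs using (hg0 m s hs).symm
  let F : unitInterval → ℂ × ℝ → ℂ × ℝ := fun t p => (p.1, g (t * l p.1) p.2)
  have hm0 : ∀ (t : unitInterval) z, 0 ≤ (t : ℝ) * l z := fun t z => mul_nonneg t.2.1 (hl0 z)
  have hm1 : ∀ (t : unitInterval) z, (t : ℝ) * l z ≤ 1 := fun t z =>
    mul_le_one₀ t.2.2 (hl0 z) (hl1 z)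
  have hFcont : Continuous fun q : unitInterval × (ℂ × ℝ) => F q.1 q.2 := by
    simp only [F, g]; fun_prop
  have hFid : ∀ t p, p ∉ openCyl → F t p = p := by
    rintro t ⟨z, s⟩ hp
    ext1
    · rfl
    · change g _ s = s
      rcases le_or_gt s 0 with hs | hs
      · exact hg0 _ _ hs
      rcases le_or_gt 1 s with hs' | hs'
      · exact hg1 _ _ hs'
      have hz : 1 ≤ ‖z‖ := by
        by_contra hz
        exact hp ⟨by simpa using hz, hs, hs'⟩
      change g (t * l z) s = s
      rw [hlout z hz]
      simp [g]
  have hFhom : ∀ t, IsHomeomorph (F t) := fun t => by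
    refine isHomeomorph_of_support (hFcont.comp (Continuous.prodMk_right t)) ⟨?_, ?_⟩ (hFid t)
    · rintro ⟨z, s⟩ ⟨z', s'⟩ hh
      obtain ⟨rfl, h2⟩ := Prod.mk.injEq _ _ _ _ ▸ hh
      exact Prod.ext rfl ((hgmono _ (hm0 t z) (hm1 t z)).injective h2)
    · rintro ⟨z, s⟩
      obtain ⟨s', hs'⟩ := hgsurj (t * l z) s
      exact ⟨(z, s'), Prod.ext rfl hs'⟩
  refine ⟨fun t => (hFhom t).homeomorph, hFcont, fun p => ?_, hFid, ?_⟩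
  · change F 0 p = p
    simp [F, g]
  have key : ∀ p, p ∈ S.carrier ↔ F 1 p ∈ S'.carrier := by
    rintro ⟨z, s⟩
    change _ ↔ (z, g ((1 : unitInterval) * l z) s) ∈ _
    rw [show ((1 : unitInterval) : ℝ) = 1 from rfl, one_mul]
    rcases le_or_gt ‖z‖ u with hz | hz
    · rw [hlin z hz, h]
      simp [g]
    rcases le_or_gt ‖z‖ 1 with hz' | hz'
    · by_cases hs : s ∈ Icc (0 : ℝ) 1
      · have hs' : g (l z) s ∈ Icc (0 : ℝ) 1 := by
          have hm := (hgmono _ (hl0 z) (hl1 z)).monotone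
          have a := hm hs.1
          have b := hm hs.2
          rw [hg0 _ _ le_rfl] at a
          rw [hg1 _ _ le_rfl] at b
          exact ⟨a, b⟩
        obtain ⟨a, b⟩ := hside ⟨hz.le, hz'⟩
        rw [a z rfl s hs, b z rfl _ hs']
      · have hg : g (l z) s = s := by
          rcases le_or_gt s 0 with hs' | hs'
          · exact hg0 _ _ hs'
          · exact hg1 _ _ (by by_contra hh; exact hs ⟨hs'.le, by linarith⟩)
        rw [hg]
        exact ⟨fun hh => absurd (S.mem_bounds hh).2 hs, fun hh => absurd (S'.mem_bounds hh).2 hs⟩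
    · exact ⟨fun hh => absurd (S.mem_bounds hh).1 (by linarith),
        fun hh => absurd (S'.mem_bounds hh).1 (by linarith)⟩
  ext p
  constructor
  · rintro ⟨q, hq, rfl⟩
    exact (key q).1 hq
  · intro hp
    obtain ⟨q, rfl⟩ := (hFhom 1).surjective p
    exact ⟨q, (key q).2 hp, rfl⟩

theorem Cobordism.assoc_isotopic {k : ℕ} {O₁ O₂ O₃ O₄ : Smoothing k} (S₁ : Cobordism O₁ O₂)
    (S₂ : Cobordism O₂ O₃) (S₃ : Cobordism O₃ O₄) :
    AmbientIsotopic ((S₁.comp S₂).comp S₃).carrier (S₁.comp (S₂.comp S₃)).carrier := by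
  let φ : ℝ → ℝ := fun s => max s (min (2 * s) (min (s + 1 / 4) (s / 2 + 1 / 2)))
  refine AmbientIsotopic.of_reparam _ _ φ (by fun_prop) ?_ ?_ ?_ ?_
  · intro a b hab
    simp only [φ]
    refine max_lt_max hab (min_lt_min (by linarith) (min_lt_min (by linarith) (by linarith)))
  · intro s hs
    exact max_eq_left ((min_le_left _ _).trans (by linarith))
  · intro s hs
    exact max_eq_left ((min_le_right _ _).trans ((min_le_right _ _).trans (by linarith)))
  · intro z s
    simp only [Cobordism.comp]
    rw [mem_stack, mem_stack, mem_stack, mem_stack]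
    have b1 : ∀ t, (z, t) ∈ S₁.carrier → 0 ≤ t ∧ t ≤ 1 := fun t ht => (S₁.mem_bounds ht).2
    have b2 : ∀ t, (z, t) ∈ S₂.carrier → 0 ≤ t ∧ t ≤ 1 := fun t ht => (S₂.mem_bounds ht).2
    have b3 : ∀ t, (z, t) ∈ S₃.carrier → 0 ≤ t ∧ t ≤ 1 := fun t ht => (S₃.mem_bounds ht).2
    have hval : (s ≤ 0 ∧ φ s = s) ∨ (0 ≤ s ∧ s ≤ 1 / 4 ∧ φ s = 2 * s) ∨
        (1 / 4 ≤ s ∧ s ≤ 1 / 2 ∧ φ s = s + 1 / 4) ∨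
        (1 / 2 ≤ s ∧ s ≤ 1 ∧ φ s = s / 2 + 1 / 2) ∨ (1 ≤ s ∧ φ s = s) := by
      simp only [φ]
      rcases le_total s 0 with h | h
      · exact Or.inl ⟨h, max_eq_left (min_le_of_left_le (by linarith))⟩
      rcases le_total s (1 / 4) with h' | h'
      · refine Or.inr (Or.inl ⟨h, h', ?_⟩)
        rw [min_eq_left (le_min (by linarith) (by linarith)), max_eq_right (by linarith)]
      rcases le_total s (1 / 2) with h2 | h2
      · refine Or.inr (Or.inr (Or.inl ⟨h', h2, ?_⟩))
        rw [min_eq_left (show s + 1 / 4 ≤ s / 2 + 1 / 2 by linarith), min_eq_right (by linarith),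
          max_eq_right (by linarith)]
      rcases le_total s 1 with h3 | h3
      · refine Or.inr (Or.inr (Or.inr (Or.inl ⟨h2, h3, ?_⟩)))
        rw [min_eq_right (show s / 2 + 1 / 2 ≤ s + 1 / 4 by linarith), min_eq_right (by linarith),
          max_eq_right (by linarith)]
      · exact Or.inr (Or.inr (Or.inr (Or.inr ⟨h3, max_eq_left
          (min_le_of_right_le (min_le_of_right_le (by linarith)))⟩)))
    generalize φ s = f at hval
    have n1 := fun t => mt (b1 t)
    have n2 := fun t => mt (b2 t)
    have n3 := fun t => mt (b3 t)
    rcases eq_or_ne s (1 / 4) with rfl | e1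
    · have hf : f = 1 / 2 := by
        rcases hval with ⟨h, rfl⟩ | ⟨h, h', rfl⟩ | ⟨h, h', rfl⟩ | ⟨h, h', rfl⟩ | ⟨h, rfl⟩ <;>
          norm_num at *
      subst hf
      have := n3 (-(1 / 2)) (by norm_num)
      have := n3 (-1) (by norm_num)
      norm_num at *
      simp [*]
    rcases eq_or_ne s (1 / 2) with rfl | e2
    · have hf : f = 3 / 4 := by
        rcases hval with ⟨h, rfl⟩ | ⟨h, h', rfl⟩ | ⟨h, h', rfl⟩ | ⟨h, h', rfl⟩ | ⟨h, rfl⟩ <;>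
          norm_num at *
      subst hf
      have := n1 2 (by norm_num)
      have := n1 (3 / 2) (by norm_num)
      norm_num at *
      simp [*]
    rcases hval with ⟨h, rfl⟩ | ⟨h, h', rfl⟩ | ⟨h, h', rfl⟩ | ⟨h, h', rfl⟩ | ⟨h, rfl⟩ <;> grind

theorem Cobordism.id_comp_isotopic {k : ℕ} {O O' : Smoothing k} (S : Cobordism O O') :
    AmbientIsotopic ((Cobordism.id O).comp S).carrier S.carrier := by
  obtain ⟨ε, e0, e1, he⟩ := S.bottom_eps
  let c : ℝ := 2 * ε / (1 + ε)
  have hc0 : 0 < c := by positivity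
  have hc1 : c ≤ 1 := by simp only [c]; rw [div_le_one (by positivity)]; linarith
  have hc : c * (1 + ε) = 2 * ε := by simp only [c]; field_simp
  let φ : ℝ → ℝ := fun s => min s (max (2 * s - 1) (c * s))
  have hmid : ∀ s, 0 ≤ s → s ≤ (1 + ε) / 2 → φ s = c * s ∧ c * s ≤ ε := by
    intro s hs hs'
    have h1 : c * s ≤ c * ((1 + ε) / 2) := by gcongr
    have h2 : c * s ≤ s := by nlinarith
    have h3 : 2 * s - 1 ≤ c * s := by nlinarith
    exact ⟨by simp only [φ]; rw [max_eq_right h3, min_eq_right h2], by linarith⟩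
  have hup : ∀ s, (1 + ε) / 2 ≤ s → s ≤ 1 → φ s = 2 * s - 1 := by
    intro s hs hs'
    have h3 : c * s ≤ 2 * s - 1 := by nlinarith
    simp only [φ]; rw [max_eq_left h3, min_eq_right (by linarith)]
  have hlo : ∀ s, s ≤ 0 → φ s = s := fun s hs => by
    simp only [φ]
    exact min_eq_left (le_max_of_le_right (by nlinarith))
  have hhi : ∀ s, 1 ≤ s → φ s = s := fun s hs => by
    simp only [φ]
    exact min_eq_left (le_max_of_le_left (by linarith))
  refine AmbientIsotopic.of_reparam _ _ φ (by fun_prop) ?_ hlo hhi ?_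
  · intro a b hab
    simp only [φ]
    exact min_lt_min hab (max_lt_max (by linarith) (by nlinarith))
  · intro z s
    simp only [Cobordism.comp]
    rw [mem_stack]
    simp only [Cobordism.id, mem_prod, mem_Icc]
    rcases lt_or_ge s 0 with hs | hs
    · rw [hlo s hs.le]
      constructor
      · rintro (hh | hh)
        · linarith [hh.2.1]
        · linarith [(S.mem_bounds hh).2.1]
      · intro hh
        linarith [(S.mem_bounds hh).2.1]
    rcases lt_or_ge 1 s with hs1 | hs1
    · rw [hhi s hs1.le]
      constructor
      · rintro (hh | hh)
        · linarith [hh.2.2]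
        · linarith [(S.mem_bounds hh).2.2]
      · intro hh
        linarith [(S.mem_bounds hh).2.2]
    rcases le_total s ((1 + ε) / 2) with h2 | h2
    · obtain ⟨h3, h4⟩ := hmid s hs h2
      rw [h3, he _ (by positivity) h4]
      constructor
      · rintro (hh | hh)
        · exact hh.1
        · exact (he _ (S.mem_bounds hh).2.1 (by linarith) z).1 hh
      · intro hh
        rcases le_total s (1 / 2) with h5 | h5
        · exact Or.inl ⟨hh, by linarith, by linarith⟩
        · exact Or.inr ((he _ (by linarith) (by linarith) z).2 hh)
    · rw [hup s h2 hs1]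
      refine or_iff_right fun hh => ?_
      linarith [hh.2.2]

theorem Cobordism.comp_id_isotopic {k : ℕ} {O O' : Smoothing k} (S : Cobordism O O') :
    AmbientIsotopic (S.comp (Cobordism.id O')).carrier S.carrier := by
  obtain ⟨ε, e0, e1, he⟩ := S.top_eps
  let c : ℝ := 2 * ε / (1 + ε)
  have hc0 : 0 < c := by positivity
  have hc1 : c ≤ 1 := by simp only [c]; rw [div_le_one (by positivity)]; linarith
  have hc : c * (1 + ε) = 2 * ε := by simp only [c]; field_simp
  let φ : ℝ → ℝ := fun s => max s (min (2 * s) (1 - c * (1 - s)))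
  have hmid : ∀ s, s ≤ 1 → (1 - ε) / 2 ≤ s → φ s = 1 - c * (1 - s) ∧ c * (1 - s) ≤ ε := by
    intro s hs hs'
    have h1 : c * (1 - s) ≤ c * ((1 + ε) / 2) := by gcongr; linarith
    have h2 : s ≤ 1 - c * (1 - s) := by nlinarith
    have h3 : 1 - c * (1 - s) ≤ 2 * s := by nlinarith
    exact ⟨by simp only [φ]; rw [min_eq_right h3, max_eq_right h2], by linarith⟩
  have hup : ∀ s, 0 ≤ s → s ≤ (1 - ε) / 2 → φ s = 2 * s := by
    intro s hs hs'
    have h3 : 2 * s ≤ 1 - c * (1 - s) := by nlinarith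
    simp only [φ]; rw [min_eq_left h3, max_eq_right (by linarith)]
  have hlo : ∀ s, s ≤ 0 → φ s = s := fun s hs => by
    simp only [φ]
    exact max_eq_left (min_le_of_left_le (by linarith))
  have hhi : ∀ s, 1 ≤ s → φ s = s := fun s hs => by
    simp only [φ]
    exact max_eq_left (min_le_of_right_le (by nlinarith))
  refine AmbientIsotopic.of_reparam _ _ φ (by fun_prop) ?_ hlo hhi ?_
  · intro a b hab
    simp only [φ]
    exact max_lt_max hab (min_lt_min (by linarith) (by nlinarith))
  · intro z s
    simp only [Cobordism.comp]
    rw [mem_stack]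
    simp only [Cobordism.id, mem_prod, mem_Icc]
    rcases lt_or_ge s 0 with hs | hs
    · rw [hlo s hs.le]
      constructor
      · rintro (hh | hh)
        · linarith [(S.mem_bounds hh).2.1]
        · linarith [hh.2.1]
      · intro hh
        linarith [(S.mem_bounds hh).2.1]
    rcases lt_or_ge 1 s with hs1 | hs1
    · rw [hhi s hs1.le]
      constructor
      · rintro (hh | hh)
        · linarith [(S.mem_bounds hh).2.2]
        · linarith [hh.2.2]
      · intro hh
        linarith [(S.mem_bounds hh).2.2]
    rcases le_total ((1 - ε) / 2) s with h2 | h2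
    · obtain ⟨h3, h4⟩ := hmid s hs1 h2
      rw [h3, he (1 - c * (1 - s)) (by linarith) (by nlinarith)]
      constructor
      · rintro (hh | hh)
        · exact (he _ (by linarith) (S.mem_bounds hh).2.2 z).1 hh
        · exact hh.1
      · intro hh
        rcases le_total s (1 / 2) with h5 | h5
        · exact Or.inl ((he _ (by linarith) (by linarith) z).2 hh)
        · exact Or.inr ⟨hh, by linarith, by linarith⟩
    · rw [hup s hs h2]
      refine or_iff_left fun hh => ?_
      linarith [hh.2.1]

/-! ### The local relations -/

/-- The unit sphere in three-space. -/
def stdSphere : Set (ℂ × ℝ) := {p | ‖p.1‖ ^ 2 + p.2 ^ 2 = 1}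

/-- A torus of revolution in three-space. -/
def stdTorus : Set (ℂ × ℝ) := {p | (‖p.1‖ - 2) ^ 2 + p.2 ^ 2 = 1}

/-- `Σ` is isotopic in the cylinder to a rescaled copy of the model surface `M`. -/
def IsotopicToModel (M Sg : Set (ℂ × ℝ)) : Prop :=
  ∃ (c w : ℂ) (α β : ℝ), w ≠ 0 ∧ α ≠ 0 ∧ place c w α β '' M ⊆ openCyl ∧
    AmbientIsotopic Sg (place c w α β '' M)

/-- The model ball for the relation `4Tu`. -/
def tuBall : Set (ℂ × ℝ) := {p | |p.1.re| ≤ 2 ∧ |p.1.im| ≤ 2 ∧ 0 ≤ p.2 ∧ p.2 ≤ 2}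

/-- The model disk in `tuBall`: a hemisphere of radius `1/2` over the point `q` of the bottom. -/
def tuDisk (q : ℂ) : Set (ℂ × ℝ) := {p | ‖p.1 - q‖ ^ 2 + p.2 ^ 2 = 1 / 4 ∧ 0 ≤ p.2}

/-- The model tube in `tuBall`, joining the boundary circles of `tuDisk q` and `tuDisk q'` for
points `q`, `q'` at distance `2`: the upper half of a torus of revolution. -/
def tuTube (q q' : ℂ) : Set (ℂ × ℝ) :=
  {p | (√(((p.1 - (q + q') / 2) / ((q' - q) / 2)).re ^ 2 + p.2 ^ 2) - 1) ^ 2 +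
      ((p.1 - (q + q') / 2) / ((q' - q) / 2)).im ^ 2 = 1 / 4 ∧ 0 ≤ p.2}

/-- The centres of the four model disks: the corners of a square, in the cyclic order
`1, 2, 4, 3`. -/
def tuCentre : Fin 4 → ℂ :=
  ![-1 + Complex.I, 1 + Complex.I, -1 - Complex.I, 1 - Complex.I]

/-- `C` meets a (tame, embedded) ball in four disks `D₁, D₂, D₃, D₄`, and `Cij` is the result of
replacing the disks `Dᵢ` and `Dⱼ` by a tube inside the ball. Here `D₁, …, D₄` are the disks with
indices `0, …, 3`. -/
def IsFourTube (C C₁₂ C₃₄ C₁₃ C₂₄ : Set (ℂ × ℝ)) : Prop :=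
  ∃ (e : OpenPartialHomeomorph (ℂ × ℝ) (ℂ × ℝ)) (E : Set (ℂ × ℝ)),
    tuBall ⊆ e.source ∧ e '' tuBall ⊆ openCyl ∧ Disjoint E (e '' tuBall) ∧
    C = E ∪ e '' (tuDisk (tuCentre 0) ∪ tuDisk (tuCentre 1) ∪ tuDisk (tuCentre 2) ∪
      tuDisk (tuCentre 3)) ∧
    C₁₂ = E ∪ e '' (tuTube (tuCentre 0) (tuCentre 1) ∪ tuDisk (tuCentre 2) ∪
      tuDisk (tuCentre 3)) ∧
    C₃₄ = E ∪ e '' (tuTube (tuCentre 2) (tuCentre 3) ∪ tuDisk (tuCentre 0) ∪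
      tuDisk (tuCentre 1)) ∧
    C₁₃ = E ∪ e '' (tuTube (tuCentre 0) (tuCentre 2) ∪ tuDisk (tuCentre 1) ∪
      tuDisk (tuCentre 3)) ∧
    C₂₄ = E ∪ e '' (tuTube (tuCentre 1) (tuCentre 3) ∪ tuDisk (tuCentre 0) ∪
      tuDisk (tuCentre 2))

/-- The defining relations between formal sums of cobordisms: isotopic cobordisms are equal, and
the relations `S`, `T` and `4Tu`. -/
inductive LocalRel {k : ℕ} {O O' : Smoothing k} : (Cobordism O O' →₀ ℤ) → Prop
  | isotopy (S S' : Cobordism O O') (h : AmbientIsotopic S.carrier S'.carrier) :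
      LocalRel (Finsupp.single S 1 - Finsupp.single S' 1)
  | sphere (S S' : Cobordism O O') (Sg : Set (ℂ × ℝ)) (hS : S.carrier = S'.carrier ∪ Sg)
      (hd : Disjoint S'.carrier Sg) (h : IsotopicToModel stdSphere Sg) :
      LocalRel (Finsupp.single S 1)
  | torus (S S' : Cobordism O O') (Sg : Set (ℂ × ℝ)) (hS : S.carrier = S'.carrier ∪ Sg)
      (hd : Disjoint S'.carrier Sg) (h : IsotopicToModel stdTorus Sg) :
      LocalRel (Finsupp.single S 1 - Finsupp.single S' 2)
  | fourTube (S S₁₂ S₃₄ S₁₃ S₂₄ : Cobordism O O')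
      (h : IsFourTube S.carrier S₁₂.carrier S₃₄.carrier S₁₃.carrier S₂₄.carrier) :
      LocalRel (Finsupp.single S₁₂ 1 + Finsupp.single S₃₄ 1 - Finsupp.single S₁₃ 1 -
        Finsupp.single S₂₄ 1)

theorem AmbientIsotopic.place {S S' : Set (ℂ × ℝ)} (h : AmbientIsotopic S S') {c w : ℂ} {α β : ℝ}
    (hw : w ≠ 0) (hα : α ≠ 0) (hc : MapsTo (place c w α β) openCyl openCyl) {R : Set (ℂ × ℝ)}
    (hR : Disjoint (BarNatan.place c w α β '' openCyl) R) :
    AmbientIsotopic (BarNatan.place c w α β '' S ∪ R) (BarNatan.place c w α β '' S' ∪ R) := by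
  obtain ⟨H, hH, h0, hid, h1⟩ := h
  let a := placeHomeo c w α β hw hα
  have ha : ∀ p, a p = BarNatan.place c w α β p := fun _ => rfl
  have hfix : ∀ t p, p ∉ BarNatan.place c w α β '' openCyl → a (H t (a.symm p)) = p := by
    intro t p hp
    rw [hid t _ (fun hh => hp ⟨_, hh, by rw [← ha, a.apply_symm_apply]⟩), a.apply_symm_apply]
  refine ⟨fun t => (a.symm.trans (H t)).trans a, ?_, ?_, ?_, ?_⟩
  · have : Continuous fun q : unitInterval × (ℂ × ℝ) => a (H q.1 (a.symm q.2)) :=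
      a.continuous.comp (hH.comp (continuous_fst.prodMk (a.symm.continuous.comp continuous_snd)))
    exact this
  · intro p
    change a (H 0 (a.symm p)) = p
    rw [h0, a.apply_symm_apply]
  · intro t p hp
    refine hfix t p fun hh => hp ?_
    obtain ⟨q, hq, rfl⟩ := hh
    exact hc hq
  · rw [image_union]
    congr 1
    · rw [← h1, image_image, image_image]
      refine image_congr fun p _ => ?_
      change a (H 1 (a.symm (a p))) = a (H 1 p)
      rw [a.symm_apply_apply]
    · ext p
      constructor
      · rintro ⟨q, hq, rfl⟩
        change a (H 1 (a.symm q)) ∈ R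
        rwa [hfix 1 q fun hh => disjoint_left.1 hR hh hq]
      · intro hp
        exact ⟨p, hp, hfix 1 p fun hh => disjoint_left.1 hR hh hp⟩

theorem AmbientIsotopic.subset_openCyl {S S' : Set (ℂ × ℝ)} (h : AmbientIsotopic S S')
    (hS : S' ⊆ openCyl) : S ⊆ openCyl := by
  obtain ⟨H, hH, h0, hid, h1⟩ := h
  intro p hp
  by_contra hpc
  have : H 1 p ∈ S' := h1 ▸ mem_image_of_mem _ hp
  rw [hid 1 p hpc] at this
  exact hpc (hS this)

theorem IsotopicToModel.subset_openCyl {M Sg : Set (ℂ × ℝ)} (h : IsotopicToModel M Sg) :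
    Sg ⊆ openCyl := by
  obtain ⟨c, w, α, β, -, -, hM, h⟩ := h
  exact h.subset_openCyl hM

theorem IsotopicToModel.place {M Sg : Set (ℂ × ℝ)} (h : IsotopicToModel M Sg) {c w : ℂ} {α β : ℝ}
    (hw : w ≠ 0) (hα : α ≠ 0) (hc : MapsTo (place c w α β) openCyl openCyl) :
    IsotopicToModel M (BarNatan.place c w α β '' Sg) := by
  obtain ⟨c', w', α', β', hw', hα', hM, h⟩ := h
  have key : BarNatan.place (c + w * c') (w * w') (α * α') (α * β' + β) '' M =
      BarNatan.place c w α β '' (BarNatan.place c' w' α' β' '' M) := by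
    rw [image_image]
    exact image_congr fun p _ => (place_place _ _ _ _ _ _ _ _ p).symm
  refine ⟨c + w * c', w * w', α * α', α * β' + β, mul_ne_zero hw hw', mul_ne_zero hα hα', ?_, ?_⟩
  · rw [key]
    exact (image_mono hM).trans hc.image_subset
  · rw [key]
    simpa using h.place hw hα hc (disjoint_empty _)

theorem disjoint_glue {a : ℂ × ℝ ≃ₜ ℂ × ℝ} {S T R : Set (ℂ × ℝ)} (h : Disjoint S T)
    (hT : T ⊆ openCyl) (hR : Disjoint (a '' openCyl) R) : Disjoint (a '' S ∪ R) (a '' T) :=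
  Disjoint.union_left ((disjoint_image_iff a.injective).2 h) (hR.mono_left (image_mono hT)).symm

/-- The local relations are preserved when cobordisms are placed in a smaller cylinder whose
complement is filled in some fixed way. -/
theorem LocalRel.glue {k m : ℕ} {O O' : Smoothing k} {P P' : Smoothing m}
    (F : Cobordism O O' → Cobordism P P') {c w : ℂ} {α β : ℝ}
    (hw : w ≠ 0) (hα : α ≠ 0) (hc : MapsTo (place c w α β) openCyl openCyl) {R : Set (ℂ × ℝ)}
    (hR : Disjoint (BarNatan.place c w α β '' openCyl) R)
    (hF : ∀ S, (F S).carrier = BarNatan.place c w α β '' S.carrier ∪ R)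
    {x : Cobordism O O' →₀ ℤ} (hx : LocalRel x) : LocalRel (Finsupp.lmapDomain ℤ ℤ F x) := by
  have key : ∀ S T Sg : Set (ℂ × ℝ), S = T ∪ Sg →
      BarNatan.place c w α β '' S ∪ R =
        BarNatan.place c w α β '' T ∪ R ∪ BarNatan.place c w α β '' Sg := by
    rintro S T Sg rfl
    rw [image_union, union_right_comm]
  cases hx with
  | isotopy S S' h =>
    simp only [map_sub, Finsupp.lmapDomain_apply, Finsupp.mapDomain_single]
    refine LocalRel.isotopy _ _ ?_
    rw [hF, hF]
    exact h.place hw hα hc hR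
  | sphere S S' Sg hS hd h =>
    simp only [Finsupp.lmapDomain_apply, Finsupp.mapDomain_single]
    refine LocalRel.sphere _ (F S') (BarNatan.place c w α β '' Sg) ?_ ?_ (h.place hw hα hc)
    · rw [hF, hF]
      exact key _ _ _ hS
    · rw [hF]
      exact disjoint_glue (a := placeHomeo c w α β hw hα) hd h.subset_openCyl hR
  | torus S S' Sg hS hd h =>
    simp only [map_sub, Finsupp.lmapDomain_apply, Finsupp.mapDomain_single]
    refine LocalRel.torus _ (F S') (BarNatan.place c w α β '' Sg) ?_ ?_ (h.place hw hα hc)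
    · rw [hF, hF]
      exact key _ _ _ hS
    · rw [hF]
      exact disjoint_glue (a := placeHomeo c w α β hw hα) hd h.subset_openCyl hR
  | fourTube S S₁₂ S₃₄ S₁₃ S₂₄ h =>
    simp only [map_sub, map_add, Finsupp.lmapDomain_apply, Finsupp.mapDomain_single]
    refine LocalRel.fourTube (F S) _ _ _ _ ?_
    obtain ⟨e, E, he, hec, hE, h0, h1, h2, h3, h4⟩ := h
    have hcomp : ∀ X : Set (ℂ × ℝ), e.transHomeomorph (placeHomeo c w α β hw hα) '' X =
        BarNatan.place c w α β '' (e '' X) := fun X =>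
      (image_image (BarNatan.place c w α β) e X).symm
    refine ⟨e.transHomeomorph (placeHomeo c w α β hw hα), BarNatan.place c w α β '' E ∪ R,
      he, ?_, ?_, ?_⟩
    · rw [hcomp]
      exact (image_mono hec).trans hc.image_subset
    · rw [hcomp]
      exact disjoint_glue (a := placeHomeo c w α β hw hα) hE hec hR
    · simp only [hF, hcomp]
      exact ⟨key _ _ _ h0, key _ _ _ h1, key _ _ _ h2, key _ _ _ h3, key _ _ _ h4⟩

/-! ### The category `Cob` modulo the local relations -/

/-- The span of the local relations. -/
def relSpan {k : ℕ} (O O' : Smoothing k) : Submodule ℤ (Cobordism O O' →₀ ℤ) :=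
  Submodule.span ℤ {x | LocalRel x}

/-- Morphisms of the preadditive category of smoothings and cobordisms: the free abelian group on
cobordisms, modulo isotopy and the local relations. -/
abbrev CobHom {k : ℕ} (O O' : Smoothing k) : Type := (Cobordism O O' →₀ ℤ) ⧸ relSpan O O'

/-- The class of a cobordism. -/
def Cobordism.cls {k : ℕ} {O O' : Smoothing k} (S : Cobordism O O') : CobHom O O' :=
  (relSpan O O').mkQ (Finsupp.single S 1)

theorem Cobordism.cls_eq {k : ℕ} {O O' : Smoothing k} {S S' : Cobordism O O'}
    (h : AmbientIsotopic S.carrier S'.carrier) : S.cls = S'.cls :=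
  (Submodule.Quotient.eq _).2 (Submodule.subset_span (LocalRel.isotopy S S' h))

theorem CobHom.lin_ext {k : ℕ} {O O' : Smoothing k} {A : Type*} [AddCommGroup A] [Module ℤ A]
    {f g : CobHom O O' →ₗ[ℤ] A} (h : ∀ S : Cobordism O O', f S.cls = g S.cls) : f = g := by
  refine Submodule.linearMap_qext _ (Finsupp.lhom_ext' fun S => LinearMap.ext_ring ?_)
  exact h S

theorem relSpan_glue {k m : ℕ} {O O' : Smoothing k} {P P' : Smoothing m}
    (F : Cobordism O O' → Cobordism P P') {c w : ℂ} {α β : ℝ}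
    (hw : w ≠ 0) (hα : α ≠ 0) (hc : MapsTo (place c w α β) openCyl openCyl) {R : Set (ℂ × ℝ)}
    (hR : Disjoint (place c w α β '' openCyl) R)
    (hF : ∀ S, (F S).carrier = place c w α β '' S.carrier ∪ R) :
    relSpan O O' ≤ (relSpan P P').comap (Finsupp.lmapDomain ℤ ℤ F) :=
  Submodule.span_le.2 fun _ hx => Submodule.subset_span (LocalRel.glue F hw hα hc hR hF hx)

theorem relSpan_comp_right {k : ℕ} {O O' O'' : Smoothing k} (S : Cobordism O O') :
    relSpan O' O'' ≤ (relSpan O O'').comap (Finsupp.lmapDomain ℤ ℤ fun S' => S.comp S') := by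
  refine relSpan_glue _ (c := 0) (w := 1) (α := 1 / 2) (β := 1 / 2) one_ne_zero (by norm_num) ?_ ?_
    fun S' => union_comm (place 0 1 (1 / 2) 0 '' S.carrier) _
  · rintro ⟨z, s⟩ ⟨hz, hs⟩
    refine ⟨by simpa [place] using hz, ?_, ?_⟩
    · have : 0 < s := hs.1
      simp only [place]; linarith
    · have : s < 1 := hs.2
      simp only [place]; linarith
  · rw [disjoint_left]
    rintro _ ⟨q, hq, rfl⟩ ⟨p, hp, hpq⟩
    have h1 := (S.mem_bounds (z := p.1) (s := p.2) hp).2.2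
    have h2 : 0 < q.2 := hq.2.1
    have h3 := congrArg Prod.snd hpq
    simp only [place] at h3
    linarith

theorem relSpan_comp_left {k : ℕ} {O O' O'' : Smoothing k} (S' : Cobordism O' O'') :
    relSpan O O' ≤ (relSpan O O'').comap (Finsupp.lmapDomain ℤ ℤ fun S => S.comp S') := by
  refine relSpan_glue _ (c := 0) (w := 1) (α := 1 / 2) (β := 0) one_ne_zero (by norm_num) ?_ ?_
    fun S => rfl
  · rintro ⟨z, s⟩ ⟨hz, hs⟩
    refine ⟨by simpa [place] using hz, ?_, ?_⟩
    · have : 0 < s := hs.1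
      simp only [place]; linarith
    · have : s < 1 := hs.2
      simp only [place]; linarith
  · rw [disjoint_left]
    rintro _ ⟨q, hq, rfl⟩ ⟨p, hp, hpq⟩
    have h1 := (S'.mem_bounds (z := p.1) (s := p.2) hp).2.1
    have h2 : q.2 < 1 := hq.2.2
    have h3 := congrArg Prod.snd hpq
    simp only [place] at h3
    linarith

/-- Bilinear composition of classes of cobordisms. -/
def CobHom.comp {k : ℕ} {O O' O'' : Smoothing k} :
    CobHom O O' →ₗ[ℤ] CobHom O' O'' →ₗ[ℤ] CobHom O O'' :=
  (relSpan O O').liftQ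
    (Finsupp.lift _ ℤ _ fun S => (relSpan O' O'').mapQ (relSpan O O'')
      (Finsupp.lmapDomain ℤ ℤ fun S' => S.comp S') (relSpan_comp_right S)) (by
    intro x hx
    rw [LinearMap.mem_ker]
    refine CobHom.lin_ext fun S' => ?_
    have h1 : (relSpan O O'').mkQ (Finsupp.lmapDomain ℤ ℤ (fun S => S.comp S') x) = 0 :=
      (Submodule.Quotient.mk_eq_zero _).2 (relSpan_comp_left (O'' := O'') S' hx)
    rw [LinearMap.zero_apply]
    refine Eq.trans ?_ h1
    clear h1 hx
    induction x using Finsupp.induction_linear with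
    | zero => simp
    | add f g hf hg => rw [map_add, LinearMap.add_apply, hf, hg, map_add, map_add]
    | single S n =>
      simp only [Finsupp.lift_apply, Finsupp.lmapDomain_apply, Finsupp.mapDomain_single,
        Finsupp.sum_single_index, zero_smul, LinearMap.smul_apply, Cobordism.cls,
        Submodule.mkQ_apply, Submodule.mapQ_apply]
      rw [← Submodule.Quotient.mk_smul, Finsupp.smul_single, smul_eq_mul, mul_one])

theorem CobHom.comp_cls {k : ℕ} {O O' O'' : Smoothing k} (S : Cobordism O O')
    (S' : Cobordism O' O'') : CobHom.comp S.cls S'.cls = (S.comp S').cls := by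
  simp [CobHom.comp, Cobordism.cls]

theorem CobHom.id_comp {k : ℕ} {O O' : Smoothing k} (f : CobHom O O') :
    CobHom.comp (Cobordism.id O).cls f = f := by
  have : CobHom.comp (Cobordism.id O).cls = (LinearMap.id : CobHom O O' →ₗ[ℤ] _) :=
    CobHom.lin_ext fun S => by
      rw [CobHom.comp_cls, LinearMap.id_apply, Cobordism.cls_eq S.id_comp_isotopic]
  exact LinearMap.congr_fun this f

theorem CobHom.comp_id {k : ℕ} {O O' : Smoothing k} (f : CobHom O O') :
    CobHom.comp f (Cobordism.id O').cls = f := by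
  have : CobHom.comp.flip (Cobordism.id O').cls = (LinearMap.id : CobHom O O' →ₗ[ℤ] _) :=
    CobHom.lin_ext fun S => by
      rw [LinearMap.flip_apply, CobHom.comp_cls, LinearMap.id_apply,
        Cobordism.cls_eq S.comp_id_isotopic]
  exact LinearMap.congr_fun this f

theorem CobHom.assoc {k : ℕ} {O₁ O₂ O₃ O₄ : Smoothing k} (f : CobHom O₁ O₂) (g : CobHom O₂ O₃)
    (h : CobHom O₃ O₄) :
    CobHom.comp (CobHom.comp f g) h = CobHom.comp f (CobHom.comp g h) := by
  have : (CobHom.comp (O := O₁) (O' := O₂) (O'' := O₃)).compr₂ (CobHom.comp (O'' := O₄)) =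
      (((LinearMap.llcomp ℤ _ _ _).comp (CobHom.comp (O := O₁) (O' := O₂))).flip.comp
        (CobHom.comp (O := O₂) (O' := O₃) (O'' := O₄))).flip := by
    refine CobHom.lin_ext fun S₁ => CobHom.lin_ext fun S₂ => CobHom.lin_ext fun S₃ => ?_
    simp only [LinearMap.compr₂_apply, LinearMap.flip_apply, LinearMap.comp_apply,
      LinearMap.llcomp_apply, CobHom.comp_cls]
    exact Cobordism.cls_eq (Cobordism.assoc_isotopic S₁ S₂ S₃)
  exact LinearMap.congr_fun (LinearMap.congr_fun (LinearMap.congr_fun this f) g) h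

theorem CobHom.add_comp {k : ℕ} {O O' O'' : Smoothing k} (f f' : CobHom O O')
    (g : CobHom O' O'') :
    CobHom.comp (f + f') g = CobHom.comp f g + CobHom.comp f' g := by
  rw [map_add, LinearMap.add_apply]

theorem CobHom.comp_add {k : ℕ} {O O' O'' : Smoothing k} (f : CobHom O O')
    (g g' : CobHom O' O'') :
    CobHom.comp f (g + g') = CobHom.comp f g + CobHom.comp f g' :=
  map_add _ _ _

/-- The category of smoothings with boundary the `k` marked points, with cobordisms modulo
isotopy and the local relations `S`, `T` and `4Tu` as morphisms. -/
abbrev Cobl (k : ℕ) : Type := Smoothing k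

instance (k : ℕ) : Category (Cobl k) where
  Hom O O' := CobHom O O'
  id O := (Cobordism.id O).cls
  comp f g := CobHom.comp f g
  id_comp f := CobHom.id_comp f
  comp_id f := CobHom.comp_id f
  assoc f g h := CobHom.assoc f g h

instance {k : ℕ} (O O' : Cobl k) : AddCommGroup (O ⟶ O') :=
  inferInstanceAs (AddCommGroup (CobHom O O'))

instance (k : ℕ) : Preadditive (Cobl k) where
  add_comp _ _ _ f f' g := CobHom.add_comp f f' g
  comp_add _ _ _ f g g' := CobHom.comp_add f g g'

/-! ### Planar arc diagrams -/

/-- A planar arc diagram with `d` inputs. The output disk is the unit disk with base point `1`. The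
`i`-th input disk is the round disk with centre `c i` parametrised by the unit disk via
`z ↦ c i + w i * z`, so that its radius is `‖w i‖` and its base point is `c i + w i`. The arcs form a
compact one-dimensional locally flat submanifold of the complement of the open input disks, meeting
the boundary circles transversely (radially near the circles), exactly in the marked points. -/
@[ext]
structure PlanarArcDiagram {d : ℕ} (κ : Fin d → ℕ) (k : ℕ) where
  c : Fin d → ℂ
  w : Fin d → ℂ
  w_ne : ∀ i, w i ≠ 0
  inside : ∀ i, ‖c i‖ + ‖w i‖ < 1
  disj : ∀ i j, i ≠ j → ‖w i‖ + ‖w j‖ < ‖c i - c j‖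
  arcs : Set ℂ
  arcs_subset : ∀ z ∈ arcs, ‖z‖ ≤ 1 ∧ ∀ i, ‖w i‖ ≤ ‖z - c i‖
  isClosed : IsClosed arcs
  outer : ∀ᶠ r in 𝓝[≤] (1 : ℝ), ∀ z : ℂ, ‖z‖ = r → (z ∈ arcs ↔ z ∈ rays k)
  inner : ∀ i, ∀ᶠ r in 𝓝[≥] (1 : ℝ), ∀ z : ℂ, ‖z‖ = r → (c i + w i * z ∈ arcs ↔ z ∈ rays (κ i))
  flat : ∀ z ∈ arcs, ‖z‖ < 1 → (∀ i, ‖w i‖ < ‖z - c i‖) → LocFlatAt flatLine arcs z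

namespace PlanarArcDiagram

variable {d : ℕ} {κ : Fin d → ℕ} {k : ℕ} (D : PlanarArcDiagram κ k)

/-- The arcs of `D` together with copies of subsets of the unit disk placed in the holes of `D`. -/
def fill (U : Fin d → Set ℂ) : Set ℂ := D.arcs ∪ ⋃ i, (fun z => D.c i + D.w i * z) '' U i

theorem mem_fill {U : Fin d → Set ℂ} {y : ℂ} :
    y ∈ D.fill U ↔ y ∈ D.arcs ∨ ∃ i, (y - D.c i) / D.w i ∈ U i := by
  simp only [fill, mem_union, mem_iUnion]
  refine or_congr_right (exists_congr fun i => ⟨?_, fun h => ⟨_, h, ?_⟩⟩)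
  · rintro ⟨z, hz, rfl⟩
    simpa [D.w_ne i] using hz
  · simp [mul_div_cancel₀ _ (D.w_ne i)]

theorem norm_coord (i : Fin d) (y : ℂ) : ‖(y - D.c i) / D.w i‖ = ‖y - D.c i‖ / ‖D.w i‖ :=
  norm_div _ _

theorem norm_coord_le (i : Fin d) {y : ℂ} : ‖(y - D.c i) / D.w i‖ ≤ 1 ↔ ‖y - D.c i‖ ≤ ‖D.w i‖ := by
  rw [norm_coord, div_le_one (norm_pos_iff.2 (D.w_ne i))]

theorem norm_coord_lt (i : Fin d) {y : ℂ} : ‖(y - D.c i) / D.w i‖ < 1 ↔ ‖y - D.c i‖ < ‖D.w i‖ := by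
  rw [norm_coord, div_lt_one (norm_pos_iff.2 (D.w_ne i))]

theorem outside_other {i j : Fin d} (hij : i ≠ j) {y : ℂ} (h : ‖y - D.c i‖ ≤ ‖D.w i‖) :
    ‖D.w j‖ < ‖y - D.c j‖ := by
  have h1 := D.disj i j hij
  have h2 : ‖D.c i - D.c j‖ ≤ ‖y - D.c i‖ + ‖y - D.c j‖ := by
    have := norm_sub_le (y - D.c j) (y - D.c i)
    rw [sub_sub_sub_cancel_left] at this
    linarith
  linarith

theorem mem_fill_outside {U : Fin d → Set ℂ} (hU : ∀ i, ∀ z ∈ U i, ‖z‖ ≤ 1) {y : ℂ}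
    (h : ∀ i, ‖D.w i‖ < ‖y - D.c i‖) : y ∈ D.fill U ↔ y ∈ D.arcs := by
  rw [mem_fill]
  refine or_iff_left ?_
  rintro ⟨i, hi⟩
  exact absurd ((D.norm_coord_le i).1 (hU i _ hi)) (not_le.2 (h i))

theorem mem_fill_inside {U : Fin d → Set ℂ} (hU : ∀ i, ∀ z ∈ U i, ‖z‖ ≤ 1) {y : ℂ} {i : Fin d}
    (h : ‖y - D.c i‖ < ‖D.w i‖) : y ∈ D.fill U ↔ (y - D.c i) / D.w i ∈ U i := by
  rw [mem_fill]
  constructor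
  · rintro (hy | ⟨j, hj⟩)
    · exact absurd ((D.arcs_subset y hy).2 i) (not_le.2 h)
    · by_cases hij : i = j
      · rwa [hij]
      · exact absurd ((D.norm_coord_le j).1 (hU j _ hj)) (not_le.2 (D.outside_other hij h.le))
  · exact fun hy => Or.inr ⟨i, hy⟩

/-- Near the boundary circle of an input disk, the filled diagram is radial. -/
theorem exists_fill_circle (i : Fin d) {ρ : ℝ} (hρ : ρ < 1) {y : ℂ}
    (hy : ‖y - D.c i‖ = ‖D.w i‖) : ∀ᶠ x in 𝓝 y, ∀ U : Fin d → Set ℂ, (∀ j, ∀ z ∈ U j, ‖z‖ ≤ 1) →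
      (∀ z : ℂ, ρ ≤ ‖z‖ → ‖z‖ ≤ 1 → (z ∈ U i ↔ z ∈ rays (κ i))) →
      (x ∈ D.fill U ↔ (x - D.c i) / D.w i ∈ rays (κ i)) := by
  obtain ⟨σ, hσ, hin⟩ := mem_nhdsGE_iff_exists_Icc_subset.1 (D.inner i)
  have hσ' : 1 < σ := hσ
  have hcont : Continuous fun x => ‖(x - D.c i) / D.w i‖ := by fun_prop
  have h1 : ‖(y - D.c i) / D.w i‖ = 1 := by
    rw [norm_coord, hy, div_self (norm_ne_zero_iff.2 (D.w_ne i))]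
  have e1 : ∀ᶠ x in 𝓝 y, ‖(x - D.c i) / D.w i‖ ∈ Ioo ρ σ :=
    hcont.continuousAt.preimage_mem_nhds (Ioo_mem_nhds (by rw [h1]; exact hρ) (by rw [h1]; exact hσ'))
  have e2 : ∀ᶠ x in 𝓝 y, ∀ j, i ≠ j → ‖D.w j‖ < ‖x - D.c j‖ := by
    refine Filter.eventually_all.2 fun j => ?_
    by_cases hij : i = j
    · exact Filter.Eventually.of_forall fun x h => absurd hij h
    have hc : Continuous fun x => ‖x - D.c j‖ := by fun_prop
    filter_upwards [hc.continuousAt.preimage_mem_nhds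
      (Ioi_mem_nhds (D.outside_other hij hy.le))] with x hx _ using hx
  filter_upwards [e1, e2] with x hx1 hx2 U hU hUi
  have hmul : D.c i + D.w i * ((x - D.c i) / D.w i) = x := by
    rw [mul_div_cancel₀ _ (D.w_ne i)]; ring
  rw [mem_fill]
  have harc : 1 ≤ ‖(x - D.c i) / D.w i‖ → (x ∈ D.arcs ↔ (x - D.c i) / D.w i ∈ rays (κ i)) := by
    intro h
    have := hin ⟨h, hx1.2.le⟩ _ rfl
    rwa [hmul] at this
  constructor
  · rintro (h | ⟨j, hj⟩)
    · refine (harc ?_).1 h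
      rw [norm_coord, one_le_div (norm_pos_iff.2 (D.w_ne i))]
      exact (D.arcs_subset x h).2 i
    · by_cases hij : i = j
      · subst hij
        exact (hUi _ hx1.1.le (hU _ _ hj)).1 hj
      · exact absurd ((D.norm_coord_le j).1 (hU j _ hj)) (not_le.2 (hx2 j hij))
  · intro h
    rcases le_total 1 ‖(x - D.c i) / D.w i‖ with h2 | h2
    · exact Or.inl ((harc h2).2 h)
    · exact Or.inr ⟨i, (hUi _ hx1.1.le h2).2 h⟩

theorem eventually_outside {y : ℂ} (h : ∀ i, ‖D.w i‖ < ‖y - D.c i‖) :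
    ∀ᶠ x in 𝓝 y, ∀ i, ‖D.w i‖ < ‖x - D.c i‖ := by
  refine Filter.eventually_all.2 fun j => ?_
  have hc : Continuous fun x => ‖x - D.c j‖ := by fun_prop
  exact hc.continuousAt.preimage_mem_nhds (Ioi_mem_nhds (h j))

theorem eventually_inside {y : ℂ} {i : Fin d} (h : ‖y - D.c i‖ < ‖D.w i‖) :
    ∀ᶠ x in 𝓝 y, ‖x - D.c i‖ < ‖D.w i‖ := by
  have hc : Continuous fun x => ‖x - D.c i‖ := by fun_prop
  exact hc.continuousAt.preimage_mem_nhds (Iio_mem_nhds h)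

theorem eventually_outer : ∀ᶠ r in 𝓝[≤] (1 : ℝ), ∀ y : ℂ, ‖y‖ = r →
    ∀ i, ‖D.w i‖ < ‖y - D.c i‖ := by
  have : ∀ᶠ r in 𝓝[≤] (1 : ℝ), ∀ i, ‖D.c i‖ + ‖D.w i‖ < r :=
    Filter.eventually_all.2 fun i => nhdsWithin_le_nhds (Ioi_mem_nhds (D.inside i))
  filter_upwards [this] with r hr y hy i
  have := norm_sub_norm_le y (D.c i)
  have := hr i
  linarith

theorem fill_norm_le {U : Fin d → Set ℂ} (hU : ∀ i, ∀ z ∈ U i, ‖z‖ ≤ 1) {y : ℂ}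
    (hy : y ∈ D.fill U) : ‖y‖ ≤ 1 := by
  rcases D.mem_fill.1 hy with h | ⟨i, h⟩
  · exact (D.arcs_subset y h).1
  · have h1 := (D.norm_coord_le i).1 (hU i _ h)
    have h2 := D.inside i
    have h3 := norm_sub_norm_le y (D.c i)
    linarith

end PlanarArcDiagram

theorem Smoothing.norm_le {k : ℕ} (T : Smoothing k) : ∀ z ∈ T.carrier, ‖z‖ ≤ 1 := fun z hz => by
  simpa using T.subset_disk hz

theorem Smoothing.collar_eps {k : ℕ} (T : Smoothing k) : ∃ ρ : ℝ, 0 < ρ ∧ ρ < 1 ∧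
    ∀ z : ℂ, ρ ≤ ‖z‖ → ‖z‖ ≤ 1 → (z ∈ T.carrier ↔ z ∈ rays k) := by
  obtain ⟨u, hu, h⟩ := mem_nhdsLE_iff_exists_Icc_subset.1 T.collar
  exact ⟨max u (1 / 2), lt_max_of_lt_right (by norm_num), max_lt hu (by norm_num),
    fun z h0 h1 => h ⟨(le_max_left _ _).trans h0, h1⟩ z rfl⟩

theorem flat_rays_of {C : Set ℂ} {k : ℕ} {ρ : ℝ} (h1 : ρ < 1) (h0 : 0 < ρ)
    (h : ∀ z : ℂ, ρ ≤ ‖z‖ → ‖z‖ ≤ 1 → (z ∈ C ↔ z ∈ rays k))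
    (hf : ∀ z ∈ C, ρ < ‖z‖ → ‖z‖ < 1 → LocFlatAt flatLine C z) {x : ℂ} (hx : x ∈ rays k)
    (hx1 : ‖x‖ = 1) : LocFlatAt flatLine (rays k) x := by
  obtain ⟨t, ht0, ht1⟩ := exists_between h1
  have htpos : 0 < t := h0.trans ht0
  have hnorm : ‖(t : ℂ) * x‖ = t := by
    rw [norm_mul, hx1, mul_one, Complex.norm_real, Real.norm_of_nonneg htpos.le]
  have hmem : (t : ℂ) * x ∈ C := by
    rw [h _ (by rw [hnorm]; exact ht0.le) (by rw [hnorm]; exact ht1.le)]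
    exact (rays_smul htpos).2 hx
  have hflat : LocFlatAt flatLine (rays k) ((t : ℂ) * x) := by
    refine (hf _ hmem (by rw [hnorm]; exact ht0) (by rw [hnorm]; exact ht1)).congr ?_
    filter_upwards [continuous_norm.continuousAt.preimage_mem_nhds
      (Ioo_mem_nhds (show ρ < ‖(t : ℂ) * x‖ by rw [hnorm]; exact ht0)
        (show ‖(t : ℂ) * x‖ < 1 by rw [hnorm]; exact ht1))] with y hy
    exact h y hy.1.le hy.2.le
  have ht : (t : ℂ) ≠ 0 := by exact_mod_cast htpos.ne'
  have h2 := LocFlatAt.preimage (Homeomorph.mulLeft₀ (t : ℂ) ht) (S := rays k) (x := x) hflat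
  refine h2.congr (Filter.Eventually.of_forall fun y => ?_)
  exact rays_smul htpos

theorem Smoothing.flat_rays {k : ℕ} (T : Smoothing k) {x : ℂ} (hx : x ∈ rays k) (hx1 : ‖x‖ = 1) :
    LocFlatAt flatLine (rays k) x := by
  obtain ⟨ρ, h0, h1, h⟩ := T.collar_eps
  exact flat_rays_of h1 h0 h (fun z hz _ hz1 => T.flat z hz hz1) hx hx1

theorem flat_affine {S : Set ℂ} {c w y : ℂ} (hw : w ≠ 0)
    (h : LocFlatAt flatLine S ((y - c) / w)) :
    LocFlatAt flatLine {x | (x - c) / w ∈ S} y := by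
  let φ : ℂ ≃ₜ ℂ := (Homeomorph.subRight c).trans (Homeomorph.mulRight₀ w⁻¹ (inv_ne_zero hw))
  have hφ : ∀ x, φ x = (x - c) / w := fun x => (div_eq_mul_inv _ _).symm
  have := LocFlatAt.preimage φ (S := S) (x := y) (by rw [hφ]; exact h)
  refine this.congr (Filter.Eventually.of_forall fun x => ?_)
  rw [mem_preimage, hφ]
  rfl

namespace PlanarArcDiagram

variable {d : ℕ} {κ : Fin d → ℕ} {k : ℕ} (D : PlanarArcDiagram κ k)

/-- The action of a planar arc diagram on smoothings: smoothings are placed in the holes. -/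
def obj (T : ∀ i, Smoothing (κ i)) : Smoothing k where
  carrier := D.fill fun i => (T i).carrier
  subset_disk y hy := by simpa using D.fill_norm_le (fun i => (T i).norm_le) hy
  isClosed := by
    refine D.isClosed.union (isClosed_iUnion_of_finite fun i => ?_)
    let φ : ℂ ≃ₜ ℂ := (Homeomorph.mulLeft₀ (D.w i) (D.w_ne i)).trans (Homeomorph.addLeft (D.c i))
    exact φ.isClosed_image.2 (T i).isClosed
  collar := by
    filter_upwards [D.outer, D.eventually_outer] with r h1 h2 z hz
    rw [D.mem_fill_outside (fun i => (T i).norm_le) (h2 z hz), h1 z hz]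
  flat := by
    intro y hy hy1
    by_cases h : ∀ i, ‖D.w i‖ < ‖y - D.c i‖
    · refine (D.flat y ((D.mem_fill_outside (fun i => (T i).norm_le) h).1 hy) hy1 h).congr ?_
      filter_upwards [D.eventually_outside h] with x hx
      exact (D.mem_fill_outside (fun i => (T i).norm_le) hx).symm
    push Not at h
    obtain ⟨i, hi⟩ := h
    rcases hi.lt_or_eq with hi | hi
    · have hy' := (D.mem_fill_inside (fun i => (T i).norm_le) hi).1 hy
      refine (flat_affine (D.w_ne i) ((T i).flat _ hy' ((D.norm_coord_lt i).2 hi))).congr ?_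
      filter_upwards [D.eventually_inside hi] with x hx
      exact (D.mem_fill_inside (fun i => (T i).norm_le) hx).symm
    · obtain ⟨ρ, h0, h1, hρ⟩ := (T i).collar_eps
      have hev := D.exists_fill_circle i h1 hi
      have hy' := (hev.self_of_nhds _ (fun i => (T i).norm_le) hρ).1 hy
      have hn : ‖(y - D.c i) / D.w i‖ = 1 := by
        rw [norm_coord, hi, div_self (norm_ne_zero_iff.2 (D.w_ne i))]
      refine (flat_affine (D.w_ne i) ((T i).flat_rays hy' hn)).congr ?_
      filter_upwards [hev] with x hx
      exact (hx _ (fun i => (T i).norm_le) hρ).symm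

variable {T T' T'' : ∀ i, Smoothing (κ i)}

/-- The union of `arcs × [0,1]` with copies of the given subsets of the cylinder, placed in the
cylindrical holes of `D × [0,1]`. -/
def fillCyl (V : Fin d → Set (ℂ × ℝ)) : Set (ℂ × ℝ) :=
  D.arcs ×ˢ Icc 0 1 ∪ ⋃ i, place (D.c i) (D.w i) 1 0 '' V i

theorem mem_fillCyl {V : Fin d → Set (ℂ × ℝ)} (hV : ∀ i, ∀ p ∈ V i, p.2 ∈ Icc (0 : ℝ) 1) {z : ℂ}
    {s : ℝ} : (z, s) ∈ D.fillCyl V ↔ s ∈ Icc (0 : ℝ) 1 ∧ z ∈ D.fill fun i => {x | (x, s) ∈ V i} := by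
  rw [mem_fill]
  simp only [fillCyl, mem_union, mem_iUnion, mem_prod, place_image_mem (D.w_ne _) one_ne_zero,
    sub_zero, div_one, mem_ofPred_eq]
  constructor
  · rintro (⟨h1, h2⟩ | ⟨i, hi⟩)
    · exact ⟨h2, Or.inl h1⟩
    · exact ⟨hV i _ hi, Or.inr ⟨i, hi⟩⟩
  · rintro ⟨h1, h2 | h2⟩
    · exact Or.inl ⟨h2, h1⟩
    · exact Or.inr h2

theorem mem_fillCyl_cob {S : ∀ i, Cobordism (T i) (T' i)} {z : ℂ} {s : ℝ} :
    (z, s) ∈ D.fillCyl (fun i => (S i).carrier) ↔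
      s ∈ Icc (0 : ℝ) 1 ∧ z ∈ D.fill fun i => {x | (x, s) ∈ (S i).carrier} :=
  D.mem_fillCyl fun i _ hp => ((S i).subset_cyl hp).2

/-- The action of a planar arc diagram `D` on cobordisms: cobordisms are placed in the cylindrical
holes of `D × [0,1]`. -/
def cob (S : ∀ i, Cobordism (T i) (T' i)) : Cobordism (D.obj T) (D.obj T') where
  carrier := D.fillCyl fun i => (S i).carrier
  subset_cyl := by
    rintro ⟨z, s⟩ h
    obtain ⟨h1, h2⟩ := D.mem_fillCyl_cob.1 h
    exact ⟨by simpa using D.fill_norm_le (fun i x hx => ((S i).mem_bounds hx).1) h2, h1⟩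
  isClosed := by
    refine (D.isClosed.prod isClosed_Icc).union (isClosed_iUnion_of_finite fun i => ?_)
    exact (placeHomeo _ _ _ _ (D.w_ne i) one_ne_zero).isClosed_image.2 (S i).isClosed
  bottom := by
    filter_upwards [self_mem_nhdsWithin, nhdsWithin_le_nhds (Iic_mem_nhds one_pos),
      Filter.eventually_all.2 fun i => (S i).bottom] with s h0 h1 h z
    rw [mem_fillCyl_cob]
    simp only [h, ofPred_mem_eq]
    exact and_iff_right ⟨h0, h1⟩
  top := by
    filter_upwards [self_mem_nhdsWithin, nhdsWithin_le_nhds (Ici_mem_nhds one_pos),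
      Filter.eventually_all.2 fun i => (S i).top] with s h0 h1 h z
    rw [mem_fillCyl_cob]
    simp only [h, ofPred_mem_eq]
    exact and_iff_right ⟨h1, h0⟩
  side := by
    filter_upwards [D.outer, D.eventually_outer] with r h1 h2 z hz s hs
    have hU : ∀ i, ∀ x ∈ {x | (x, s) ∈ (S i).carrier}, ‖x‖ ≤ 1 :=
      fun i x hx => ((S i).mem_bounds hx).1
    rw [mem_fillCyl_cob, D.mem_fill_outside hU (h2 z hz), h1 z hz]
    exact and_iff_right hs
  flat := by
    rintro ⟨y, s⟩ hp ⟨hy1, hs⟩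
    have hy1' : ‖y‖ < 1 := by simpa using hy1
    have hU : ∀ t : ℝ, ∀ i, ∀ x ∈ {x | (x, t) ∈ (S i).carrier}, ‖x‖ ≤ 1 :=
      fun t i x hx => ((S i).mem_bounds hx).1
    have hy := (D.mem_fillCyl_cob.1 hp).2
    have hs' : ∀ᶠ p : ℂ × ℝ in 𝓝 (y, s), p.2 ∈ Icc (0 : ℝ) 1 := by
      filter_upwards [continuous_snd.continuousAt.preimage_mem_nhds
        (Ioo_mem_nhds (show 0 < (y, s).2 from hs.1) (show (y, s).2 < 1 from hs.2))] with p hp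
      exact Ioo_subset_Icc_self hp
    have hfst : Filter.Tendsto (Prod.fst : ℂ × ℝ → ℂ) (𝓝 (y, s)) (𝓝 y) :=
      continuous_fst.continuousAt
    by_cases h : ∀ i, ‖D.w i‖ < ‖y - D.c i‖
    · refine ((D.flat y ((D.mem_fill_outside (hU s) h).1 hy) hy1' h).cylinder s).congr ?_
      filter_upwards [hs', hfst.eventually (D.eventually_outside h)]
      rintro ⟨x, t⟩ ht hx
      rw [mem_fillCyl_cob, D.mem_fill_outside (hU t) hx]
      exact (and_iff_right ht).symm
    push Not at h
    obtain ⟨i, hi⟩ := h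
    rcases hi.lt_or_eq with hi | hi
    · have hy' := (D.mem_fill_inside (hU s) hi).1 hy
      have hf := (S i).flat _ hy' ⟨by simpa using (D.norm_coord_lt i).2 hi, hs⟩
      have hf' : LocFlatAt flatPlane (place (D.c i) (D.w i) 1 0 '' (S i).carrier) (y, s) := by
        refine LocFlatAt.place_image (D.w_ne i) one_ne_zero ?_
        simpa using hf
      refine hf'.congr ?_
      filter_upwards [hs', hfst.eventually (D.eventually_inside hi)]
      rintro ⟨x, t⟩ ht hx
      rw [mem_fillCyl_cob, D.mem_fill_inside (hU t) hx, place_image_mem (D.w_ne i) one_ne_zero]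
      simpa using fun _ => ht
    · obtain ⟨ρ, h1, hρ⟩ := mem_nhdsLE_iff_exists_Icc_subset.1 (S i).side
      have hev := D.exists_fill_circle i h1 hi
      have hρ' : ∀ t ∈ Icc (0 : ℝ) 1, ∀ x : ℂ, ρ ≤ ‖x‖ → ‖x‖ ≤ 1 →
          (x ∈ {x | (x, t) ∈ (S i).carrier} ↔ x ∈ rays (κ i)) :=
        fun t ht x h0 h1 => hρ ⟨h0, h1⟩ x rfl t ht
      have hy' := (hev.self_of_nhds _ (hU s) (hρ' s (Ioo_subset_Icc_self hs))).1 hy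
      have hn : ‖(y - D.c i) / D.w i‖ = 1 := by
        rw [norm_coord, hi, div_self (norm_ne_zero_iff.2 (D.w_ne i))]
      refine ((flat_affine (D.w_ne i) ((T i).flat_rays hy' hn)).cylinder s).congr ?_
      filter_upwards [hs', hfst.eventually hev]
      rintro ⟨x, t⟩ ht hx
      rw [mem_fillCyl_cob, hx _ (hU t) (hρ' t ht)]
      exact (and_iff_right ht).symm

theorem cob_id : D.cob (fun i => Cobordism.id (T i)) = Cobordism.id (D.obj T) := by
  ext ⟨z, s⟩
  change _ ∈ D.fillCyl _ ↔ _
  rw [mem_fillCyl_cob]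
  simp only [Cobordism.id, obj, mem_prod, mem_ofPred_eq, mem_fill]
  tauto

theorem cob_comp (S : ∀ i, Cobordism (T i) (T' i)) (S' : ∀ i, Cobordism (T' i) (T'' i)) :
    D.cob (fun i => (S i).comp (S' i)) = (D.cob S).comp (D.cob S') := by
  ext ⟨z, s⟩
  change _ ∈ D.fillCyl _ ↔ _ ∈ place 0 1 (1 / 2) 0 '' D.fillCyl _ ∪
    place 0 1 (1 / 2) (1 / 2) '' D.fillCyl _
  rw [mem_fillCyl_cob, mem_stack, mem_fillCyl_cob, mem_fillCyl_cob]
  simp only [mem_fill, mem_ofPred_eq, Cobordism.comp, mem_stack, mem_Icc]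
  constructor
  · rintro ⟨hs, h | ⟨i, h | h⟩⟩
    · rcases le_total s (1 / 2) with h2 | h2
      · exact Or.inl ⟨⟨by linarith, by linarith⟩, Or.inl h⟩
      · exact Or.inr ⟨⟨by linarith, by linarith⟩, Or.inl h⟩
    · exact Or.inl ⟨((S i).mem_bounds h).2, Or.inr ⟨i, h⟩⟩
    · exact Or.inr ⟨((S' i).mem_bounds h).2, Or.inr ⟨i, h⟩⟩
  · rintro (⟨hs, h | ⟨i, h⟩⟩ | ⟨hs, h | ⟨i, h⟩⟩)
    · exact ⟨⟨by linarith, by linarith⟩, Or.inl h⟩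
    · exact ⟨⟨by linarith, by linarith⟩, Or.inr ⟨i, Or.inl h⟩⟩
    · exact ⟨⟨by linarith, by linarith⟩, Or.inl h⟩
    · exact ⟨⟨by linarith, by linarith⟩, Or.inr ⟨i, Or.inr h⟩⟩

end PlanarArcDiagram

/-! ### Multilinear action on morphisms -/

open Classical in
/-- The multilinear extension of a map defined on tuples of generators. -/
def freeMulti (R : Type) [CommRing R] {ι : Type} [Fintype ι] {X : ι → Type} {A : Type} [AddCommGroup A] [Module R A]
    (g : (∀ i, X i) → A) : MultilinearMap R (fun i => X i →₀ R) A :=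
  (MultilinearMap.fromDFinsuppEquiv X R fun p => MultilinearMap.mkPiRing R ι (g p)).compLinearMap
    fun _ => (finsuppLequivDFinsupp R).toLinearMap

theorem freeMulti_single {R : Type} [CommRing R] {ι : Type} [Fintype ι] {X : ι → Type} {A : Type} [AddCommGroup A] [Module R A]
    (g : (∀ i, X i) → A) (p : ∀ i, X i) :
    freeMulti R g (fun i => Finsupp.single (p i) (1 : R)) = g p := by
  classical
  simp only [freeMulti, MultilinearMap.compLinearMap_apply, LinearEquiv.coe_coe,
    finsuppLequivDFinsupp_apply_apply, Finsupp.toDFinsupp_single]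
  rw [MultilinearMap.fromDFinsuppEquiv_single]
  simp

theorem freeMulti_update_eq_zero {R : Type} [CommRing R] {ι : Type} [Fintype ι] [DecidableEq ι] {X : ι → Type} {A : Type}
    [AddCommGroup A] [Module R A] (g : (∀ i, X i) → A) (i : ι) (r : X i →₀ R)
    (h : ∀ t : ∀ j, X j, Finsupp.lift A R (X i) (fun S => g (Function.update t i S)) r = 0)
    (x : ∀ j, X j →₀ R) : freeMulti R g (Function.update x i r) = 0 := by
  have hlin : ∀ (t : ∀ j, X j) (r : X i →₀ R),
      freeMulti R g (Function.update (fun j => Finsupp.single (t j) (1 : R)) i r) =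
        Finsupp.lift A R (X i) (fun S => g (Function.update t i S)) r := by
    intro t r
    have : (freeMulti R g).toLinearMap (fun j => Finsupp.single (t j) (1 : R)) i =
        Finsupp.lift A R (X i) (fun S => g (Function.update t i S)) := by
      refine Finsupp.lhom_ext' fun S => LinearMap.ext_ring ?_
      simp only [LinearMap.comp_apply, Finsupp.lsingle_apply, MultilinearMap.toLinearMap_apply,
        Finsupp.lift_apply, Finsupp.sum_single_index, zero_smul, one_smul]
      rw [← freeMulti_single (R := R) g (Function.update t i S)]
      congr 1
      ext1 j
      by_cases hj : j = i
      · subst hj; simp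
      · simp [hj]
    exact LinearMap.congr_fun this r
  by_cases hr : r = 0
  · rw [hr, MultilinearMap.map_update_zero]
  obtain ⟨S₀, -⟩ := Finsupp.support_nonempty_iff.2 hr
  have key : ∀ s : Finset ι, ∀ x : ∀ j, X j →₀ R,
      (∀ j, j ∉ s → j ≠ i → ∃ t : X j, x j = Finsupp.single t (1 : R)) →
      freeMulti R g (Function.update x i r) = 0 := by
    intro s
    induction s using Finset.induction_on with
    | empty =>
      intro x hx
      have : ∀ j, ∃ t : X j, j ≠ i → x j = Finsupp.single t (1 : R) := fun j => by
        by_cases hj : j = i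
        · subst hj; exact ⟨S₀, fun h => absurd rfl h⟩
        · obtain ⟨t, ht⟩ := hx j (Finset.notMem_empty j) hj
          exact ⟨t, fun _ => ht⟩
      choose t ht using this
      rw [← h t, ← hlin]
      congr 1
      ext1 j
      by_cases hj : j = i
      · subst hj; simp
      · simp [hj, ht j hj]
    | insert j s hjs ih =>
      intro x hx
      by_cases hj : j = i
      · refine ih x fun l hl hli => hx l ?_ hli
        rw [Finset.mem_insert, not_or]
        exact ⟨fun h => hli (h.trans hj), hl⟩
      have hv : ∀ v, freeMulti R g (Function.update (Function.update x i r) j v) = 0 := by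
        intro v
        induction v using Finsupp.induction_linear with
        | zero => exact MultilinearMap.map_update_zero _ _ _
        | add a b ha hb => rw [MultilinearMap.map_update_add, ha, hb, add_zero]
        | single t n =>
          have : Finsupp.single t n = n • Finsupp.single t (1 : R) := by simp
          rw [this, MultilinearMap.map_update_smul, Function.update_comm (Ne.symm hj), ih, smul_zero]
          intro l hl hli
          by_cases hlj : l = j
          · subst hlj; exact ⟨t, by simp⟩
          · rw [Function.update_of_ne hlj]
            exact hx l (by simp [hl, hlj]) hli
      have := hv (x j)
      rwa [Function.update_comm (Ne.symm hj), Function.update_eq_self] at this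
  exact key Finset.univ x fun j hj => absurd (Finset.mem_univ j) hj

theorem multi_congr {R : Type} [CommRing R] {ι : Type} [Fintype ι] [DecidableEq ι] {M : ι → Type}
    [∀ i, AddCommGroup (M i)] [∀ i, Module R (M i)] {A : Type} [AddCommGroup A] [Module R A] (f : MultilinearMap R M A)
    (K : ∀ i, Submodule R (M i)) (h : ∀ x i, ∀ r ∈ K i, f (Function.update x i r) = 0)
    {x y : ∀ i, M i} (hxy : ∀ i, x i - y i ∈ K i) : f x = f y := by
  have key : ∀ s : Finset ι, f (s.piecewise x y) = f y := by
    intro s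
    induction s using Finset.induction_on with
    | empty => simp
    | insert j s hj ih =>
      rw [Finset.piecewise_insert, ← ih, ← sub_eq_zero]
      have h1 := h (s.piecewise x y) j _ (hxy j)
      rw [MultilinearMap.map_update_sub] at h1
      rw [← h1]
      congr 2
      conv_lhs => rw [← Function.update_eq_self j (s.piecewise x y)]
      rw [Finset.piecewise_eq_of_notMem _ _ _ hj]
  have := key Finset.univ
  rwa [Finset.piecewise_univ] at this

/-- Descent of a multilinear map to quotients. -/
def multiLiftQ {R : Type} [CommRing R] {ι : Type} [Fintype ι] [inst₀ : DecidableEq ι] {M : ι → Type}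
    [∀ i, AddCommGroup (M i)] [∀ i, Module R (M i)] {A : Type} [AddCommGroup A] [Module R A] (f : MultilinearMap R M A) (K : ∀ i, Submodule R (M i))
    (h : ∀ x i, ∀ r ∈ K i, f (Function.update x i r) = 0) :
    MultilinearMap R (fun i => M i ⧸ K i) A :=
  have hout : ∀ i (a : M i ⧸ K i), (K i).mkQ a.out = a := fun i a => Quotient.out_eq _
  { toFun := fun x => f fun i => (x i).out
    map_update_add' := fun {inst} x i a b => by
      obtain rfl : inst = inst₀ := Subsingleton.elim _ _
      have e : ∀ c : M i ⧸ K i, ∀ c' : M i, (K i).mkQ c' = c →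
          f (fun j => (Function.update x i c j).out) =
            f (Function.update (fun j => (x j).out) i c') := by
        intro c c' hc
        refine multi_congr f K h fun j => (Submodule.Quotient.eq _).1 ?_
        by_cases hj : j = i
        · subst hj
          have := hout j c
          simp only [Function.update_self]
          exact this.trans hc.symm
        · simp [hj]
      rw [e (a + b) (a.out + b.out) (by rw [map_add, hout, hout]), e a a.out (hout i a),
        e b b.out (hout i b), MultilinearMap.map_update_add]
    map_update_smul' := fun {inst} x i n a => by
      obtain rfl : inst = inst₀ := Subsingleton.elim _ _
      have e : ∀ c : M i ⧸ K i, ∀ c' : M i, (K i).mkQ c' = c →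
          f (fun j => (Function.update x i c j).out) =
            f (Function.update (fun j => (x j).out) i c') := by
        intro c c' hc
        refine multi_congr f K h fun j => (Submodule.Quotient.eq _).1 ?_
        by_cases hj : j = i
        · subst hj
          have := hout j c
          simp only [Function.update_self]
          exact this.trans hc.symm
        · simp [hj]
      rw [e (n • a) (n • a.out) (by rw [map_smul, hout]), e a a.out (hout i a),
        MultilinearMap.map_update_smul] }

theorem multiLiftQ_mk {R : Type} [CommRing R] {ι : Type} [Fintype ι] [DecidableEq ι] {M : ι → Type}
    [∀ i, AddCommGroup (M i)] [∀ i, Module R (M i)] {A : Type} [AddCommGroup A] [Module R A] (f : MultilinearMap R M A)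
    (K : ∀ i, Submodule R (M i)) (h : ∀ x i, ∀ r ∈ K i, f (Function.update x i r) = 0)
    (x : ∀ i, M i) : multiLiftQ f K h (fun i => (K i).mkQ (x i)) = f x :=
  multi_congr f K h fun _ => (Submodule.Quotient.eq _).1 (Quotient.out_eq _)

theorem CobHom.multi_ext {d : ℕ} {κ : Fin d → ℕ} {T T' : ∀ i, Smoothing (κ i)} {A : Type}
    [AddCommGroup A] [Module ℤ A] {f g : MultilinearMap ℤ (fun i => CobHom (T i) (T' i)) A}
    (h : ∀ S : ∀ i, Cobordism (T i) (T' i), f (fun i => (S i).cls) = g fun i => (S i).cls) :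
    f = g := by
  have : f.compLinearMap (fun i => (relSpan (T i) (T' i)).mkQ) =
      g.compLinearMap fun i => (relSpan (T i) (T' i)).mkQ := by
    refine Module.Basis.ext_multilinear (fun i => Finsupp.basisSingleOne) fun S => ?_
    simp only [MultilinearMap.compLinearMap_apply, Finsupp.coe_basisSingleOne]
    exact h S
  ext x
  have hx : x = fun i => (relSpan (T i) (T' i)).mkQ (x i).out :=
    funext fun i => (Quotient.out_eq _).symm
  rw [hx]
  exact congrArg (fun F => F fun i => (x i).out) this

namespace PlanarArcDiagram

variable {d : ℕ} {κ : Fin d → ℕ} {k : ℕ} (D : PlanarArcDiagram κ k)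
variable {T T' T'' : ∀ i, Smoothing (κ i)}

theorem relSpan_cob (S : ∀ i, Cobordism (T i) (T' i)) (i : Fin d) :
    relSpan (T i) (T' i) ≤ (relSpan (D.obj T) (D.obj T')).comap
      (Finsupp.lmapDomain ℤ ℤ fun X => D.cob (Function.update S i X)) := by
  refine relSpan_glue _ (c := D.c i) (w := D.w i) (α := 1) (β := 0)
    (R := D.arcs ×ˢ Icc 0 1 ∪
      ⋃ (j : Fin d) (_ : j ≠ i), place (D.c j) (D.w j) 1 0 '' (S j).carrier)
    (D.w_ne i) one_ne_zero ?_ ?_ fun X => ?_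
  · rintro ⟨z, s⟩ ⟨hz, hs⟩
    have hz' : ‖z‖ < 1 := by simpa using hz
    refine ⟨?_, by simpa [place] using hs⟩
    have h1 := D.inside i
    have h2 := norm_add_le (D.c i) (D.w i * z)
    rw [norm_mul] at h2
    have h3 : ‖D.w i‖ * ‖z‖ ≤ ‖D.w i‖ := mul_le_of_le_one_right (norm_nonneg _) hz'.le
    simp only [place, Metric.mem_ball, dist_zero_right]
    linarith
  · rw [disjoint_left]
    rintro ⟨y, s⟩ h1 h2
    have h1' : ‖y - D.c i‖ < ‖D.w i‖ := by
      have := ((place_image_mem (D.w_ne i) one_ne_zero).1 h1).1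
      rw [← D.norm_coord_lt i]
      simpa using this
    rcases h2 with h2 | h2
    · exact absurd ((D.arcs_subset y h2.1).2 i) (not_le.2 h1')
    · simp only [mem_iUnion] at h2
      obtain ⟨j, hj, h2⟩ := h2
      have h3 := (place_image_mem (D.w_ne j) one_ne_zero).1 h2
      have h4 := (D.norm_coord_le j).1 ((S j).mem_bounds h3).1
      exact absurd h4 (not_le.2 (D.outside_other hj.symm h1'.le))
  · change D.arcs ×ˢ Icc 0 1 ∪ _ = _
    rw [union_left_comm]
    congr 1
    ext p
    simp only [mem_iUnion, mem_union]
    constructor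
    · rintro ⟨j, hj⟩
      by_cases hji : j = i
      · subst hji
        rw [Function.update_self] at hj
        exact Or.inl hj
      · rw [Function.update_of_ne hji] at hj
        exact Or.inr ⟨j, hji, hj⟩
    · rintro (h | ⟨j, hji, hj⟩)
      · exact ⟨i, by rwa [Function.update_self]⟩
      · exact ⟨j, by rwa [Function.update_of_ne hji]⟩

theorem free_cob_update (S : ∀ i, Cobordism (T i) (T' i)) (i : Fin d)
    {r : Cobordism (T i) (T' i) →₀ ℤ} (hr : r ∈ relSpan (T i) (T' i)) :
    Finsupp.lift (CobHom (D.obj T) (D.obj T')) ℤ _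
      (fun X => (D.cob (Function.update S i X)).cls) r = 0 := by
  have h1 : (relSpan (D.obj T) (D.obj T')).mkQ
      (Finsupp.lmapDomain ℤ ℤ (fun X => D.cob (Function.update S i X)) r) = 0 :=
    (Submodule.Quotient.mk_eq_zero _).2 (D.relSpan_cob S i hr)
  have h2 : Finsupp.lift (CobHom (D.obj T) (D.obj T')) ℤ _
      (fun X => (D.cob (Function.update S i X)).cls) =
      (relSpan (D.obj T) (D.obj T')).mkQ.comp
        (Finsupp.lmapDomain ℤ ℤ fun X => D.cob (Function.update S i X)) := by
    refine Finsupp.lhom_ext' fun X => LinearMap.ext_ring ?_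
    simp [Cobordism.cls]
  rw [h2]
  exact h1

theorem freeMulti_cob_update (T T' : ∀ i, Smoothing (κ i))
    (x : ∀ i, Cobordism (T i) (T' i) →₀ ℤ) (i : Fin d) (r : Cobordism (T i) (T' i) →₀ ℤ)
    (hr : r ∈ relSpan (T i) (T' i)) :
    freeMulti ℤ (X := fun i => Cobordism (T i) (T' i)) (fun S => (D.cob S).cls)
      (Function.update x i r) = 0 := by
  apply freeMulti_update_eq_zero
  intro S
  exact D.free_cob_update S i hr

/-- The multilinear extension of the action of `D` on cobordisms to classes of formal sums of
cobordisms. -/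
def multi (T T' : ∀ i, Smoothing (κ i)) :
    MultilinearMap ℤ (fun i => CobHom (T i) (T' i)) (CobHom (D.obj T) (D.obj T')) :=
  multiLiftQ (R := ℤ) (M := fun i => Cobordism (T i) (T' i) →₀ ℤ)
    (freeMulti ℤ (X := fun i => Cobordism (T i) (T' i)) fun S => (D.cob S).cls)
    (fun i => relSpan (T i) (T' i)) (D.freeMulti_cob_update T T')

theorem multi_cls (S : ∀ i, Cobordism (T i) (T' i)) :
    D.multi T T' (fun i => (S i).cls) = (D.cob S).cls :=
  (multiLiftQ_mk (R := ℤ) _ (fun i => relSpan (T i) (T' i)) (D.freeMulti_cob_update T T')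
    fun i => Finsupp.single (S i) 1).trans
    (freeMulti_single (R := ℤ) (X := fun i => Cobordism (T i) (T' i)) (fun S => (D.cob S).cls) S)

/-- The action of `D` on morphisms of `Cobl`. -/
def map {T T' : ∀ i, Cobl (κ i)} (f : ∀ i, T i ⟶ T' i) :
    D.obj T ⟶ D.obj T' :=
  D.multi T T' f

theorem multi_comp (f : ∀ i, CobHom (T i) (T' i)) (g : ∀ i, CobHom (T' i) (T'' i)) :
    D.multi T T'' (fun i => CobHom.comp (f i) (g i)) =
      CobHom.comp (D.multi T T' f) (D.multi T' T'' g) := by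
  have h1 : ∀ (S : ∀ i, Cobordism (T i) (T' i)) (g : ∀ i, CobHom (T' i) (T'' i)),
      D.multi T T'' (fun i => CobHom.comp (S i).cls (g i)) =
        CobHom.comp (D.multi T T' fun i => (S i).cls) (D.multi T' T'' g) := by
    intro S g
    have : (D.multi T T'').compLinearMap (fun i => CobHom.comp (S i).cls) =
        (CobHom.comp (D.multi T T' fun i => (S i).cls)).compMultilinearMap (D.multi T' T'') := by
      refine CobHom.multi_ext fun S' => ?_
      simp only [MultilinearMap.compLinearMap_apply, LinearMap.compMultilinearMap_apply,
        CobHom.comp_cls, multi_cls, cob_comp]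
    exact congrArg (fun F => F g) this
  have : (D.multi T T'').compLinearMap (fun i => CobHom.comp.flip (g i)) =
      (CobHom.comp.flip (D.multi T' T'' g)).compMultilinearMap (D.multi T T') := by
    refine CobHom.multi_ext fun S => ?_
    exact h1 S g
  exact congrArg (fun F => F f) this

theorem map_comp {T T' T'' : ∀ i, Cobl (κ i)} (f : ∀ i, T i ⟶ T' i) (g : ∀ i, T' i ⟶ T'' i) :
    D.map (fun i => f i ≫ g i) = D.map f ≫ D.map g :=
  D.multi_comp f g

theorem map_id (T : ∀ i, Cobl (κ i)) : D.map (fun i => 𝟙 (T i)) = 𝟙 (D.obj T) := by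
  refine (D.multi_cls fun i => Cobordism.id (T i)).trans ?_
  rw [cob_id]
  rfl

theorem map_eq_zero {T T' : ∀ i, Cobl (κ i)} {f : ∀ i, T i ⟶ T' i} (i : Fin d) (h : f i = 0) :
    D.map f = 0 :=
  (D.multi T T').map_coord_zero i h

theorem map_sum {T T' : ∀ i, Cobl (κ i)} {X : Fin d → Type} [∀ i, Fintype (X i)]
    (f : ∀ i, X i → (T i ⟶ T' i)) :
    D.map (fun i => ∑ x, f i x) = ∑ r : ∀ i, X i, D.map fun i => f i (r i) :=
  (D.multi T T').map_sum f

end PlanarArcDiagram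

/-! ### Complexes -/

/-- Complexes over the additive closure of `Cobl k`. -/
abbrev KomMat (k : ℕ) : Type 1 := CochainComplex (Mat_ (Cobl k)) ℤ

/-- Only finitely many terms of the complex differ from the empty formal direct sum. -/
def finiteLength (k : ℕ) : ObjectProperty (KomMat k) :=
  fun C => {n : ℤ | Nonempty (C.X n).ι}.Finite

/-- The category of complexes of finite length over the additive closure of `Cobl k`. -/
abbrev Kob (k : ℕ) : Type 1 := (finiteLength k).FullSubcategory

namespace Kob

variable {k : ℕ} (Ω : Kob k)

/-- The summands of all chain objects of a complex; the first component is the degree. -/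
abbrev Summand : Type := Σ n : ℤ, (Ω.obj.X n).ι

instance : Finite Ω.Summand := by
  have : Finite {n : ℤ | Nonempty (Ω.obj.X n).ι} := Ω.property.to_subtype
  refine Finite.of_injective (β := Σ n : {n : ℤ | Nonempty (Ω.obj.X n).ι}, (Ω.obj.X n.1).ι)
    (fun x => ⟨⟨x.1, ⟨x.2⟩⟩, x.2⟩) ?_
  rintro ⟨n, x⟩ ⟨m, y⟩ h
  simp only [Sigma.mk.injEq, Subtype.mk.injEq] at h
  obtain ⟨rfl, h⟩ := h
  simp only [heq_eq_eq] at h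
  rw [h]

instance : Fintype Ω.Summand := Fintype.ofFinite _

variable {Ω}

/-- The smoothing at a summand. -/
def Summand.sm (x : Ω.Summand) : Cobl k := (Ω.obj.X x.1).X x.2

/-- The matrix entry of the differential between two summands. -/
def dEntry (x y : Ω.Summand) : x.sm ⟶ y.sm := (Ω.obj.d x.1 y.1 : Mat_.Hom _ _) x.2 y.2

open Classical in
/-- The matrix entry of the identity between two summands. -/
def idEntry (x y : Ω.Summand) : x.sm ⟶ y.sm :=
  if h : x = y then eqToHom (congrArg Summand.sm h) else 0

theorem dEntry_eq_zero {x y : Ω.Summand} (h : x.1 + 1 ≠ y.1) : dEntry x y = 0 := by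
  unfold dEntry
  rw [Ω.obj.shape x.1 y.1 h]
  rfl

theorem idEntry_eq_zero {x y : Ω.Summand} (h : x ≠ y) : idEntry x y = 0 := by
  unfold idEntry
  rw [dif_neg h]

theorem idEntry_self (x : Ω.Summand) : idEntry x x = 𝟙 x.sm := by
  unfold idEntry
  rw [dif_pos rfl]
  rfl

theorem sum_d_d (x y : Ω.Summand) : ∑ z : Ω.Summand, dEntry x z ≫ dEntry z y = 0 := by
  let e : (Ω.obj.X (x.1 + 1)).ι → Ω.Summand := fun u => ⟨x.1 + 1, u⟩
  have he : Function.Injective e := fun u v h => by simpa [e] using h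
  have h1 : ∑ u, dEntry x (e u) ≫ dEntry (e u) y = ∑ z : Ω.Summand, dEntry x z ≫ dEntry z y := by
    refine Fintype.sum_of_injective e he _ (fun z => dEntry x z ≫ dEntry z y) ?_ fun _ => Eq.refl _
    rintro ⟨n, u⟩ hz
    rw [dEntry_eq_zero, Limits.zero_comp]
    rintro rfl
    exact hz ⟨u, rfl⟩
  rw [← h1]
  have h2 := Ω.obj.d_comp_d x.1 (x.1 + 1) y.1
  have h3 := Mat_.comp_apply (Ω.obj.d x.1 (x.1 + 1)) (Ω.obj.d (x.1 + 1) y.1) x.2 y.2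
  rw [h2] at h3
  exact h3.symm

theorem sum_id_d (x y : Ω.Summand) : ∑ z : Ω.Summand, idEntry x z ≫ dEntry z y = dEntry x y := by
  rw [Fintype.sum_eq_single x fun z hz => by rw [idEntry_eq_zero hz.symm, Limits.zero_comp],
    idEntry_self, Category.id_comp]

theorem sum_d_id (x y : Ω.Summand) : ∑ z : Ω.Summand, dEntry x z ≫ idEntry z y = dEntry x y := by
  rw [Fintype.sum_eq_single y fun z hz => by rw [idEntry_eq_zero hz, Limits.comp_zero],
    idEntry_self, Category.comp_id]

theorem sum_id_id (x y : Ω.Summand) :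
    ∑ z : Ω.Summand, idEntry x z ≫ idEntry z y = idEntry x y := by
  rw [Fintype.sum_eq_single x fun z hz => by rw [idEntry_eq_zero hz.symm, Limits.zero_comp],
    idEntry_self, Category.id_comp]

end Kob

namespace PlanarArcDiagram

open Kob

variable {d : ℕ} {κ : Fin d → ℕ} {k : ℕ} (D : PlanarArcDiagram κ k) (Ω : ∀ i, Kob (κ i))

variable {Ω} in
/-- The total degree of a tuple of summands. -/
def deg (p : ∀ i, (Ω i).Summand) : ℤ := ∑ i, (p i).1

variable {Ω} in
/-- The sign `(-1) ^ (r₁ + ⋯ + r_{i-1})`, where `r_j` is the degree of the `j`-th summand. -/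
def sign (p : ∀ i, (Ω i).Summand) (i : Fin d) : ℤ :=
  (∑ j ∈ Finset.univ.filter (· < i), (p j).1).negOnePow

variable {Ω} in
/-- The family with `i`-th member the differential and all other members the identity (matrix
entries). -/
def slot (i : Fin d) (p q : ∀ j, (Ω j).Summand) (j : Fin d) : (p j).sm ⟶ (q j).sm :=
  if j = i then dEntry (p j) (q j) else idEntry (p j) (q j)

variable {Ω} in
/-- Matrix entries of the differential `∑ i, (-1) ^ (r₁ + ⋯ + r_{i-1}) D(I, …, d_i, …, I)`. -/
def tensorEntry (p q : ∀ i, (Ω i).Summand) :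
    D.obj (fun i => (p i).sm) ⟶ D.obj (fun i => (q i).sm) :=
  ∑ i, sign p i • D.map (slot i p q)

/-- The chain object `⨁_{r = r₁ + ⋯ + r_d} D(Ω₁^{r₁}, …, Ω_d^{r_d})`. -/
def tensorX (r : ℤ) : Mat_ (Cobl k) where
  ι := {p : ∀ i, (Ω i).Summand // deg p = r}
  fintype := Subtype.fintype _
  X p := D.obj fun i => (p.1 i).sm

variable {Ω}

theorem map_slot_eq_zero {i : Fin d} {p q : ∀ j, (Ω j).Summand}
    (h : ¬∀ j, (q j).1 = (p j).1 + if j = i then 1 else 0) : D.map (slot i p q) = 0 := by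
  push Not at h
  obtain ⟨j, hj⟩ := h
  refine D.map_eq_zero j ?_
  unfold slot
  by_cases hji : j = i
  · rw [if_pos hji] at hj ⊢
    exact dEntry_eq_zero (Ne.symm hj)
  · rw [if_neg hji] at hj ⊢
    refine idEntry_eq_zero fun h => hj ?_
    rw [h, add_zero]

theorem deg_slot {i : Fin d} {p q : ∀ j, (Ω j).Summand}
    (h : ∀ j, (q j).1 = (p j).1 + if j = i then 1 else 0) : deg q = deg p + 1 := by
  unfold deg
  simp only [h, Finset.sum_add_distrib, Finset.sum_ite_eq', Finset.mem_univ, if_true]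

theorem sign_slot {i j : Fin d} {p q : ∀ j, (Ω j).Summand}
    (h : ∀ j, (q j).1 = (p j).1 + if j = i then 1 else 0) :
    sign q j = sign p j * if i < j then -1 else 1 := by
  unfold sign
  simp only [h, Finset.sum_add_distrib, Finset.sum_ite_eq', Finset.mem_filter, Finset.mem_univ,
    true_and, Int.negOnePow_add]
  split_ifs <;> simp

theorem tensorEntry_eq_zero {p q : ∀ j, (Ω j).Summand} (h : deg q ≠ deg p + 1) :
    D.tensorEntry p q = 0 := by
  unfold tensorEntry
  refine Finset.sum_eq_zero fun i _ => ?_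
  rw [D.map_slot_eq_zero fun hh => h (deg_slot hh), smul_zero]

theorem sum_slot_slot (i j : Fin d) (p q : ∀ l, (Ω l).Summand) :
    ∑ m : ∀ l, (Ω l).Summand, D.map (slot i p m) ≫ D.map (slot j m q) =
      D.map fun l => ∑ z, (if l = i then dEntry (p l) z else idEntry (p l) z) ≫
        (if l = j then dEntry z (q l) else idEntry z (q l)) := by
  rw [D.map_sum]
  refine Finset.sum_congr rfl fun m _ => ?_
  rw [← D.map_comp]
  rfl

theorem sum_slot_self (i : Fin d) (p q : ∀ l, (Ω l).Summand) :
    ∑ m : ∀ l, (Ω l).Summand, D.map (slot i p m) ≫ D.map (slot i m q) = 0 := by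
  rw [sum_slot_slot]
  refine D.map_eq_zero i ?_
  simp only [if_true]
  exact sum_d_d _ _

theorem sum_slot_comm {i j : Fin d} (hij : i ≠ j) (p q : ∀ l, (Ω l).Summand) :
    ∑ m : ∀ l, (Ω l).Summand, D.map (slot i p m) ≫ D.map (slot j m q) =
      ∑ m : ∀ l, (Ω l).Summand, D.map (slot j p m) ≫ D.map (slot i m q) := by
  rw [sum_slot_slot, sum_slot_slot]
  congr 1
  ext1 l
  by_cases hi : l = i
  · have hj : l ≠ j := fun h => hij (hi.symm.trans h)
    simp only [if_pos hi, if_neg hj]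
    rw [sum_d_id, sum_id_d]
  · by_cases hj : l = j
    · simp only [if_pos hj, if_neg hi]
      rw [sum_d_id, sum_id_d]
    · simp only [if_neg hj, if_neg hi]

theorem sum_tensorEntry (p q : ∀ l, (Ω l).Summand) :
    ∑ m : ∀ l, (Ω l).Summand, D.tensorEntry p m ≫ D.tensorEntry m q = 0 := by
  have h1 : ∀ m : ∀ l, (Ω l).Summand, D.tensorEntry p m ≫ D.tensorEntry m q =
      ∑ x : Fin d × Fin d, (sign p x.1 * (sign p x.2 * if x.1 < x.2 then -1 else 1)) •
        (D.map (slot x.1 p m) ≫ D.map (slot x.2 m q)) := by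
    intro m
    unfold tensorEntry
    rw [Preadditive.sum_comp, Fintype.sum_prod_type]
    refine Finset.sum_congr rfl fun i _ => ?_
    rw [Preadditive.comp_sum]
    refine Finset.sum_congr rfl fun j _ => ?_
    rw [Preadditive.zsmul_comp, Preadditive.comp_zsmul, smul_smul]
    by_cases h : ∀ l, (m l).1 = (p l).1 + if l = i then 1 else 0
    · rw [sign_slot h]
    · rw [D.map_slot_eq_zero h, Limits.zero_comp, smul_zero, smul_zero]
  simp only [h1]
  rw [Finset.sum_comm]
  simp only [← Finset.smul_sum]
  refine Finset.sum_involution (fun x _ => (x.2, x.1)) ?_ ?_ (fun _ _ => Finset.mem_univ _)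
    fun _ _ => rfl
  · rintro ⟨i, j⟩ -
    rcases lt_trichotomy i j with h | rfl | h
    · simp only [if_pos h, if_neg h.not_gt]
      rw [D.sum_slot_comm h.ne, ← add_smul]
      convert zero_smul ℤ _ using 2
      ring
    · simp only [D.sum_slot_self, smul_zero, add_zero]
    · simp only [if_pos h, if_neg h.not_gt]
      rw [D.sum_slot_comm h.ne, ← add_smul]
      convert zero_smul ℤ _ using 2
      ring
  · rintro ⟨i, j⟩ - hne heq
    have hij : i = j := (congrArg Prod.snd heq)
    subst hij
    exact hne (by rw [D.sum_slot_self, smul_zero])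

variable (Ω)

/-- The action of a planar arc diagram on complexes: the signed tensor product
`D(Ω₁, …, Ω_d)`. -/
def tensor : Kob k where
  obj :=
    { X := D.tensorX Ω
      d := fun _ _ => (fun p q => D.tensorEntry p.1 q.1 : Mat_.Hom (D.tensorX Ω _) (D.tensorX Ω _))
      shape := by
        intro a b hab
        refine Mat_.hom_ext _ _ fun p q => ?_
        refine D.tensorEntry_eq_zero fun h => hab ?_
        change a + 1 = b
        rw [← p.2, ← q.2, h]
      d_comp_d' := by
        rintro a b c rfl rfl
        refine Mat_.hom_ext _ _ fun p q => ?_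
        refine Eq.trans ?_ (D.sum_tensorEntry p.1 q.1)
        refine Fintype.sum_of_injective Subtype.val Subtype.val_injective _ _ ?_ fun _ => rfl
        intro m hm
        have h0 : D.tensorEntry p.1 m = 0 :=
          D.tensorEntry_eq_zero fun h => hm ⟨⟨m, by rw [h, p.2]⟩, rfl⟩
        exact (congrArg (· ≫ D.tensorEntry m q.1) h0).trans Limits.zero_comp }
  property := by
    refine (Set.finite_range fun p : ∀ i, (Ω i).Summand => deg p).subset ?_
    rintro n ⟨p⟩
    exact ⟨p.1, p.2⟩

end PlanarArcDiagram

/-! ### Isotopy, radial diagrams and insertion -/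

namespace PlanarArcDiagram

variable {d : ℕ} {κ : Fin d → ℕ} {k : ℕ}

/-- Isotopy of planar arc diagrams: an ambient isotopy of the plane, fixed near and outside the
boundary circle of the output disk, carries the arcs to the arcs and the input disks, with their
boundary parametrisations, to the input disks. -/
def Isotopic (D D' : PlanarArcDiagram κ k) : Prop :=
  ∃ F : unitInterval → (ℂ ≃ₜ ℂ),
    Continuous (fun q : unitInterval × ℂ => F q.1 q.2) ∧
    (∀ z, F 0 z = z) ∧ (∃ ρ < 1, ∀ t z, ρ ≤ ‖z‖ → F t z = z) ∧
    F 1 '' D.arcs = D'.arcs ∧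
    ∀ i z, ‖z‖ ≤ 1 → F 1 (D.c i + D.w i * z) = D'.c i + D'.w i * z

/-- A one-input diagram is radial if its input disk is concentric with the output disk, with the
base points on the same ray, and its arcs are the radial segments between the marked points. -/
def IsRadial (D : PlanarArcDiagram (fun _ : Fin 1 => k) k) : Prop :=
  ∃ ρ : ℝ, 0 < ρ ∧ D.c 0 = 0 ∧ D.w 0 = ρ ∧ D.arcs = {z ∈ rays k | ρ ≤ ‖z‖ ∧ ‖z‖ ≤ 1}

variable (D : PlanarArcDiagram κ k) (i : Fin d) {d' : ℕ} {κ' : Fin d' → ℕ}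
  (D' : PlanarArcDiagram κ' (κ i))

/-- The centres of the input disks after inserting `D'` in the `i`-th hole of `D`. -/
def insC : {j // j ≠ i} ⊕ Fin d' → ℂ :=
  Sum.elim (fun j => D.c j) fun a => D.c i + D.w i * D'.c a

/-- The radii and base points of the input disks after inserting `D'` in the `i`-th hole of `D`. -/
def insW : {j // j ≠ i} ⊕ Fin d' → ℂ :=
  Sum.elim (fun j => D.w j) fun a => D.w i * D'.w a

/-- The arcs after inserting `D'` in the `i`-th hole of `D`. -/
def insArcs : Set ℂ := D.arcs ∪ (fun z => D.c i + D.w i * z) '' D'.arcs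

theorem insArcs_eq : D.insArcs i D' = D.fill fun j => {z | j = i ∧ z ∈ D'.arcs} := by
  unfold insArcs fill
  congr 1
  ext y
  simp only [mem_iUnion, mem_image, mem_ofPred_eq]
  constructor
  · rintro ⟨z, hz, rfl⟩
    exact ⟨i, z, ⟨rfl, hz⟩, rfl⟩
  · rintro ⟨_, z, ⟨rfl, hz⟩, rfl⟩
    exact ⟨z, hz, rfl⟩

theorem ins_norm_le : ∀ j, ∀ z ∈ {z | j = i ∧ z ∈ D'.arcs}, ‖z‖ ≤ 1 :=
  fun _ z hz => (D'.arcs_subset z hz.2).1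

theorem mem_insArcs_outside {y : ℂ} (h : ‖D.w i‖ < ‖y - D.c i‖) :
    y ∈ D.insArcs i D' ↔ y ∈ D.arcs := by
  rw [insArcs_eq, mem_fill]
  refine or_iff_left ?_
  rintro ⟨_, rfl, hj⟩
  exact absurd ((D.norm_coord_le _).1 (D'.arcs_subset _ hj).1) (not_le.2 h)

theorem mem_insArcs_inside {y : ℂ} (h : ‖y - D.c i‖ < ‖D.w i‖) :
    y ∈ D.insArcs i D' ↔ (y - D.c i) / D.w i ∈ D'.arcs := by
  rw [insArcs_eq, D.mem_fill_inside (ins_norm_le i D') h]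
  exact and_iff_right rfl

variable {D D' i} in
theorem insW_ne (s : {j // j ≠ i} ⊕ Fin d') : D.insW i D' s ≠ 0 := by
  rcases s with j | a
  · exact D.w_ne j
  · exact mul_ne_zero (D.w_ne i) (D'.w_ne a)

theorem ins_inside (s : {j // j ≠ i} ⊕ Fin d') : ‖D.insC i D' s‖ + ‖D.insW i D' s‖ < 1 := by
  rcases s with j | a
  · exact D.inside j
  · simp only [insC, insW, Sum.elim_inr]
    have h1 := norm_add_le (D.c i) (D.w i * D'.c a)
    have h2 := D.inside i
    have h3 := D'.inside a
    have h4 := norm_nonneg (D.w i)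
    rw [norm_mul] at h1 ⊢
    nlinarith

theorem ins_disj_aux (j : {j // j ≠ i}) (a : Fin d') :
    ‖D.w j‖ + ‖D.w i * D'.w a‖ < ‖D.c j - (D.c i + D.w i * D'.c a)‖ := by
  have h1 := D.disj j i j.2
  have h3 := D'.inside a
  have h4 := norm_nonneg (D.w i)
  have h5 := norm_sub_norm_le (D.c j - D.c i) (D.w i * D'.c a)
  rw [← sub_sub]
  rw [norm_mul] at h5 ⊢
  nlinarith

theorem ins_disj (s t : {j // j ≠ i} ⊕ Fin d') (h : s ≠ t) :
    ‖D.insW i D' s‖ + ‖D.insW i D' t‖ < ‖D.insC i D' s - D.insC i D' t‖ := by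
  rcases s with j | a <;> rcases t with l | b
  · exact D.disj j l fun hh => h (by rw [Subtype.ext hh])
  · exact D.ins_disj_aux i D' j b
  · rw [add_comm, norm_sub_rev]
    exact D.ins_disj_aux i D' l a
  · simp only [insC, insW, Sum.elim_inr]
    rw [add_sub_add_left_eq_sub, ← mul_sub, norm_mul, norm_mul, norm_mul, ← mul_add]
    exact mul_lt_mul_of_pos_left (D'.disj a b fun hh => h (by rw [hh]))
      (norm_pos_iff.2 (D.w_ne i))

theorem ins_sub (a : Fin d') (y : ℂ) :
    y - (D.c i + D.w i * D'.c a) = D.w i * ((y - D.c i) / D.w i - D'.c a) := by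
  rw [mul_sub, mul_div_cancel₀ _ (D.w_ne i)]
  ring

theorem ins_outside {y : ℂ} (h : ‖D.w i‖ ≤ ‖y - D.c i‖) (a : Fin d') :
    ‖D.w i * D'.w a‖ < ‖y - (D.c i + D.w i * D'.c a)‖ := by
  have h3 := D'.inside a
  have h4 := norm_pos_iff.2 (D.w_ne i)
  have h5 := norm_sub_norm_le (y - D.c i) (D.w i * D'.c a)
  rw [← sub_sub]
  rw [norm_mul] at h5 ⊢
  nlinarith

theorem ins_arcs_subset (y : ℂ) (hy : y ∈ D.insArcs i D') :
    ‖y‖ ≤ 1 ∧ ∀ s, ‖D.insW i D' s‖ ≤ ‖y - D.insC i D' s‖ := by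
  refine ⟨D.fill_norm_le (ins_norm_le i D') (by rwa [← insArcs_eq]), ?_⟩
  rcases hy with hy | ⟨z, hz, rfl⟩
  · rintro (j | a)
    · exact (D.arcs_subset y hy).2 j
    · exact (D.ins_outside i D' ((D.arcs_subset y hy).2 i) a).le
  · have hz' := D'.arcs_subset z hz
    rintro (j | a)
    · refine (D.outside_other j.2.symm ?_).le
      rw [add_sub_cancel_left, norm_mul]
      exact mul_le_of_le_one_right (norm_nonneg _) hz'.1
    · simp only [insC, insW, Sum.elim_inr]
      rw [add_sub_add_left_eq_sub, ← mul_sub, norm_mul, norm_mul]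
      exact mul_le_mul_of_nonneg_left (hz'.2 a) (norm_nonneg _)

theorem ins_isClosed : IsClosed (D.insArcs i D') := by
  let φ : ℂ ≃ₜ ℂ := (Homeomorph.mulLeft₀ (D.w i) (D.w_ne i)).trans (Homeomorph.addLeft (D.c i))
  exact D.isClosed.union (φ.isClosed_image.2 D'.isClosed)

theorem ins_outer : ∀ᶠ r in 𝓝[≤] (1 : ℝ), ∀ z : ℂ, ‖z‖ = r →
    (z ∈ D.insArcs i D' ↔ z ∈ rays k) := by
  filter_upwards [D.outer, D.eventually_outer] with r h1 h2 z hz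
  rw [D.mem_insArcs_outside i D' (h2 z hz i), h1 z hz]

theorem ins_inner (s : {j // j ≠ i} ⊕ Fin d') : ∀ᶠ r in 𝓝[≥] (1 : ℝ), ∀ z : ℂ, ‖z‖ = r →
    (D.insC i D' s + D.insW i D' s * z ∈ D.insArcs i D' ↔
      z ∈ rays (Sum.elim (fun j : {j // j ≠ i} => κ j) κ' s)) := by
  rcases s with j | a
  · have hc : Continuous fun r : ℝ => ‖D.w i‖ + ‖D.w j‖ * r := by fun_prop
    have h1 : ∀ᶠ r in 𝓝[≥] (1 : ℝ), ‖D.w i‖ + ‖D.w j‖ * r < ‖D.c i - D.c j‖ := by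
      refine nhdsWithin_le_nhds (hc.continuousAt.preimage_mem_nhds (Iio_mem_nhds ?_))
      rw [mul_one]
      exact D.disj i j j.2.symm
    filter_upwards [D.inner j, h1] with r h2 h3 z hz
    refine (D.mem_insArcs_outside i D' ?_).trans (h2 z hz)
    simp only [insC, insW, Sum.elim_inl]
    have h4 := norm_sub_norm_le (D.c i - D.c j) (D.w j * z)
    rw [norm_mul, hz] at h4
    have h5 : D.c j + D.w j * z - D.c i = -(D.c i - D.c j - D.w j * z) := by ring
    rw [h5, norm_neg]
    linarith
  · have hc : Continuous fun r : ℝ => ‖D'.c a‖ + ‖D'.w a‖ * r := by fun_prop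
    have h1 : ∀ᶠ r in 𝓝[≥] (1 : ℝ), ‖D'.c a‖ + ‖D'.w a‖ * r < 1 := by
      refine nhdsWithin_le_nhds (hc.continuousAt.preimage_mem_nhds (Iio_mem_nhds ?_))
      rw [mul_one]
      exact D'.inside a
    filter_upwards [D'.inner a, h1] with r h2 h3 z hz
    simp only [insC, insW, Sum.elim_inr]
    have h4 : D.c i + D.w i * D'.c a + D.w i * D'.w a * z =
        D.c i + D.w i * (D'.c a + D'.w a * z) := by ring
    have h5 : (D.c i + D.w i * (D'.c a + D'.w a * z) - D.c i) / D.w i = D'.c a + D'.w a * z := by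
      rw [add_sub_cancel_left, mul_div_cancel_left₀ _ (D.w_ne i)]
    have h6 : ‖D'.c a + D'.w a * z‖ < 1 := by
      refine (norm_add_le _ _).trans_lt ?_
      rwa [norm_mul, hz]
    rw [h4, D.mem_insArcs_inside i D', h5, h2 z hz]
    rwa [← D.norm_coord_lt, h5]

theorem flat_rays (D : PlanarArcDiagram κ k) {x : ℂ} (hx : x ∈ rays k) (hx1 : ‖x‖ = 1) :
    LocFlatAt flatLine (rays k) x := by
  obtain ⟨u, hu, h⟩ := mem_nhdsLE_iff_exists_Icc_subset.1 (D.outer.and D.eventually_outer)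
  have h1 : max u (1 / 2) < 1 := max_lt hu (by norm_num)
  refine flat_rays_of h1 (lt_max_of_lt_right (by norm_num))
    (fun z h0 h1 => (h ⟨(le_max_left _ _).trans h0, h1⟩).1 z rfl) (fun z hz h0 h1 => ?_) hx hx1
  exact D.flat z hz h1 ((h ⟨(le_max_left _ _).trans h0.le, h1.le⟩).2 z rfl)

theorem ins_flat (y : ℂ) (hy : y ∈ D.insArcs i D') (hy1 : ‖y‖ < 1)
    (h : ∀ s, ‖D.insW i D' s‖ < ‖y - D.insC i D' s‖) :
    LocFlatAt flatLine (D.insArcs i D') y := by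
  have hc : Continuous fun x => ‖x - D.c i‖ := by fun_prop
  rcases lt_trichotomy ‖y - D.c i‖ ‖D.w i‖ with hi | hi | hi
  · have hy' := (D.mem_insArcs_inside i D' hi).1 hy
    have hf := D'.flat _ hy' ((D.norm_coord_lt i).2 hi) fun a => by
      have h1 := h (Sum.inr a)
      simp only [insC, insW, Sum.elim_inr] at h1
      rw [ins_sub, norm_mul, norm_mul] at h1
      exact lt_of_mul_lt_mul_left h1 (norm_nonneg _)
    refine (flat_affine (D.w_ne i) hf).congr ?_
    filter_upwards [D.eventually_inside hi] with x hx
    exact (D.mem_insArcs_inside i D' hx).symm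
  · obtain ⟨ρ, hρ1, hρ⟩ := mem_nhdsLE_iff_exists_Icc_subset.1 D'.outer
    have hev := D.exists_fill_circle i hρ1 hi
    have hU : ∀ z : ℂ, ρ ≤ ‖z‖ → ‖z‖ ≤ 1 →
        (z ∈ {z | i = i ∧ z ∈ D'.arcs} ↔ z ∈ rays (κ i)) := fun z h0 h1 =>
      (and_iff_right rfl).trans (hρ ⟨h0, h1⟩ z rfl)
    have hmem : ∀ᶠ x in 𝓝 y, (x ∈ D.insArcs i D' ↔ (x - D.c i) / D.w i ∈ rays (κ i)) := by
      filter_upwards [hev] with x hx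
      rw [insArcs_eq]
      exact hx (fun j => {z | j = i ∧ z ∈ D'.arcs}) (ins_norm_le i D') hU
    have hn : ‖(y - D.c i) / D.w i‖ = 1 := by
      rw [norm_coord, hi, div_self (norm_ne_zero_iff.2 (D.w_ne i))]
    refine (flat_affine (D.w_ne i) (D'.flat_rays (hmem.self_of_nhds.1 hy) hn)).congr ?_
    filter_upwards [hmem] with x hx
    exact hx.symm
  · have hy' := (D.mem_insArcs_outside i D' hi).1 hy
    refine (D.flat y hy' hy1 fun j => ?_).congr ?_
    · by_cases hj : j = i
      · rwa [hj]
      · exact h (Sum.inl ⟨j, hj⟩)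
    · filter_upwards [hc.continuousAt.preimage_mem_nhds (Ioi_mem_nhds hi)] with x hx
      exact (D.mem_insArcs_outside i D' hx).symm

/-- The result of placing `D'` into the `i`-th hole of `D`. The input disks of the result are the
input disks of `D` other than the `i`-th one and the input disks of `D'`, numbered by `e`. -/
def insert {n : ℕ} (e : Fin n ≃ {j // j ≠ i} ⊕ Fin d') :
    PlanarArcDiagram (fun m => Sum.elim (fun j : {j // j ≠ i} => κ j) κ' (e m)) k where
  c m := D.insC i D' (e m)
  w m := D.insW i D' (e m)
  w_ne m := insW_ne (e m)
  inside m := D.ins_inside i D' (e m)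
  disj m l h := D.ins_disj i D' _ _ (e.injective.ne h)
  arcs := D.insArcs i D'
  arcs_subset y hy := ⟨(D.ins_arcs_subset i D' y hy).1, fun m => (D.ins_arcs_subset i D' y hy).2 _⟩
  isClosed := D.ins_isClosed i D'
  outer := D.ins_outer i D'
  inner m := D.ins_inner i D' (e m)
  flat y hy hy1 h := D.ins_flat i D' y hy hy1 fun s => by simpa using h (e.symm s)

end PlanarArcDiagram

/-! ### Planar algebras -/

universe u

/-- Inputs for `D` (outside the `i`-th hole) and inputs for `D'`, combined to inputs for the result
of placing `D'` into the `i`-th hole of `D`. -/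
def combine {P : ℕ → Type u} {d d' : ℕ} {κ : Fin d → ℕ} {κ' : Fin d' → ℕ} (i : Fin d)
    (x : ∀ j, P (κ j)) (x' : ∀ a, P (κ' a)) :
    ∀ s : {j // j ≠ i} ⊕ Fin d', P (Sum.elim (fun j : {j // j ≠ i} => κ j) κ' s)
  | Sum.inl j => x j
  | Sum.inr a => x' a

/-- A planar algebra structure on the sets `P k`: planar arc diagrams, up to isotopy, act as
operations, radial diagrams act as identities, and placing `D'` into the `i`-th hole of `D`
corresponds to composition of operations, `D ∘ (I × ⋯ × D' × ⋯ × I)`, for every numbering of the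
input disks of the composite diagram. -/
structure PlanarAlgebra (P : ℕ → Type u) where
  op : ∀ {d : ℕ} {κ : Fin d → ℕ} {k : ℕ}, PlanarArcDiagram κ k → (∀ i, P (κ i)) → P k
  isotopy : ∀ {d : ℕ} {κ : Fin d → ℕ} {k : ℕ} (D D' : PlanarArcDiagram κ k), D.Isotopic D' →
    op D = op D'
  radial : ∀ {k : ℕ} (D : PlanarArcDiagram (fun _ : Fin 1 => k) k), D.IsRadial →
    ∀ x : P k, op D (fun _ => x) = x
  assoc : ∀ {d d' : ℕ} {κ : Fin d → ℕ} {κ' : Fin d' → ℕ} {k : ℕ} (D : PlanarArcDiagram κ k)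
    (i : Fin d) (D' : PlanarArcDiagram κ' (κ i)) {n : ℕ} (e : Fin n ≃ {j // j ≠ i} ⊕ Fin d')
    (x : ∀ j, P (κ j)) (x' : ∀ a, P (κ' a)),
    op (D.insert i D' e) (fun m => combine i x x' (e m)) =
      op D (Function.update x i (op D' x'))

/-- Homotopy equivalence of complexes. -/
def HtpyEquiv {k : ℕ} (Ω Ω' : Kob k) : Prop := Nonempty (HomotopyEquiv Ω.obj Ω'.obj)

/-- Homotopy equivalence of complexes as an equivalence relation. -/
def htpySetoid (k : ℕ) : Setoid (Kob k) where
  r := HtpyEquiv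
  iseqv :=
    ⟨fun Ω => ⟨HomotopyEquiv.refl Ω.obj⟩, fun ⟨h⟩ => ⟨h.symm⟩, fun ⟨h⟩ ⟨h'⟩ => ⟨h.trans h'⟩⟩

/-- Isomorphism classes of objects of `Kob k`. -/
abbrev KobClass (k : ℕ) : Type 1 := Quotient (isIsomorphicSetoid (Kob k))

/-- Isomorphism classes of objects of `Kob k` modulo homotopy, that is, homotopy equivalence classes
of complexes. -/
abbrev KobHtpyClass (k : ℕ) : Type 1 := Quotient (htpySetoid k)

/-- The isomorphism class of a complex. -/
def Kob.cls {k : ℕ} (Ω : Kob k) : KobClass k := Quotient.mk _ Ω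

/-- The homotopy equivalence class of a complex. -/
def Kob.htpyCls {k : ℕ} (Ω : Kob k) : KobHtpyClass k := Quotient.mk _ Ω

end BarNatan

end

/-!
A complex is encoded by the matrix of its differential over the direct sum of all its summands
(`Kob.tot`). Chain maps become matrices of degree `0` that commute with the differentials,
homotopies become matrices of degree `-1`, and the signs in the differential of `D(Ω₁, …, Ω_d)` are
absorbed by the involutions `(-1) ^ r` (`Kob.parity`): the differential is the sum of `D(ε, …, ε,
d_i, 1, …, 1)`, where `ε` denotes these involutions (`PlanarArcDiagram.dTot_tensor`). As `D` is
multiplicative and multilinear on matrices, it takes tuples of chain maps to chain maps, and a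
homotopy `h` in one slot to the homotopy `D(ε f₁, …, ε f_{l-1}, h, f_{l+1}, …, f_d)`; changing one
slot at a time shows that the action respects isomorphism and homotopy equivalence (`tensor_iso`,
`tensor_htpyEquiv`).

The laws of a planar algebra hold up to isomorphism of complexes, before passing to classes.

* An ambient isotopy from `D` to `D'` carries `D(T₁, …, T_d)` to `D'(T₁, …, T_d)`. Its trace is a
  cobordism between the two, invertible because the trace followed by its reverse can be
  straightened by an isotopy, and natural because moving the end of a cobordism by the isotopy
  after it, or its start before it, gives isotopic surfaces: only the positions of the bottom and
  the top matter (`DiskIsotopy.track_isotopic`). So traces form isomorphisms of complexes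
  (`tensor_iso_of_isotopic`).
* For a radial diagram, the trace of a radial contraction of the disk is a cobordism from `T` to
  `D(T)`. A smoothing and a cobordism are radial only in a collar of the boundary whose width
  depends on them, but the trace does not depend on where in the collar the contraction is cut off,
  so it is natural in all cobordisms (`tensor_iso_of_radial`).
* Placing `D'` into a hole of `D` composes the actions on smoothings and on cobordisms on the nose,
  hence, by multilinearity, on all morphisms (`SplitsHom.map_eq`). For complexes the two sides
  differ in the order in which the factors are enumerated, hence in the signs of the differentials;
  the Koszul sign of the rearrangement, summand by summand, is an isomorphism between them
  (`tensor_iso_insert`).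
-/

noncomputable section

namespace BarNatan

/-! ### Complexes as matrices over all summands -/

namespace Kob

variable {k : ℕ} {Ω Ω' Ω'' : Kob k}

/-- The formal direct sum of all chain objects of a complex. -/
def tot (Ω : Kob k) : Mat_ (Cobl k) where
  ι := Ω.Summand
  X x := x.sm

/-- The matrix with entries `f x y`, as a morphism between total objects. -/
def ofEntries (f : ∀ (x : Ω.Summand) (y : Ω'.Summand), x.sm ⟶ y.sm) : Ω.tot ⟶ Ω'.tot := f

/-- The entry of a morphism between total objects at a pair of summands. -/
def ent (φ : Ω.tot ⟶ Ω'.tot) (x : Ω.Summand) (y : Ω'.Summand) : x.sm ⟶ y.sm :=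
  (φ : Mat_.Hom _ _) x y

theorem tot_ext {φ ψ : Ω.tot ⟶ Ω'.tot} (h : ∀ x y, ent φ x y = ent ψ x y) : φ = ψ :=
  Mat_.hom_ext _ _ h

@[simp]
theorem ent_ofEntries (f : ∀ (x : Ω.Summand) (y : Ω'.Summand), x.sm ⟶ y.sm) (x : Ω.Summand)
    (y : Ω'.Summand) : ent (ofEntries f) x y = f x y := rfl

theorem ent_comp (φ : Ω.tot ⟶ Ω'.tot) (ψ : Ω'.tot ⟶ Ω''.tot) (x : Ω.Summand) (y : Ω''.Summand) :
    ent (φ ≫ ψ) x y = ∑ z, ent φ x z ≫ ent ψ z y := rfl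

@[simp]
theorem ent_add (φ ψ : Ω.tot ⟶ Ω'.tot) (x : Ω.Summand) (y : Ω'.Summand) :
    ent (φ + ψ) x y = ent φ x y + ent ψ x y := rfl

/-- Taking entries, as an additive map. -/
def entHom (x : Ω.Summand) (y : Ω'.Summand) : (Ω.tot ⟶ Ω'.tot) →+ (x.sm ⟶ y.sm) where
  toFun φ := ent φ x y
  map_zero' := rfl
  map_add' _ _ := rfl

theorem ent_sum {ι : Type*} (s : Finset ι) (φ : ι → (Ω.tot ⟶ Ω'.tot)) (x : Ω.Summand)
    (y : Ω'.Summand) : ent (∑ i ∈ s, φ i) x y = ∑ i ∈ s, ent (φ i) x y :=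
  map_sum (entHom x y) φ s

theorem ent_id (x y : Ω.Summand) : ent (𝟙 Ω.tot) x y = idEntry x y := by
  by_cases h : x = y
  · subst h
    rw [idEntry_self]
    exact Mat_.id_apply_self Ω.tot x
  · rw [idEntry_eq_zero h]
    exact Mat_.id_apply_of_ne Ω.tot x y h

/-- The differential of a complex, on the total object. -/
def dTot (Ω : Kob k) : Ω.tot ⟶ Ω.tot := ofEntries fun x y => dEntry x y

/-- The involution `(-1) ^ r` on the summands of degree `r`. -/
def parity (Ω : Kob k) : Ω.tot ⟶ Ω.tot :=
  ofEntries fun x y => ((x.1.negOnePow : ℤˣ) : ℤ) • idEntry x y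

/-- The matrix `φ` has degree `n`: only entries raising the degree by `n` are nonzero. -/
def IsDeg (n : ℤ) (φ : Ω.tot ⟶ Ω'.tot) : Prop := ∀ x y, x.1 + n ≠ y.1 → ent φ x y = 0

theorem isDeg_dTot (Ω : Kob k) : IsDeg 1 Ω.dTot := fun _ _ h => dEntry_eq_zero h

theorem isDeg_id (Ω : Kob k) : IsDeg 0 (𝟙 Ω.tot) := fun x y h => by
  rw [ent_id]
  exact idEntry_eq_zero fun hh => h (by rw [hh, add_zero])

theorem IsDeg.add {n : ℤ} {φ ψ : Ω.tot ⟶ Ω'.tot} (h : IsDeg n φ) (h' : IsDeg n ψ) :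
    IsDeg n (φ + ψ) := fun x y hh => by rw [ent_add, h x y hh, h' x y hh, add_zero]

theorem IsDeg.comp {n m : ℤ} {φ : Ω.tot ⟶ Ω'.tot} {ψ : Ω'.tot ⟶ Ω''.tot} (h : IsDeg n φ)
    (h' : IsDeg m ψ) : IsDeg (n + m) (φ ≫ ψ) := fun x y hh => by
  rw [ent_comp]
  refine Finset.sum_eq_zero fun z _ => ?_
  by_cases hz : x.1 + n = z.1
  · rw [h' z y fun h2 => hh (by rw [← add_assoc, hz, h2]), Limits.comp_zero]
  · rw [h x z hz, Limits.zero_comp]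

theorem ent_parity_comp (φ : Ω.tot ⟶ Ω'.tot) (x : Ω.Summand) (y : Ω'.Summand) :
    ent (Ω.parity ≫ φ) x y = ((x.1.negOnePow : ℤˣ) : ℤ) • ent φ x y := by
  have h : ent (𝟙 Ω.tot ≫ φ) x y = ent φ x y := by rw [Category.id_comp]
  rw [← h, ent_comp, ent_comp, Finset.smul_sum]
  refine Finset.sum_congr rfl fun z _ => ?_
  rw [ent_id, ← Preadditive.zsmul_comp]
  rfl

theorem ent_comp_parity (φ : Ω.tot ⟶ Ω'.tot) (x : Ω.Summand) (y : Ω'.Summand) :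
    ent (φ ≫ Ω'.parity) x y = ((y.1.negOnePow : ℤˣ) : ℤ) • ent φ x y := by
  have h : ent (φ ≫ 𝟙 Ω'.tot) x y = ent φ x y := by rw [Category.comp_id]
  rw [← h, ent_comp, ent_comp, Finset.smul_sum]
  refine Finset.sum_congr rfl fun z _ => ?_
  rw [ent_id, parity, ent_ofEntries]
  by_cases hz : z = y
  · rw [hz, Preadditive.comp_zsmul]
  · rw [idEntry_eq_zero hz, smul_zero, Limits.comp_zero, smul_zero]

theorem parity_parity (Ω : Kob k) : Ω.parity ≫ Ω.parity = 𝟙 Ω.tot := by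
  refine tot_ext fun x y => ?_
  rw [ent_parity_comp, ent_id, parity, ent_ofEntries, smul_smul]
  rw [← Units.val_mul, ← Int.negOnePow_add, Int.negOnePow_even _ ⟨x.1, rfl⟩, Units.val_one,
    one_smul]

theorem IsDeg.parity_comp {n : ℤ} {φ : Ω.tot ⟶ Ω'.tot} (h : IsDeg n φ) :
    Ω.parity ≫ φ = ((n.negOnePow : ℤˣ) : ℤ) • (φ ≫ Ω'.parity) := by
  refine tot_ext fun x y => ?_
  rw [ent_parity_comp]
  refine Eq.trans ?_ (map_zsmul (entHom x y) _ _).symm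
  change _ = _ • ent (φ ≫ Ω'.parity) x y
  rw [ent_comp_parity, smul_smul]
  by_cases hxy : x.1 + n = y.1
  · rw [← hxy, ← Units.val_mul, ← Int.negOnePow_add]
    congr 2
    rw [add_comm n, add_assoc, Int.negOnePow_add, Int.negOnePow_even _ ⟨n, rfl⟩, mul_one]
  · rw [h x y hxy, smul_zero, smul_zero]

theorem IsDeg.parity_comp_even {φ : Ω.tot ⟶ Ω'.tot} (h : IsDeg 0 φ) :
    Ω.parity ≫ φ = φ ≫ Ω'.parity := by
  rw [h.parity_comp, Int.negOnePow_zero, Units.val_one, one_smul]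

theorem IsDeg.parity_comp_one {φ : Ω.tot ⟶ Ω'.tot} (h : IsDeg 1 φ) :
    Ω.parity ≫ φ = -(φ ≫ Ω'.parity) := by
  rw [h.parity_comp, Int.negOnePow_one, Units.val_neg, Units.val_one, neg_one_smul]

theorem IsDeg.parity_comp_neg_one {φ : Ω.tot ⟶ Ω'.tot} (h : IsDeg (-1) φ) :
    Ω.parity ≫ φ = -(φ ≫ Ω'.parity) := by
  rw [h.parity_comp, Int.negOnePow_neg, Int.negOnePow_one, Units.val_neg, Units.val_one,
    neg_one_smul]

/-- The part of a matrix between the chain objects in degrees `a` and `b`. -/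
def block (φ : Ω.tot ⟶ Ω'.tot) (a b : ℤ) : Ω.obj.X a ⟶ Ω'.obj.X b :=
  (fun u v => ent φ ⟨a, u⟩ ⟨b, v⟩ : Mat_.Hom _ _)

theorem block_add (φ ψ : Ω.tot ⟶ Ω'.tot) (a b : ℤ) :
    block (φ + ψ) a b = block φ a b + block ψ a b := rfl

theorem block_dTot (Ω : Kob k) (a b : ℤ) : block Ω.dTot a b = Ω.obj.d a b := rfl

theorem block_id (Ω : Kob k) (a : ℤ) : block (𝟙 Ω.tot) a a = 𝟙 (Ω.obj.X a) := by
  refine Mat_.hom_ext _ _ fun u v => ?_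
  by_cases h : u = v
  · subst h
    rw [Mat_.id_apply_self]
    exact (ent_id _ _).trans (idEntry_self _)
  · rw [Mat_.id_apply_of_ne _ _ _ h]
    refine (ent_id _ _).trans (idEntry_eq_zero fun hh => h ?_)
    simpa using hh

theorem block_comp {n : ℤ} {φ : Ω.tot ⟶ Ω'.tot} (h : IsDeg n φ) (ψ : Ω'.tot ⟶ Ω''.tot)
    {a b : ℤ} (hab : a + n = b) (c : ℤ) :
    block (φ ≫ ψ) a c = block φ a b ≫ block ψ b c := by
  refine Mat_.hom_ext _ _ fun u v => ?_
  refine Eq.trans ?_ (Mat_.comp_apply (block φ a b) (block ψ b c) u v).symm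
  change ∑ z, _ = _
  symm
  refine Fintype.sum_of_injective (fun z : (Ω'.obj.X b).ι => (⟨b, z⟩ : Ω'.Summand))
    (fun u v h => by simpa using h) _ _ ?_ fun _ => rfl
  rintro ⟨m, z⟩ hz
  change ent φ ⟨a, u⟩ ⟨m, z⟩ ≫ ent ψ ⟨m, z⟩ ⟨c, v⟩ = 0
  rw [h, Limits.zero_comp]
  rintro hm
  change a + n = m at hm
  obtain rfl := hab.symm.trans hm
  exact hz ⟨z, rfl⟩

theorem IsDeg.ext {n : ℤ} {φ ψ : Ω.tot ⟶ Ω'.tot} (h : IsDeg n φ) (h' : IsDeg n ψ)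
    (hb : ∀ a b, a + n = b → block φ a b = block ψ a b) : φ = ψ := by
  refine tot_ext fun x y => ?_
  by_cases hxy : x.1 + n = y.1
  · exact congrFun (congrFun (hb _ _ hxy) x.2) y.2
  · rw [h x y hxy, h' x y hxy]

/-- The matrix of degree `n` with given blocks. -/
def ofBlocks (n : ℤ) (f : ∀ a b, Ω.obj.X a ⟶ Ω'.obj.X b) : Ω.tot ⟶ Ω'.tot :=
  ofEntries fun x y => if x.1 + n = y.1 then (f x.1 y.1 : Mat_.Hom _ _) x.2 y.2 else 0

theorem isDeg_ofBlocks (n : ℤ) (f : ∀ a b, Ω.obj.X a ⟶ Ω'.obj.X b) : IsDeg n (ofBlocks n f) :=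
  fun _ _ h => if_neg h

theorem block_ofBlocks {n : ℤ} (f : ∀ a b, Ω.obj.X a ⟶ Ω'.obj.X b) {a b : ℤ} (h : a + n = b) :
    block (ofBlocks n f) a b = f a b := by
  refine Mat_.hom_ext _ _ fun u v => ?_
  exact if_pos h

/-- The matrix of a chain map. -/
def matOf (f : Ω.obj ⟶ Ω'.obj) : Ω.tot ⟶ Ω'.tot :=
  ofBlocks 0 fun a b => if h : a = b then f.f a ≫ eqToHom (congrArg Ω'.obj.X h) else 0

theorem isDeg_matOf (f : Ω.obj ⟶ Ω'.obj) : IsDeg 0 (matOf f) := isDeg_ofBlocks _ _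

theorem block_matOf (f : Ω.obj ⟶ Ω'.obj) (a : ℤ) : block (matOf f) a a = f.f a := by
  rw [matOf, block_ofBlocks _ (add_zero a), dif_pos rfl, eqToHom_refl, Category.comp_id]

theorem matOf_id (Ω : Kob k) : matOf (𝟙 Ω.obj) = 𝟙 Ω.tot := by
  refine (isDeg_matOf _).ext (isDeg_id Ω) fun a b h => ?_
  obtain rfl : a = b := by rw [← h, add_zero]
  rw [block_matOf, block_id]
  rfl

theorem matOf_comp (f : Ω.obj ⟶ Ω'.obj) (g : Ω'.obj ⟶ Ω''.obj) :
    matOf (f ≫ g) = matOf f ≫ matOf g := by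
  refine (isDeg_matOf _).ext ((isDeg_matOf f).comp (isDeg_matOf g)) fun a b h => ?_
  obtain rfl : a = b := by rw [← h, add_zero]
  rw [block_matOf, block_comp (isDeg_matOf f) _ (add_zero a), block_matOf, block_matOf]
  rfl

/-- A matrix of degree zero that commutes with the differentials. -/
def IsChain (φ : Ω.tot ⟶ Ω'.tot) : Prop := IsDeg 0 φ ∧ φ ≫ Ω'.dTot = Ω.dTot ≫ φ

theorem isChain_matOf (f : Ω.obj ⟶ Ω'.obj) : IsChain (matOf f) := by
  refine ⟨isDeg_matOf f, ?_⟩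
  refine IsDeg.ext (n := 1) ((isDeg_matOf f).comp (isDeg_dTot Ω'))
    ((isDeg_dTot Ω).comp (isDeg_matOf f)) fun a b h => ?_
  rw [block_comp (isDeg_matOf f) _ (add_zero a), block_comp (isDeg_dTot Ω) _ h, block_matOf,
    block_matOf, block_dTot, block_dTot]
  exact f.comm a b

/-- The chain map given by a matrix. -/
def homOf {φ : Ω.tot ⟶ Ω'.tot} (h : IsChain φ) : Ω.obj ⟶ Ω'.obj where
  f a := block φ a a
  comm' a b hab := by
    have : block (φ ≫ Ω'.dTot) a b = block (Ω.dTot ≫ φ) a b := by rw [h.2]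
    rwa [block_comp h.1 _ (add_zero a), block_comp (isDeg_dTot Ω) _ hab] at this

theorem matOf_homOf {φ : Ω.tot ⟶ Ω'.tot} (h : IsChain φ) : matOf (homOf h) = φ := by
  refine (isDeg_matOf _).ext h.1 fun a b hab => ?_
  obtain rfl : a = b := by rw [← hab, add_zero]
  rw [block_matOf]
  rfl

theorem matOf_injective {f g : Ω.obj ⟶ Ω'.obj} (h : matOf f = matOf g) : f = g := by
  ext a : 1
  rw [← block_matOf, h, block_matOf]

theorem IsChain.id (Ω : Kob k) : IsChain (𝟙 Ω.tot) :=
  ⟨isDeg_id Ω, by rw [Category.id_comp, Category.comp_id]⟩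

theorem IsChain.comp {φ : Ω.tot ⟶ Ω'.tot} {ψ : Ω'.tot ⟶ Ω''.tot}
    (h : IsChain φ) (h' : IsChain ψ) : IsChain (φ ≫ ψ) := by
  refine ⟨?_, ?_⟩
  · have := h.1.comp h'.1
    rwa [add_zero] at this
  · rw [Category.assoc, h'.2, ← Category.assoc, h.2, Category.assoc]

/-- Chain homotopy of matrices. -/
def TotHtpy (φ ψ : Ω.tot ⟶ Ω'.tot) : Prop :=
  ∃ h : Ω.tot ⟶ Ω'.tot, IsDeg (-1) h ∧ φ = Ω.dTot ≫ h + h ≫ Ω'.dTot + ψ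

theorem TotHtpy.refl (φ : Ω.tot ⟶ Ω'.tot) : TotHtpy φ φ :=
  ⟨0, fun _ _ _ => rfl, by simp⟩

theorem TotHtpy.trans {φ ψ χ : Ω.tot ⟶ Ω'.tot} (h : TotHtpy φ ψ) (h' : TotHtpy ψ χ) :
    TotHtpy φ χ := by
  obtain ⟨s, hs, rfl⟩ := h
  obtain ⟨s', hs', rfl⟩ := h'
  refine ⟨s + s', hs.add hs', ?_⟩
  rw [Preadditive.comp_add, Preadditive.add_comp]
  abel

theorem totHtpy_of_homotopy {f g : Ω.obj ⟶ Ω'.obj} (h : Homotopy f g) :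
    TotHtpy (matOf f) (matOf g) := by
  have hs : IsDeg (-1) (ofBlocks (Ω := Ω) (Ω' := Ω') (-1) h.hom) := isDeg_ofBlocks _ _
  refine ⟨ofBlocks (-1) h.hom, hs, ?_⟩
  have h1 : IsDeg 0 (Ω.dTot ≫ ofBlocks (-1) h.hom) := (isDeg_dTot Ω).comp hs
  have h2 : IsDeg 0 (ofBlocks (-1) h.hom ≫ Ω'.dTot) := hs.comp (isDeg_dTot Ω')
  refine (isDeg_matOf f).ext ((h1.add h2).add (isDeg_matOf g)) fun a b hab => ?_
  obtain rfl : a = b := by rw [← hab, add_zero]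
  have e1 : (ComplexShape.up ℤ).Rel a (a + 1) := rfl
  have e2 : (ComplexShape.up ℤ).Rel (a - 1) a := sub_add_cancel a 1
  rw [block_add, block_add, block_matOf, block_matOf, block_comp (isDeg_dTot Ω) _ (b := a + 1) rfl,
    block_comp hs _ (b := a - 1) rfl, block_ofBlocks _ (by ring), block_ofBlocks _ (by ring),
    block_dTot, block_dTot, h.comm a, dNext_eq _ e1, prevD_eq _ e2]

theorem homotopy_of_totHtpy {f g : Ω.obj ⟶ Ω'.obj} (h : TotHtpy (matOf f) (matOf g)) :
    Nonempty (Homotopy f g) := by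
  obtain ⟨s, hs, h⟩ := h
  refine ⟨⟨fun a b => block s a b, fun a b hab => ?_, fun a => ?_⟩⟩
  · refine Mat_.hom_ext _ _ fun u v => ?_
    refine hs _ _ fun hh => hab ?_
    change b + 1 = a
    change a + -1 = b at hh
    rw [← hh]
    ring
  · have e1 : (ComplexShape.up ℤ).Rel a (a + 1) := rfl
    have e2 : (ComplexShape.up ℤ).Rel (a - 1) a := sub_add_cancel a 1
    have : block (matOf f) a a = block (Ω.dTot ≫ s + s ≫ Ω'.dTot + matOf g) a a := by rw [h]
    rw [block_add, block_add, block_matOf, block_matOf,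
      block_comp (isDeg_dTot Ω) _ (b := a + 1) rfl, block_comp hs _ (b := a - 1) rfl,
      block_dTot, block_dTot] at this
    rw [this, dNext_eq _ e1, prevD_eq _ e2]

theorem nonempty_iso_iff : Nonempty (Ω ≅ Ω') ↔ ∃ (φ : Ω.tot ⟶ Ω'.tot) (ψ : Ω'.tot ⟶ Ω.tot),
    IsChain φ ∧ IsChain ψ ∧ φ ≫ ψ = 𝟙 _ ∧ ψ ≫ φ = 𝟙 _ := by
  constructor
  · rintro ⟨e⟩
    let e' : Ω.obj ≅ Ω'.obj := (finiteLength k).ι.mapIso e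
    refine ⟨matOf e'.hom, matOf e'.inv, isChain_matOf _, isChain_matOf _, ?_, ?_⟩
    · rw [← matOf_comp, e'.hom_inv_id, matOf_id]
    · rw [← matOf_comp, e'.inv_hom_id, matOf_id]
  · rintro ⟨φ, ψ, hφ, hψ, h1, h2⟩
    refine ⟨ObjectProperty.isoMk _ ⟨homOf hφ, homOf hψ, matOf_injective ?_, matOf_injective ?_⟩⟩
    · rw [matOf_comp, matOf_homOf, matOf_homOf, h1, matOf_id]
    · rw [matOf_comp, matOf_homOf, matOf_homOf, h2, matOf_id]

theorem htpyEquiv_iff : HtpyEquiv Ω Ω' ↔ ∃ (φ : Ω.tot ⟶ Ω'.tot) (ψ : Ω'.tot ⟶ Ω.tot),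
    IsChain φ ∧ IsChain ψ ∧ TotHtpy (φ ≫ ψ) (𝟙 _) ∧ TotHtpy (ψ ≫ φ) (𝟙 _) := by
  constructor
  · rintro ⟨e⟩
    refine ⟨matOf e.hom, matOf e.inv, isChain_matOf _, isChain_matOf _, ?_, ?_⟩
    · rw [← matOf_comp, ← matOf_id]
      exact totHtpy_of_homotopy e.homotopyHomInvId
    · rw [← matOf_comp, ← matOf_id]
      exact totHtpy_of_homotopy e.homotopyInvHomId
  · rintro ⟨φ, ψ, hφ, hψ, h1, h2⟩
    have e1 : TotHtpy (matOf (homOf hφ ≫ homOf hψ)) (matOf (𝟙 Ω.obj)) := by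
      rwa [matOf_comp, matOf_homOf, matOf_homOf, matOf_id]
    have e2 : TotHtpy (matOf (homOf hψ ≫ homOf hφ)) (matOf (𝟙 Ω'.obj)) := by
      rwa [matOf_comp, matOf_homOf, matOf_homOf, matOf_id]
    obtain ⟨s1⟩ := homotopy_of_totHtpy e1
    obtain ⟨s2⟩ := homotopy_of_totHtpy e2
    exact ⟨⟨homOf hφ, homOf hψ, s1, s2⟩⟩

theorem htpyEquiv_of_iso (h : Nonempty (Ω ≅ Ω')) : HtpyEquiv Ω Ω' := by
  obtain ⟨φ, ψ, hφ, hψ, h1, h2⟩ := nonempty_iso_iff.1 h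
  exact htpyEquiv_iff.2 ⟨φ, ψ, hφ, hψ, h1 ▸ TotHtpy.refl _, h2 ▸ TotHtpy.refl _⟩

/-- Complexes are isomorphic if their summands correspond to each other bijectively, by isomorphic
smoothings of the same degree, compatibly with the entries of the differential. -/
theorem nonempty_iso_of_summands (B : Ω.Summand ≃ Ω'.Summand) (hB : ∀ x, (B x).1 = x.1)
    (η : ∀ x, x.sm ≅ (B x).sm)
    (h : ∀ x y, dEntry x y ≫ (η y).hom = (η x).hom ≫ dEntry (B x) (B y)) :
    Nonempty (Ω ≅ Ω') := by
  let φ : Ω.tot ⟶ Ω'.tot := ofEntries fun x y => (η x).hom ≫ idEntry (B x) y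
  let ψ : Ω'.tot ⟶ Ω.tot := ofEntries fun y x => idEntry y (B x) ≫ (η x).inv
  have h1 : φ ≫ ψ = 𝟙 _ := by
    refine tot_ext fun x y => ?_
    rw [ent_comp, Fintype.sum_eq_single (B x)]
    · simp only [φ, ψ, ent_ofEntries, idEntry_self, Category.comp_id, ent_id]
      by_cases hxy : x = y
      · subst hxy
        simp [idEntry_self]
      · rw [idEntry_eq_zero hxy, idEntry_eq_zero fun hh => hxy (B.injective hh)]
        simp
    · intro z hz
      simp only [φ, ent_ofEntries]
      rw [idEntry_eq_zero hz.symm]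
      simp
  have h2 : ψ ≫ φ = 𝟙 _ := by
    refine tot_ext fun x y => ?_
    obtain ⟨x, rfl⟩ := B.surjective x
    rw [ent_comp, Fintype.sum_eq_single x]
    · simp [φ, ψ, ent_id, idEntry_self]
    · intro z hz
      simp only [ψ, ent_ofEntries]
      rw [idEntry_eq_zero fun hh => hz (B.injective hh).symm]
      simp
  have h3 : φ ≫ Ω'.dTot = Ω.dTot ≫ φ := by
    refine tot_ext fun x y => ?_
    obtain ⟨y, rfl⟩ := B.surjective y
    rw [ent_comp, ent_comp, Fintype.sum_eq_single (B x), Fintype.sum_eq_single y]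
    · simp [φ, idEntry_self, dTot, h]
    · intro z hz
      simp only [φ, ent_ofEntries]
      rw [idEntry_eq_zero fun hh => hz (B.injective hh)]
      simp
    · intro z hz
      simp only [φ, ent_ofEntries]
      rw [idEntry_eq_zero hz.symm]
      simp
  refine nonempty_iso_iff.2 ⟨φ, ψ, ⟨fun x y hxy => ?_, h3⟩, ⟨fun y x hxy => ?_, ?_⟩, h1, h2⟩
  · simp only [φ, ent_ofEntries]
    rw [idEntry_eq_zero fun hh => hxy (by rw [← hh, hB, add_zero]), Limits.comp_zero]
  · simp only [ψ, ent_ofEntries]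
    rw [idEntry_eq_zero fun hh => hxy (by rw [hh, hB, add_zero]), Limits.zero_comp]
  · calc ψ ≫ Ω.dTot = ψ ≫ (Ω.dTot ≫ φ) ≫ ψ := by rw [Category.assoc, h1, Category.comp_id]
      _ = (ψ ≫ φ) ≫ Ω'.dTot ≫ ψ := by rw [← h3]; simp only [Category.assoc]
      _ = Ω'.dTot ≫ ψ := by rw [h2, Category.id_comp]

end Kob

/-! ### The tensor product as a functor on matrices -/

namespace PlanarArcDiagram

open Kob

variable {d : ℕ} {κ : Fin d → ℕ} {k : ℕ} (D : PlanarArcDiagram κ k)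
variable {Ω Ω' Ω'' : ∀ i, Kob (κ i)}

theorem map_smul_univ {T T' : ∀ i, Cobl (κ i)} (c : Fin d → ℤ) (f : ∀ i, T i ⟶ T' i) :
    D.map (fun i => c i • f i) = (∏ i, c i) • D.map f :=
  (D.multi T T').map_smul_univ c f

theorem map_add_slot {T T' : ∀ i, Cobl (κ i)} {e f g : ∀ i, T i ⟶ T' i} (l : Fin d)
    (hf : ∀ j, j ≠ l → f j = e j) (hg : ∀ j, j ≠ l → g j = e j) (h : e l = f l + g l) :
    D.map e = D.map f + D.map g := by
  have key : ∀ f : ∀ i, T i ⟶ T' i, (∀ j, j ≠ l → f j = e j) → f = Function.update e l (f l) := by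
    intro f hf
    ext1 j
    by_cases hj : j = l
    · subst hj
      rw [Function.update_self]
    · rw [Function.update_of_ne hj, hf j hj]
  have he := key e fun _ _ => rfl
  rw [h] at he
  calc D.map e = D.map (Function.update e l (f l + g l)) := congrArg D.map he
    _ = D.map (Function.update e l (f l)) + D.map (Function.update e l (g l)) :=
      (D.multi T T').map_update_add e l (f l) (g l)
    _ = D.map f + D.map g := by rw [← key f hf, ← key g hg]

/-- The summands of `D(Ω₁, …, Ω_d)` are the tuples of summands of the `Ω_i`. -/
def tensorEquiv (Ω : ∀ i, Kob (κ i)) : (D.tensor Ω).Summand ≃ ∀ i, (Ω i).Summand where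
  toFun x := x.2.1
  invFun p := ⟨deg p, ⟨p, rfl⟩⟩
  left_inv := by rintro ⟨_, p, rfl⟩; rfl
  right_inv _ := rfl

theorem tensor_deg (x : (D.tensor Ω).Summand) : x.1 = ∑ i, (D.tensorEquiv Ω x i).1 := x.2.2.symm

/-- The action of a planar arc diagram on matrices of morphisms. -/
def tmat (f : ∀ i, (Ω i).tot ⟶ (Ω' i).tot) : (D.tensor Ω).tot ⟶ (D.tensor Ω').tot :=
  ofEntries fun x y => D.map fun i => ent (f i) (D.tensorEquiv Ω x i) (D.tensorEquiv Ω' y i)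

theorem ent_tmat (f : ∀ i, (Ω i).tot ⟶ (Ω' i).tot) (x : (D.tensor Ω).Summand)
    (y : (D.tensor Ω').Summand) : ent (D.tmat f) x y =
      D.map fun i => ent (f i) (D.tensorEquiv Ω x i) (D.tensorEquiv Ω' y i) := rfl

theorem tmat_comp (f : ∀ i, (Ω i).tot ⟶ (Ω' i).tot) (g : ∀ i, (Ω' i).tot ⟶ (Ω'' i).tot) :
    D.tmat f ≫ D.tmat g = D.tmat fun i => f i ≫ g i := by
  refine tot_ext fun x y => ?_
  rw [ent_comp, ent_tmat]
  simp only [ent_comp]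
  refine Eq.trans ?_ (D.map_sum _).symm
  refine Fintype.sum_equiv (D.tensorEquiv Ω') _ _ fun z => ?_
  exact (D.map_comp _ _).symm

theorem map_idEntry (p q : ∀ i, (Ω i).Summand) (h : p ≠ q) :
    D.map (fun i => idEntry (p i) (q i)) = 0 := by
  obtain ⟨i, hi⟩ := Function.ne_iff.1 h
  exact D.map_eq_zero i (idEntry_eq_zero hi)

theorem map_idEntry_self (p : ∀ i, (Ω i).Summand) :
    D.map (fun i => idEntry (p i) (p i)) = 𝟙 (D.obj fun i => (p i).sm) := by
  simp only [idEntry_self]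
  exact D.map_id _

theorem tensor_idEntry (x y : (D.tensor Ω).Summand) :
    idEntry x y = D.map fun i => idEntry (D.tensorEquiv Ω x i) (D.tensorEquiv Ω y i) := by
  by_cases h : x = y
  · subst h
    rw [idEntry_self, map_idEntry_self]
    rfl
  · rw [idEntry_eq_zero h, map_idEntry]
    · rfl
    · exact fun hh => h ((D.tensorEquiv Ω).injective hh)

theorem tmat_id : D.tmat (fun i => 𝟙 (Ω i).tot) = 𝟙 (D.tensor Ω).tot := by
  refine tot_ext fun x y => ?_
  rw [ent_tmat, ent_id, tensor_idEntry]
  exact congrArg D.map (funext fun i => ent_id _ _)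

theorem tmat_add_slot {e f g : ∀ i, (Ω i).tot ⟶ (Ω' i).tot} (l : Fin d)
    (hf : ∀ j, j ≠ l → f j = e j) (hg : ∀ j, j ≠ l → g j = e j) (h : e l = f l + g l) :
    D.tmat e = D.tmat f + D.tmat g := by
  refine tot_ext fun x y => D.map_add_slot l (fun j hj => ?_) (fun j hj => ?_) ?_
  · exact congrArg (fun φ => ent φ _ _) (hf j hj)
  · exact congrArg (fun φ => ent φ _ _) (hg j hj)
  · exact congrArg (fun φ => ent φ _ _) h

theorem tmat_add_neg_slot {f g : ∀ i, (Ω i).tot ⟶ (Ω' i).tot} (l : Fin d)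
    (h : ∀ j, j ≠ l → f j = g j) (hl : f l = -g l) : D.tmat f + D.tmat g = 0 := by
  rw [← D.tmat_add_slot (e := Function.update f l 0) l]
  · refine tot_ext fun x y => D.map_eq_zero l ?_
    rw [Function.update_self]
    rfl
  · exact fun j hj => (Function.update_of_ne hj _ _).symm
  · exact fun j hj => by rw [Function.update_of_ne hj, h j hj]
  · rw [Function.update_self, hl, neg_add_cancel]

theorem isDeg_tmat {n : Fin d → ℤ} {f : ∀ i, (Ω i).tot ⟶ (Ω' i).tot} (h : ∀ i, IsDeg (n i) (f i)) :
    IsDeg (∑ i, n i) (D.tmat f) := by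
  intro x y hxy
  rw [D.tensor_deg x, D.tensor_deg y, ← Finset.sum_add_distrib] at hxy
  obtain ⟨i, hi⟩ : ∃ i, (D.tensorEquiv Ω x i).1 + n i ≠ (D.tensorEquiv Ω' y i).1 := by
    by_contra! hh
    exact hxy (Finset.sum_congr rfl fun i _ => hh i)
  exact D.map_eq_zero i (h i _ _ hi)

/-- The family of matrices with `i`-th member the differential, preceded by parity involutions and
followed by identities. -/
def diffFam (Ω : ∀ i, Kob (κ i)) (i j : Fin d) : (Ω j).tot ⟶ (Ω j).tot :=
  if j < i then (Ω j).parity else if j = i then (Ω j).dTot else 𝟙 _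

theorem negOnePow_sum {ι : Type*} (s : Finset ι) (n : ι → ℤ) :
    (((∑ j ∈ s, n j).negOnePow : ℤˣ) : ℤ) = ∏ j ∈ s, (((n j).negOnePow : ℤˣ) : ℤ) := by
  classical
  induction s using Finset.induction_on with
  | empty => simp
  | insert a s ha ih =>
    rw [Finset.sum_insert ha, Finset.prod_insert ha, Int.negOnePow_add, Units.val_mul, ih]

/-- The signs in the differential of `D(Ω₁, …, Ω_d)` are absorbed by the parity involutions. -/
theorem dTot_tensor (Ω : ∀ i, Kob (κ i)) :
    (D.tensor Ω).dTot = ∑ i, D.tmat (diffFam Ω i) := by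
  refine tot_ext fun x y => ?_
  rw [ent_sum]
  change ∑ i, sign (D.tensorEquiv Ω x) i •
    D.map (slot i (D.tensorEquiv Ω x) (D.tensorEquiv Ω y)) = _
  refine Finset.sum_congr rfl fun i _ => ?_
  rw [ent_tmat]
  have h1 : sign (D.tensorEquiv Ω x) i =
      ∏ j, if j < i then ((((D.tensorEquiv Ω x j).1).negOnePow : ℤˣ) : ℤ) else 1 := by
    rw [← Finset.prod_filter, ← negOnePow_sum]
    rfl
  rw [h1, ← map_smul_univ]
  congr 1
  ext1 j
  unfold diffFam slot
  rcases lt_trichotomy j i with h | h | h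
  · rw [if_pos h, if_pos h, if_neg h.ne]
    rfl
  · rw [if_neg h.not_lt, if_pos h, if_neg h.not_lt, if_pos h, one_smul]
    rfl
  · rw [if_neg h.not_gt, if_neg h.ne', if_neg h.not_gt, if_neg h.ne', one_smul, ent_id]

theorem isChain_tmat {f : ∀ i, (Ω i).tot ⟶ (Ω' i).tot} (h : ∀ i, IsChain (f i)) :
    IsChain (D.tmat f) := by
  refine ⟨?_, ?_⟩
  · simpa using D.isDeg_tmat (n := fun _ => 0) fun i => (h i).1
  · rw [dTot_tensor, dTot_tensor, Preadditive.comp_sum, Preadditive.sum_comp]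
    refine Finset.sum_congr rfl fun i _ => ?_
    rw [tmat_comp, tmat_comp]
    congr 1
    ext1 j
    unfold diffFam
    split_ifs
    · exact (h j).1.parity_comp_even.symm
    · exact (h j).2
    · rw [Category.id_comp, Category.comp_id]

/-- Changing one input by a chain homotopy `h` changes the result by the chain homotopy
`D(±f₁, …, ±f_{l-1}, h, f_{l+1}, …, f_d)`. -/
theorem totHtpy_tmat_slot {f g : ∀ i, (Ω i).tot ⟶ (Ω' i).tot} (hf : ∀ i, IsChain (f i))
    (l : Fin d) (h : ∀ j, j ≠ l → f j = g j) (hl : TotHtpy (f l) (g l)) :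
    TotHtpy (D.tmat f) (D.tmat g) := by
  obtain ⟨s, hs, hl⟩ := hl
  let H : ∀ j, (Ω j).tot ⟶ (Ω' j).tot := fun j =>
    if hj : j = l then hj ▸ s else if j < l then (Ω j).parity ≫ f j else f j
  have Hl : H l = s := dif_pos rfl
  have Hlt : ∀ j, j < l → H j = (Ω j).parity ≫ f j := fun j hj => by
    simp only [H]
    rw [dif_neg hj.ne, if_pos hj]
  have Hgt : ∀ j, l < j → H j = f j := fun j hj => by
    simp only [H]
    rw [dif_neg hj.ne', if_neg hj.not_gt]
  have Hdeg : IsDeg (-1) (D.tmat H) := by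
    have := D.isDeg_tmat (n := fun j => if j = l then -1 else 0) (f := H) fun j => by
      rcases lt_trichotomy j l with hj | rfl | hj
      · rw [if_neg hj.ne, Hlt j hj, (hf j).1.parity_comp_even]
        intro x y hxy
        rw [ent_comp_parity, (hf j).1 x y hxy, smul_zero]
      · rw [if_pos rfl, Hl]
        exact hs
      · rw [if_neg hj.ne', Hgt j hj]
        exact (hf j).1
    simpa using this
  have Hdf : ∀ j, (Ω j).parity ≫ (Ω j).parity ≫ f j = f j := fun j => by
    rw [← Category.assoc, parity_parity, Category.id_comp]
  have Hfd : ∀ j, ((Ω j).parity ≫ f j) ≫ (Ω' j).parity = f j := fun j => by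
    rw [Category.assoc, ← (hf j).1.parity_comp_even, Hdf]
  refine ⟨D.tmat H, Hdeg, ?_⟩
  rw [dTot_tensor, dTot_tensor, Preadditive.comp_sum, Preadditive.sum_comp,
    ← Finset.sum_add_distrib]
  simp only [tmat_comp]
  rw [Finset.sum_eq_single l]
  · rw [← D.tmat_add_slot (e := Function.update f l ((Ω l).dTot ≫ s + s ≫ (Ω' l).dTot)) l]
    · refine D.tmat_add_slot l (fun j hj => Function.update_of_ne hj _ _)
        (fun j hj => (h j hj).symm) ?_
      rw [Function.update_self, hl]
    · intro j hj
      rw [Function.update_of_ne hj, diffFam]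
      rcases hj.lt_or_gt with hj | hj
      · rw [if_pos hj, Hlt j hj, Hdf]
      · rw [if_neg hj.not_gt, if_neg hj.ne', Hgt j hj, Category.id_comp]
    · intro j hj
      rw [Function.update_of_ne hj, diffFam]
      rcases hj.lt_or_gt with hj | hj
      · rw [if_pos hj, Hlt j hj, Hfd]
      · rw [if_neg hj.not_gt, if_neg hj.ne', Hgt j hj, Category.comp_id]
    · rw [Function.update_self, Hl, diffFam, diffFam, if_neg (lt_irrefl l), if_neg (lt_irrefl l),
        if_pos rfl, if_pos rfl]
  · intro i _ hil
    -- For `i ≠ l` the two terms differ by a sign in the slot `min i l`.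
    rcases hil.lt_or_gt with hil | hil
    · refine D.tmat_add_neg_slot i (fun j hj => ?_) ?_
      · unfold diffFam
        rcases hj.lt_or_gt with hji | hji
        · rw [if_pos hji, if_pos hji, Hlt j (hji.trans hil), Hdf, Hfd]
        · rw [if_neg hji.not_gt, if_neg hj, if_neg hji.not_gt, if_neg hj, Category.id_comp,
            Category.comp_id]
      · simp only [diffFam, if_neg (lt_irrefl i), if_true]
        rw [Hlt i hil, Category.assoc, (hf i).2, ← Category.assoc, ← Category.assoc,
          (isDeg_dTot (Ω i)).parity_comp_one, Preadditive.neg_comp, neg_neg]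
    · refine D.tmat_add_neg_slot l (fun j hj => ?_) ?_
      · unfold diffFam
        rcases lt_trichotomy j i with hji | rfl | hji
        · rw [if_pos hji, if_pos hji]
          rcases hj.lt_or_gt with hjl | hjl
          · rw [Hlt j hjl, Hdf, Hfd]
          · rw [Hgt j hjl, (hf j).1.parity_comp_even]
        · rw [if_neg (lt_irrefl j), if_pos rfl, if_neg (lt_irrefl j), if_pos rfl, Hgt j hil,
            (hf j).2]
        · rw [if_neg hji.not_gt, if_neg hji.ne', if_neg hji.not_gt, if_neg hji.ne',
            Category.id_comp, Category.comp_id]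
      · simp only [diffFam, if_pos hil]
        rw [Hl, hs.parity_comp_neg_one]
  · exact fun hh => absurd (Finset.mem_univ l) hh

theorem totHtpy_tmat {f g : ∀ i, (Ω i).tot ⟶ (Ω' i).tot} (hf : ∀ i, IsChain (f i))
    (hg : ∀ i, IsChain (g i)) (h : ∀ i, TotHtpy (f i) (g i)) : TotHtpy (D.tmat f) (D.tmat g) := by
  have key : ∀ s : Finset (Fin d), TotHtpy (D.tmat f) (D.tmat (s.piecewise g f)) := by
    intro s
    induction s using Finset.induction_on with
    | empty =>
      rw [Finset.piecewise_empty]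
      exact TotHtpy.refl _
    | insert l s hl ih =>
      refine ih.trans (D.totHtpy_tmat_slot (fun i => ?_) l (fun j hj => ?_) ?_)
      · by_cases hi : i ∈ s
        · rw [Finset.piecewise_eq_of_mem _ _ _ hi]
          exact hg i
        · rw [Finset.piecewise_eq_of_notMem _ _ _ hi]
          exact hf i
      · rw [Finset.piecewise_insert, Function.update_of_ne hj]
      · rw [Finset.piecewise_insert, Function.update_self, Finset.piecewise_eq_of_notMem _ _ _ hl]
        exact h l
  simpa only [Finset.piecewise_univ] using key Finset.univ

/-- The action of a planar arc diagram respects isomorphism of complexes. -/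
theorem tensor_iso (h : ∀ i, Nonempty (Ω i ≅ Ω' i)) : Nonempty (D.tensor Ω ≅ D.tensor Ω') := by
  simp only [nonempty_iso_iff] at h ⊢
  choose φ ψ hφ hψ h1 h2 using h
  refine ⟨D.tmat φ, D.tmat ψ, D.isChain_tmat hφ, D.isChain_tmat hψ, ?_, ?_⟩
  · rw [tmat_comp, ← tmat_id]
    simp only [h1]
  · rw [tmat_comp, ← tmat_id]
    simp only [h2]

/-- The action of a planar arc diagram respects homotopy equivalence of complexes. -/
theorem tensor_htpyEquiv (h : ∀ i, HtpyEquiv (Ω i) (Ω' i)) :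
    HtpyEquiv (D.tensor Ω) (D.tensor Ω') := by
  simp only [htpyEquiv_iff] at h ⊢
  choose φ ψ hφ hψ h1 h2 using h
  refine ⟨D.tmat φ, D.tmat ψ, D.isChain_tmat hφ, D.isChain_tmat hψ, ?_, ?_⟩
  · rw [tmat_comp, ← tmat_id]
    exact D.totHtpy_tmat (fun i => (hφ i).comp (hψ i)) (fun i => IsChain.id _) h1
  · rw [tmat_comp, ← tmat_id]
    exact D.totHtpy_tmat (fun i => (hψ i).comp (hφ i)) (fun i => IsChain.id _) h2

end PlanarArcDiagram

/-! ### Ambient isotopy -/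

theorem AmbientIsotopic.symm {S S' : Set (ℂ × ℝ)} (h : AmbientIsotopic S S') :
    AmbientIsotopic S' S := by
  obtain ⟨H, hH, h0, hid, rfl⟩ := h
  have hid' : ∀ p, p ∉ openCyl → (H 1).symm p = p := fun p hp => by
    rw [Homeomorph.symm_apply_eq, hid 1 p hp]
  refine ⟨fun t => (H 1).symm.trans (H (unitInterval.symm t)), ?_, fun p => ?_,
    fun t p hp => ?_, ?_⟩
  · exact hH.comp ((unitInterval.continuous_symm.comp continuous_fst).prodMk
      ((H 1).symm.continuous.comp continuous_snd))
  · simp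
  · rw [Homeomorph.trans_apply, hid' p hp, hid _ p hp]
  · rw [image_image]
    simp [h0]

theorem AmbientIsotopic.trans {S S' S'' : Set (ℂ × ℝ)} (h : AmbientIsotopic S S')
    (h' : AmbientIsotopic S' S'') : AmbientIsotopic S S'' := by
  obtain ⟨H, hH, h0, hid, rfl⟩ := h
  obtain ⟨K, hK, k0, kid, rfl⟩ := h'
  refine ⟨fun t => (H t).trans (K t), ?_, fun p => ?_, fun t p hp => ?_, ?_⟩
  · exact hK.comp (continuous_fst.prodMk hH)
  · rw [Homeomorph.trans_apply, h0, k0]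
  · rw [Homeomorph.trans_apply, hid t p hp, kid t p hp]
  · rw [image_image]
    rfl

theorem AmbientIsotopic.image {S S' : Set (ℂ × ℝ)} (h : AmbientIsotopic S S')
    (G : ℂ × ℝ ≃ₜ ℂ × ℝ) (hG : ∀ p, G p ∈ openCyl ↔ p ∈ openCyl) :
    AmbientIsotopic (G '' S) (G '' S') := by
  obtain ⟨H, hH, h0, hid, rfl⟩ := h
  refine ⟨fun t => (G.symm.trans (H t)).trans G, ?_, fun p => ?_, fun t p hp => ?_, ?_⟩
  · exact G.continuous.comp
      (hH.comp (continuous_fst.prodMk (G.symm.continuous.comp continuous_snd)))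
  · simp [h0]
  · simp only [Homeomorph.trans_apply]
    rw [hid t _ fun hh => hp ?_, G.apply_symm_apply]
    rwa [← hG, G.apply_symm_apply] at hh
  · rw [image_image, image_image]
    simp

theorem isHomeomorph_of_eqOn_compl {X : Type*} [TopologicalSpace X] [T2Space X] {f : X → X}
    {U K : Set X} (hf : Continuous f) (hb : Function.Bijective f) (hU : IsOpen U) (hUK : U ⊆ K)
    (hK : IsCompact K) (hid : ∀ x, x ∉ U → f x = x) : IsHomeomorph f := by
  refine isHomeomorph_iff_continuous_isClosedMap_bijective.2 ⟨hf, fun F hF => ?_, hb⟩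
  have h1 : f '' F = f '' (F ∩ K) ∪ F \ U := by
    ext p
    constructor
    · rintro ⟨q, hq, rfl⟩
      by_cases hqc : q ∈ U
      · exact Or.inl ⟨q, ⟨hq, hUK hqc⟩, rfl⟩
      · exact Or.inr (by rw [hid q hqc]; exact ⟨hq, hqc⟩)
    · rintro (⟨q, hq, rfl⟩ | ⟨hp, hpc⟩)
      · exact ⟨q, hq.1, rfl⟩
      · exact ⟨p, hp, hid p hpc⟩
  rw [h1]
  exact ((hK.inter_left hF).image hf).isClosed.union (hF.sdiff hU)

/-! ### Isotopies of the disk and their traces -/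

/-- An ambient isotopy of the plane that starts at the identity and is fixed near and outside the
boundary circle of the unit disk. -/
structure DiskIsotopy where
  homeo : unitInterval → (ℂ ≃ₜ ℂ)
  continuous_homeo : Continuous fun q : unitInterval × ℂ => homeo q.1 q.2
  zero : ∀ z, homeo 0 z = z
  supp : ∃ ρ < 1, ∀ t z, ρ ≤ ‖z‖ → homeo t z = z

namespace DiskIsotopy

variable (F : DiskIsotopy)

theorem fix {t : unitInterval} {z : ℂ} (h : 1 ≤ ‖z‖) : F.homeo t z = z := by
  obtain ⟨ρ, hρ, hF⟩ := F.supp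
  exact hF t z (hρ.le.trans h)

theorem norm_lt_iff (t : unitInterval) (z : ℂ) : ‖F.homeo t z‖ < 1 ↔ ‖z‖ < 1 := by
  constructor
  · intro h
    by_contra hz
    rw [F.fix (not_lt.1 hz)] at h
    exact hz h
  · intro h
    by_contra hz
    rw [(F.homeo t).injective (F.fix (not_lt.1 hz))] at hz
    exact hz h

theorem symm_fix {ρ : ℝ} (h : ∀ t z, ρ ≤ ‖z‖ → F.homeo t z = z) (t : unitInterval) {z : ℂ}
    (hz : ρ ≤ ‖z‖) : (F.homeo t).symm z = z := by
  rw [Homeomorph.symm_apply_eq, h t z hz]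

theorem norm_symm_le {t : unitInterval} {z : ℂ} (h : ‖(F.homeo t).symm z‖ ≤ 1) : ‖z‖ ≤ 1 := by
  by_contra hz
  rw [Homeomorph.symm_apply_eq (F.homeo t) |>.2 (F.fix (not_le.1 hz).le).symm] at h
  exact hz h

theorem continuous_symm : Continuous fun q : unitInterval × ℂ => (F.homeo q.1).symm q.2 := by
  let f : unitInterval × ℂ → unitInterval × ℂ := fun q => (q.1, F.homeo q.1 q.2)
  have hf : IsHomeomorph f := by
    refine isHomeomorph_of_eqOn_compl (U := univ ×ˢ Metric.ball 0 1)
      (K := univ ×ˢ Metric.closedBall 0 1) (continuous_fst.prodMk F.continuous_homeo) ⟨?_, ?_⟩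
      (isOpen_univ.prod Metric.isOpen_ball) (prod_mono subset_rfl Metric.ball_subset_closedBall)
      (isCompact_univ.prod (isCompact_closedBall 0 1)) ?_
    · rintro ⟨t, z⟩ ⟨t', z'⟩ h
      obtain ⟨rfl, h2⟩ := Prod.mk.injEq _ _ _ _ ▸ h
      exact Prod.ext rfl ((F.homeo t).injective h2)
    · rintro ⟨t, z⟩
      exact ⟨(t, (F.homeo t).symm z), Prod.ext rfl ((F.homeo t).apply_symm_apply z)⟩
    · rintro ⟨t, z⟩ h
      refine Prod.ext rfl (F.fix ?_)
      by_contra hz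
      exact h ⟨mem_univ _, by simpa using hz⟩
  have h2 : ∀ q, hf.homeomorph.symm q = (q.1, (F.homeo q.1).symm q.2) := fun q => by
    rw [Homeomorph.symm_apply_eq]
    exact Prod.ext rfl ((F.homeo q.1).apply_symm_apply q.2).symm
  have := continuous_snd.comp hf.homeomorph.symm.continuous
  simpa only [Function.comp_def, h2] using this

/-- The self-homeomorphism `(z, s) ↦ (F_{a(s)}(z), s)` of `ℂ × ℝ`. -/
def track (a : C(ℝ, unitInterval)) : ℂ × ℝ ≃ₜ ℂ × ℝ where
  toFun p := (F.homeo (a p.2) p.1, p.2)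
  invFun p := ((F.homeo (a p.2)).symm p.1, p.2)
  left_inv p := by simp
  right_inv p := by simp
  continuous_toFun := (F.continuous_homeo.comp
    ((a.continuous.comp continuous_snd).prodMk continuous_fst)).prodMk continuous_snd
  continuous_invFun := (F.continuous_symm.comp
    ((a.continuous.comp continuous_snd).prodMk continuous_fst)).prodMk continuous_snd

theorem track_apply (a : C(ℝ, unitInterval)) (p : ℂ × ℝ) :
    F.track a p = (F.homeo (a p.2) p.1, p.2) := rfl

theorem track_symm_apply (a : C(ℝ, unitInterval)) (p : ℂ × ℝ) :
    (F.track a).symm p = ((F.homeo (a p.2)).symm p.1, p.2) := rfl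

theorem mem_track (a : C(ℝ, unitInterval)) {X : Set (ℂ × ℝ)} {z : ℂ} {s : ℝ} :
    (z, s) ∈ F.track a '' X ↔ ((F.homeo (a s)).symm z, s) ∈ X := by
  rw [Homeomorph.image_eq_preimage_symm]
  rfl

theorem track_mem_openCyl (a : C(ℝ, unitInterval)) (p : ℂ × ℝ) :
    F.track a p ∈ openCyl ↔ p ∈ openCyl := by
  rw [track_apply]
  simp only [openCyl, mem_prod, mem_ball_zero_iff, F.norm_lt_iff]

theorem track_zero (X : Set (ℂ × ℝ)) : F.track (ContinuousMap.const ℝ 0) '' X = X := by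
  ext ⟨z, s⟩
  rw [mem_track]
  have : (F.homeo ((ContinuousMap.const ℝ (0 : unitInterval)) s)).symm z = z := by
    rw [Homeomorph.symm_apply_eq]
    exact (F.zero z).symm
  rw [this]

/-- Only the values of `a` outside `(0, 1)` matter for the isotopy class of the image under
`track a`. -/
theorem track_isotopic {a b : C(ℝ, unitInterval)} (h : ∀ s, s ∉ Ioo (0 : ℝ) 1 → a s = b s)
    (X : Set (ℂ × ℝ)) : AmbientIsotopic (F.track a '' X) (F.track b '' X) := by
  let c : unitInterval → ℝ → unitInterval := fun t s =>
    ⟨(1 - t) * a s + t * b s, (convex_Icc (0 : ℝ) 1) (a s).2 (b s).2 (sub_nonneg.2 t.2.2) t.2.1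
      (by ring)⟩
  have hc : Continuous fun q : unitInterval × ℝ => c q.1 q.2 := by
    refine Continuous.subtype_mk ?_ _
    fun_prop
  let C : unitInterval → C(ℝ, unitInterval) := fun t => ⟨c t, hc.comp (Continuous.prodMk_right t)⟩
  have hC0 : ∀ s, C 0 s = a s := fun s => Subtype.ext (by simp [C, c])
  have hC1 : ∀ s, C 1 s = b s := fun s => Subtype.ext (by simp [C, c])
  have hCe : ∀ t s, s ∉ Ioo (0 : ℝ) 1 → C t s = a s := fun t s hs => by
    refine Subtype.ext ?_
    change (1 - (t : ℝ)) * a s + t * b s = a s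
    rw [h s hs]
    ring
  refine ⟨fun t => (F.track a).symm.trans (F.track (C t)), ?_, fun p => ?_, fun t p hp => ?_, ?_⟩
  · have h1 : Continuous fun q : unitInterval × (ℂ × ℝ) => (F.track a).symm q.2 :=
      (F.track a).symm.continuous.comp continuous_snd
    have h2 : Continuous fun q : unitInterval × (ℂ × ℝ) => C q.1 ((F.track a).symm q.2).2 :=
      hc.comp (continuous_fst.prodMk (continuous_snd.comp h1))
    exact (F.continuous_homeo.comp (h2.prodMk (continuous_fst.comp h1))).prodMk
      (continuous_snd.comp h1)
  · simp only [Homeomorph.trans_apply, track_apply, track_symm_apply, hC0,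
      Homeomorph.apply_symm_apply]
  · simp only [Homeomorph.trans_apply, track_apply, track_symm_apply]
    by_cases hs : p.2 ∈ Ioo (0 : ℝ) 1
    · have hz : 1 ≤ ‖p.1‖ := by
        by_contra hz
        exact hp ⟨by simpa using hz, hs⟩
      have h1 : (F.homeo (a p.2)).symm p.1 = p.1 := by
        rw [Homeomorph.symm_apply_eq, F.fix hz]
      rw [h1, F.fix hz]
    · rw [hCe t _ hs, Homeomorph.apply_symm_apply]
  · rw [image_image]
    refine image_congr fun p _ => ?_
    rw [Homeomorph.trans_apply, Homeomorph.symm_apply_apply, track_apply, track_apply, hC1]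

/-- The concatenation of two paths, reparametrised in the same way as a composition of
cobordisms. -/
def join (a b : C(ℝ, unitInterval)) (h : a 1 = b 0) : C(ℝ, unitInterval) where
  toFun s := if s ≤ 1 / 2 then a (2 * s) else b (2 * s - 1)
  continuous_toFun := by
    refine Continuous.if_le (by fun_prop) (by fun_prop) continuous_id continuous_const ?_
    rintro s rfl
    simpa using h

theorem join_left {a b : C(ℝ, unitInterval)} {h : a 1 = b 0} {s : ℝ} (hs : s ≤ 1 / 2) :
    join a b h s = a (2 * s) := if_pos hs

theorem join_right {a b : C(ℝ, unitInterval)} {h : a 1 = b 0} {s : ℝ} (hs : 1 / 2 ≤ s) :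
    join a b h s = b (2 * s - 1) := by
  rcases hs.eq_or_lt with rfl | hs
  · rw [join_left le_rfl]
    simpa using h
  · exact if_neg hs.not_ge

theorem stack_track {X X' : Set (ℂ × ℝ)} (hX : ∀ p ∈ X, p.2 ∈ Icc (0 : ℝ) 1)
    (hX' : ∀ p ∈ X', p.2 ∈ Icc (0 : ℝ) 1) {a b : C(ℝ, unitInterval)} (h : a 1 = b 0) :
    place 0 1 (1 / 2) 0 '' (F.track a '' X) ∪ place 0 1 (1 / 2) (1 / 2) '' (F.track b '' X') =
      F.track (join a b h) '' (place 0 1 (1 / 2) 0 '' X ∪ place 0 1 (1 / 2) (1 / 2) '' X') := by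
  ext ⟨z, s⟩
  rw [mem_stack, mem_track, mem_track, mem_track, mem_stack]
  refine or_congr ?_ ?_
  · by_cases hs : s ≤ 1 / 2
    · rw [join_left hs]
    · have : ∀ y, (y, 2 * s) ∉ X := fun y hy => by
        have := (hX _ hy).2
        simp only at this
        linarith
      exact iff_of_false (this _) (this _)
  · by_cases hs : 1 / 2 ≤ s
    · rw [join_right hs]
    · have : ∀ y, (y, 2 * s - 1) ∉ X' := fun y hy => by
        have := (hX' _ hy).1
        simp only at this
        linarith
      exact iff_of_false (this _) (this _)

variable {k : ℕ} {T T' P P' : Smoothing k}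

theorem _root_.BarNatan.Cobordism.snd_mem (S : Cobordism T T') : ∀ p ∈ S.carrier,
    p.2 ∈ Icc (0 : ℝ) 1 := fun _ hp => (S.subset_cyl hp).2

/-- The cobordism obtained from a cobordism by moving the slice at height `s` by `F_{a(s)}`. -/
def twist (S : Cobordism T T') (a : C(ℝ, unitInterval)) (h0 : ∀ s, s ≤ 1 / 3 → a s = a 0)
    (h1 : ∀ s, 2 / 3 ≤ s → a s = a 1) (hP : P.carrier = F.homeo (a 0) '' T.carrier)
    (hP' : P'.carrier = F.homeo (a 1) '' T'.carrier) : Cobordism P P' where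
  carrier := F.track a '' S.carrier
  subset_cyl := by
    rintro ⟨z, s⟩ h
    obtain ⟨h1, h2⟩ := S.mem_bounds ((F.mem_track a).1 h)
    exact ⟨by simpa using F.norm_symm_le h1, h2⟩
  isClosed := (F.track a).isClosed_image.2 S.isClosed
  bottom := by
    filter_upwards [S.bottom, nhdsWithin_le_nhds (Iic_mem_nhds (show (0 : ℝ) < 1 / 3 by norm_num))]
      with s hs hs' z
    rw [mem_track, hs, h0 s hs', hP, Homeomorph.image_eq_preimage_symm, mem_preimage]
  top := by
    filter_upwards [S.top, nhdsWithin_le_nhds (Ici_mem_nhds (show (2 / 3 : ℝ) < 1 by norm_num))]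
      with s hs hs' z
    rw [mem_track, hs, h1 s hs', hP', Homeomorph.image_eq_preimage_symm, mem_preimage]
  side := by
    obtain ⟨ρ, hρ, hF⟩ := F.supp
    filter_upwards [S.side, nhdsWithin_le_nhds (Ici_mem_nhds hρ)] with r hr hr' z hz s hs
    rw [mem_track, F.symm_fix hF _ (by rw [hz]; exact hr'), hr z hz s hs]
  flat := by
    rintro p ⟨q, hq, rfl⟩ hp
    rw [track_mem_openCyl] at hp
    rw [Homeomorph.image_eq_preimage_symm]
    refine LocFlatAt.preimage _ ?_
    rw [Homeomorph.symm_apply_apply]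
    exact S.flat q hq hp

/-- A path from `0` to `1` that is constant outside `[1/3, 2/3]`. -/
def profile : C(ℝ, unitInterval) where
  toFun s := projIcc 0 1 zero_le_one (3 * s - 1)
  continuous_toFun := continuous_projIcc.comp (by fun_prop)

theorem profile_low {s : ℝ} (hs : s ≤ 1 / 3) : profile s = 0 :=
  projIcc_of_le_left zero_le_one (by linarith)

theorem profile_high {s : ℝ} (hs : 2 / 3 ≤ s) : profile s = 1 :=
  projIcc_of_right_le zero_le_one (by linarith)

/-- The reverse of `profile`. -/
def revProfile : C(ℝ, unitInterval) where
  toFun s := unitInterval.symm (profile s)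
  continuous_toFun := unitInterval.continuous_symm.comp profile.continuous

theorem revProfile_low {s : ℝ} (hs : s ≤ 1 / 3) : revProfile s = 1 := by
  simp [revProfile, profile_low hs]

theorem revProfile_high {s : ℝ} (hs : 2 / 3 ≤ s) : revProfile s = 0 := by
  simp [revProfile, profile_high hs]

theorem homeo_zero_image (X : Set ℂ) : F.homeo 0 '' X = X := by
  have : (F.homeo 0 : ℂ → ℂ) = id := funext F.zero
  rw [this, image_id]

/-- The trace of an isotopy, a cobordism from a smoothing to its image under the isotopy. -/
def trace (hP : P.carrier = F.homeo 1 '' T.carrier) : Cobordism T P :=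
  F.twist (Cobordism.id T) profile
    (fun s hs => by rw [profile_low hs, profile_low (by norm_num)])
    (fun s hs => by rw [profile_high hs, profile_high (by norm_num)])
    (by rw [profile_low (by norm_num), homeo_zero_image])
    (by rw [profile_high (by norm_num), hP])

/-- The reverse of the trace of an isotopy. -/
def revTrace (hP : P.carrier = F.homeo 1 '' T.carrier) : Cobordism P T :=
  F.twist (Cobordism.id T) revProfile
    (fun s hs => by rw [revProfile_low hs, revProfile_low (by norm_num)])
    (fun s hs => by rw [revProfile_high hs, revProfile_high (by norm_num)])
    (by rw [revProfile_low (by norm_num), hP])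
    (by rw [revProfile_high (by norm_num), homeo_zero_image])

theorem trace_carrier (hP : P.carrier = F.homeo 1 '' T.carrier) :
    (F.trace hP).carrier = F.track profile '' (T.carrier ×ˢ Icc 0 1) := rfl

theorem comp_revTrace (hP : P.carrier = F.homeo 1 '' T.carrier) :
    AmbientIsotopic ((F.trace hP).comp (F.revTrace hP)).carrier (Cobordism.id T).carrier := by
  have h : profile 1 = revProfile 0 := by
    rw [profile_high (by norm_num), revProfile_low (by norm_num)]
  have h1 : ((F.trace hP).comp (F.revTrace hP)).carrier =
      F.track (join profile revProfile h) '' ((Cobordism.id T).comp (Cobordism.id T)).carrier :=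
    F.stack_track (Cobordism.id T).snd_mem (Cobordism.id T).snd_mem h
  rw [h1]
  refine (F.track_isotopic (b := ContinuousMap.const ℝ 0) (fun s hs => ?_) _).trans ?_
  · rw [ContinuousMap.const_apply]
    by_cases hs0 : s ≤ 0
    · rw [join_left (by linarith), profile_low (by linarith)]
    · have hs1 : 1 ≤ s := by
        by_contra hh
        exact hs ⟨not_le.1 hs0, not_le.1 hh⟩
      rw [join_right (by linarith), revProfile_high (by linarith)]
  · rw [track_zero]
    exact Cobordism.id_comp_isotopic _

theorem revTrace_comp (hP : P.carrier = F.homeo 1 '' T.carrier) :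
    AmbientIsotopic ((F.revTrace hP).comp (F.trace hP)).carrier (Cobordism.id P).carrier := by
  have h : revProfile 1 = profile 0 := by
    rw [revProfile_high (by norm_num), profile_low (by norm_num)]
  have h1 : ((F.revTrace hP).comp (F.trace hP)).carrier =
      F.track (join revProfile profile h) '' ((Cobordism.id T).comp (Cobordism.id T)).carrier :=
    F.stack_track (Cobordism.id T).snd_mem (Cobordism.id T).snd_mem h
  have h2 : F.track (ContinuousMap.const ℝ 1) '' (Cobordism.id T).carrier =
      (Cobordism.id P).carrier := by
    ext ⟨z, s⟩
    rw [mem_track, ContinuousMap.const_apply]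
    simp only [Cobordism.id, mem_prod, hP, Homeomorph.image_eq_preimage_symm, mem_preimage]
  rw [h1]
  refine (F.track_isotopic (b := ContinuousMap.const ℝ 1) (fun s hs => ?_) _).trans ?_
  · rw [ContinuousMap.const_apply]
    by_cases hs0 : s ≤ 0
    · rw [join_left (by linarith), revProfile_low (by linarith)]
    · have hs1 : 1 ≤ s := by
        by_contra hh
        exact hs ⟨not_le.1 hs0, not_le.1 hh⟩
      rw [join_right (by linarith), profile_high (by linarith)]
  · rw [← h2]
    exact (Cobordism.id_comp_isotopic (Cobordism.id T)).image _ (F.track_mem_openCyl _)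

/-- Traces are natural: first applying a cobordism and then moving its end is isotopic to first
moving its start and then applying the moved cobordism. -/
theorem trace_natural (S : Cobordism T T') {R : Cobordism P P'} {tr : Cobordism T P}
    {tr' : Cobordism T' P'} (htr : tr.carrier = F.track profile '' (T.carrier ×ˢ Icc 0 1))
    (htr' : tr'.carrier = F.track profile '' (T'.carrier ×ˢ Icc 0 1))
    (hR : ∀ z s, (z, s) ∈ S.carrier ↔ (F.homeo 1 z, s) ∈ R.carrier) :
    AmbientIsotopic (S.comp tr').carrier (tr.comp R).carrier := by
  let o : C(ℝ, unitInterval) := ContinuousMap.const ℝ 0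
  let e : C(ℝ, unitInterval) := ContinuousMap.const ℝ 1
  have hR' : R.carrier = F.track e '' S.carrier := by
    ext ⟨z, s⟩
    rw [mem_track, hR]
    simp [e]
  have h1 : o 1 = profile 0 := (profile_low (by norm_num)).symm
  have h2 : profile 1 = e 0 := profile_high (by norm_num)
  have e1 : (S.comp tr').carrier = F.track (join o profile h1) ''
      (S.comp (Cobordism.id T')).carrier := by
    have := F.stack_track S.snd_mem (Cobordism.id T').snd_mem h1
    rw [track_zero] at this
    refine Eq.trans ?_ this
    change _ ∪ _ '' tr'.carrier = _
    rw [htr']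
    rfl
  have e2 : (tr.comp R).carrier = F.track (join profile e h2) ''
      ((Cobordism.id T).comp S).carrier := by
    refine Eq.trans ?_ (F.stack_track (Cobordism.id T).snd_mem S.snd_mem h2)
    change _ '' tr.carrier ∪ _ '' R.carrier = _
    rw [htr, hR']
    rfl
  rw [e1, e2]
  refine (S.comp_id_isotopic.image _ (F.track_mem_openCyl _)).trans
    ((F.track_isotopic (fun s hs => ?_) _).trans
      (S.id_comp_isotopic.symm.image _ (F.track_mem_openCyl _)))
  by_cases hs0 : s ≤ 0
  · rw [join_left (by linarith), join_left (by linarith), profile_low (by linarith)]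
    rfl
  · have hs1 : 1 ≤ s := by
      by_contra hh
      exact hs ⟨not_le.1 hs0, not_le.1 hh⟩
    rw [join_right (by linarith), join_right (by linarith), profile_high (by linarith)]
    rfl

/-- A smoothing is isomorphic to its image under an isotopy, by the trace of the isotopy. -/
def traceIso (hP : P.carrier = F.homeo 1 '' T.carrier) : (T : Cobl k) ≅ P where
  hom := (F.trace hP).cls
  inv := (F.revTrace hP).cls
  hom_inv_id := (CobHom.comp_cls _ _).trans (Cobordism.cls_eq (F.comp_revTrace hP))
  inv_hom_id := (CobHom.comp_cls _ _).trans (Cobordism.cls_eq (F.revTrace_comp hP))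

end DiskIsotopy

/-! ### Isotopic planar arc diagrams -/

namespace PlanarArcDiagram

open Kob

variable {d : ℕ} {κ : Fin d → ℕ} {k : ℕ} {D D' : PlanarArcDiagram κ k}

/-- Diagrams acting by naturally isomorphic multifunctors on smoothings and cobordisms act in the
same way on complexes. -/
theorem tensor_iso_of_natural (η : ∀ T : ∀ i, Cobl (κ i), D.obj T ≅ D'.obj T)
    (hη : ∀ (T T' : ∀ i, Cobl (κ i)) (f : ∀ i, T i ⟶ T' i),
      D.map f ≫ (η T').hom = (η T).hom ≫ D'.map f) (Ω : ∀ i, Kob (κ i)) :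
    Nonempty (D.tensor Ω ≅ D'.tensor Ω) := by
  refine nonempty_iso_of_summands ((D.tensorEquiv Ω).trans (D'.tensorEquiv Ω).symm)
    (fun x => x.2.2) (fun x => η fun i => (D.tensorEquiv Ω x i).sm) fun x y => ?_
  change D.tensorEntry (D.tensorEquiv Ω x) (D.tensorEquiv Ω y) ≫ _ =
    _ ≫ D'.tensorEntry (D.tensorEquiv Ω x) (D.tensorEquiv Ω y)
  unfold tensorEntry
  rw [Preadditive.sum_comp, Preadditive.comp_sum]
  refine Finset.sum_congr rfl fun i _ => ?_
  rw [Preadditive.zsmul_comp, Preadditive.comp_zsmul]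
  exact congrArg _ (hη _ _ _)

theorem map_natural {T T' : ∀ i, Cobl (κ i)} (η : CobHom (D.obj T) (D'.obj T))
    (η' : CobHom (D.obj T') (D'.obj T'))
    (h : ∀ S : ∀ i, Cobordism (T i) (T' i),
      CobHom.comp (D.cob S).cls η' = CobHom.comp η (D'.cob S).cls) (f : ∀ i, T i ⟶ T' i) :
    (D.map f ≫ η' : D.obj T ⟶ D'.obj T') = η ≫ D'.map f := by
  have : (CobHom.comp.flip η').compMultilinearMap (D.multi T T') =
      (CobHom.comp η).compMultilinearMap (D'.multi T T') := by
    refine CobHom.multi_ext fun S => ?_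
    simp only [LinearMap.compMultilinearMap_apply, multi_cls, LinearMap.flip_apply, h]
  exact congrArg (fun F => F f) this

theorem mem_fill_isotopic {f : ℂ ≃ₜ ℂ} (ha : f '' D.arcs = D'.arcs)
    (hf : ∀ i z, ‖z‖ ≤ 1 → f (D.c i + D.w i * z) = D'.c i + D'.w i * z) {U : Fin d → Set ℂ}
    (hU : ∀ i, ∀ z ∈ U i, ‖z‖ ≤ 1) (z : ℂ) : z ∈ D.fill U ↔ f z ∈ D'.fill U := by
  simp only [fill, mem_union, mem_iUnion]
  refine or_congr ?_ (exists_congr fun i => ⟨?_, ?_⟩)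
  · rw [← ha, f.injective.mem_set_image]
  · rintro ⟨u, hu, rfl⟩
    exact ⟨u, hu, (hf i u (hU i u hu)).symm⟩
  · rintro ⟨u, hu, h⟩
    refine ⟨u, hu, f.injective ?_⟩
    exact (hf i u (hU i u hu)).trans h

/-- Isotopic diagrams give isomorphic complexes: the traces of the isotopy of the output disk are
natural isomorphisms between the results of filling the two diagrams. -/
theorem tensor_iso_of_isotopic (h : D.Isotopic D') (Ω : ∀ i, Kob (κ i)) :
    Nonempty (D.tensor Ω ≅ D'.tensor Ω) := by
  obtain ⟨F₀, hF, h0, hs, ha, hf⟩ := h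
  let F : DiskIsotopy := ⟨F₀, hF, h0, hs⟩
  have hobj : ∀ T : ∀ i, Cobl (κ i), (D'.obj T).carrier = F.homeo 1 '' (D.obj T).carrier := by
    intro T
    ext z
    rw [Homeomorph.image_eq_preimage_symm, mem_preimage]
    change z ∈ D'.fill _ ↔ (F.homeo 1).symm z ∈ D.fill _
    rw [mem_fill_isotopic ha hf (fun i => (T i).norm_le)]
    change _ ↔ F.homeo 1 ((F.homeo 1).symm z) ∈ D'.fill _
    rw [Homeomorph.apply_symm_apply]
  refine tensor_iso_of_natural (fun T => F.traceIso (hobj T)) (fun T T' f => ?_) Ω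
  refine map_natural _ _ (fun S => ?_) f
  refine (CobHom.comp_cls _ _).trans (Eq.trans ?_ (CobHom.comp_cls _ _).symm)
  refine Cobordism.cls_eq (F.trace_natural (D.cob S) (F.trace_carrier (hobj T))
    (F.trace_carrier (hobj T')) fun z s => ?_)
  change (z, s) ∈ D.fillCyl _ ↔ (F.homeo 1 z, s) ∈ D'.fillCyl _
  rw [mem_fillCyl_cob, mem_fillCyl_cob]
  exact and_congr_right fun _ =>
    mem_fill_isotopic ha hf (fun i x hx => ((S i).mem_bounds hx).1) z

end PlanarArcDiagram

/-! ### Radial diagrams -/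

/-- The factor by which the radial isotopy at time `t` multiplies the points of norm `x`: it is
`1 - t (1 - ρ)` for `x ≤ σ` and `1` for `x ≥ (1 + σ) / 2`. -/
def radialFactor (ρ σ t x : ℝ) : ℝ :=
  1 - t * (1 - ρ) * max 0 (min 1 (((1 + σ) / 2 - x) / ((1 - σ) / 2)))

section Radial

variable {ρ σ t : ℝ}

theorem radialFactor_eq (hσ : σ < 1) {x : ℝ} (hx : x ≤ σ) :
    radialFactor ρ σ t x = 1 - t * (1 - ρ) := by
  have : 1 ≤ ((1 + σ) / 2 - x) / ((1 - σ) / 2) := by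
    rw [le_div_iff₀ (by linarith)]
    linarith
  rw [radialFactor, min_eq_left this, max_eq_right zero_le_one, mul_one]

theorem radialFactor_eq_one (hσ : σ < 1) {x : ℝ} (hx : (1 + σ) / 2 ≤ x) :
    radialFactor ρ σ t x = 1 := by
  have : ((1 + σ) / 2 - x) / ((1 - σ) / 2) ≤ 0 :=
    div_nonpos_of_nonpos_of_nonneg (by linarith) (by linarith)
  rw [radialFactor, max_eq_left ((min_le_right _ _).trans this), mul_zero, sub_zero]

theorem radialFactor_mono (hρ : ρ < 1) (hσ : σ < 1) (ht : 0 ≤ t) {x y : ℝ} (h : x ≤ y) :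
    radialFactor ρ σ t x ≤ radialFactor ρ σ t y := by
  unfold radialFactor
  have h1 : 0 ≤ t * (1 - ρ) := mul_nonneg ht (by linarith)
  have h2 : 0 ≤ (1 - σ) / 2 := by linarith
  gcongr

theorem radialFactor_le_one (hρ : ρ < 1) (ht : 0 ≤ t) (x : ℝ) : radialFactor ρ σ t x ≤ 1 := by
  unfold radialFactor
  have h1 : 0 ≤ t * (1 - ρ) := mul_nonneg ht (by linarith)
  linarith [mul_nonneg h1 (le_max_left 0 (min 1 (((1 + σ) / 2 - x) / ((1 - σ) / 2))))]

theorem le_radialFactor (hρ : ρ < 1) (ht : 0 ≤ t) (x : ℝ) :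
    1 - t * (1 - ρ) ≤ radialFactor ρ σ t x := by
  unfold radialFactor
  have h1 : 0 ≤ t * (1 - ρ) := mul_nonneg ht (by linarith)
  have h2 : max 0 (min 1 (((1 + σ) / 2 - x) / ((1 - σ) / 2))) ≤ 1 :=
    max_le zero_le_one (min_le_left _ _)
  linarith [mul_le_of_le_one_right h1 h2]

theorem scale_pos (h0 : 0 < ρ) (h1 : ρ < 1) (ht : t ∈ Icc (0 : ℝ) 1) : 0 < 1 - t * (1 - ρ) := by
  nlinarith [ht.1, ht.2]

/-- Radial contraction of the plane, multiplying by `1 - t (1 - ρ)` on the disk of radius `σ`. -/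
def radialMap (ρ σ t : ℝ) (z : ℂ) : ℂ := (radialFactor ρ σ t ‖z‖ : ℂ) * z

theorem continuous_radialMap (ρ σ : ℝ) : Continuous fun q : ℝ × ℂ => radialMap ρ σ q.1 q.2 := by
  unfold radialMap radialFactor
  fun_prop

theorem norm_radialMap (h0 : 0 < ρ) (h1 : ρ < 1) (ht : t ∈ Icc (0 : ℝ) 1) (z : ℂ) :
    ‖radialMap ρ σ t z‖ = radialFactor ρ σ t ‖z‖ * ‖z‖ := by
  rw [radialMap, norm_mul, Complex.norm_real, Real.norm_of_nonneg]
  exact (scale_pos h0 h1 ht).le.trans (le_radialFactor h1 ht.1 _)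

theorem radialMap_eq_self (hσ : σ < 1) {z : ℂ} (hz : (1 + σ) / 2 ≤ ‖z‖) :
    radialMap ρ σ t z = z := by
  rw [radialMap, radialFactor_eq_one hσ hz, Complex.ofReal_one, one_mul]

theorem isHomeomorph_radialMap (h0 : 0 < ρ) (h1 : ρ < 1) (hσ : σ < 1) (ht : t ∈ Icc (0 : ℝ) 1) :
    IsHomeomorph (radialMap ρ σ t) := by
  have hpos : ∀ x, 0 < radialFactor ρ σ t x := fun x =>
    (scale_pos h0 h1 ht).trans_le (le_radialFactor h1 ht.1 x)
  have hmono : ∀ x y, 0 ≤ x → x < y → radialFactor ρ σ t x * x < radialFactor ρ σ t y * y := by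
    intro x y hx hxy
    calc radialFactor ρ σ t x * x ≤ radialFactor ρ σ t y * x :=
          mul_le_mul_of_nonneg_right (radialFactor_mono h1 hσ ht.1 hxy.le) hx
      _ < radialFactor ρ σ t y * y := mul_lt_mul_of_pos_left hxy (hpos y)
  have hcont : Continuous (radialMap ρ σ t) :=
    (continuous_radialMap ρ σ).comp (Continuous.prodMk_right t)
  have hfix : ∀ z : ℂ, 1 ≤ ‖z‖ → radialMap ρ σ t z = z := fun z hz =>
    radialMap_eq_self hσ (by linarith)
  refine isHomeomorph_of_eqOn_compl (U := Metric.ball 0 1) (K := Metric.closedBall 0 1) hcont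
    ⟨fun z z' h => ?_, fun z => ?_⟩ Metric.isOpen_ball Metric.ball_subset_closedBall
    (isCompact_closedBall 0 1) fun z hz => hfix z (by simpa using hz)
  · have hn : ‖z‖ = ‖z'‖ := by
      have hn := congrArg norm h
      rw [norm_radialMap h0 h1 ht, norm_radialMap h0 h1 ht] at hn
      rcases lt_trichotomy ‖z‖ ‖z'‖ with hh | hh | hh
      · exact absurd hn (hmono _ _ (norm_nonneg _) hh).ne
      · exact hh
      · exact absurd hn (hmono _ _ (norm_nonneg _) hh).ne'
    rw [radialMap, radialMap, hn] at h
    exact mul_left_cancel₀ (by exact_mod_cast (hpos _).ne') h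
  · by_cases hz : 1 ≤ ‖z‖
    · exact ⟨z, hfix z hz⟩
    by_cases hz0 : z = 0
    · exact ⟨0, by simp [radialMap, hz0]⟩
    have hg : Continuous fun x : ℝ => radialFactor ρ σ t x * x := by
      unfold radialFactor
      fun_prop
    obtain ⟨x, hx, hxz⟩ : ‖z‖ ∈ (fun x : ℝ => radialFactor ρ σ t x * x) '' Icc 0 1 := by
      refine intermediate_value_Icc zero_le_one hg.continuousOn ⟨by simp, ?_⟩
      rw [radialFactor_eq_one hσ (by linarith), one_mul]
      exact (not_le.1 hz).le
    have hzn : (‖z‖ : ℂ) ≠ 0 := by exact_mod_cast norm_ne_zero_iff.2 hz0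
    have hw : ‖(x : ℂ) * (z / ‖z‖)‖ = x := by
      rw [norm_mul, norm_div, Complex.norm_real, Complex.norm_real, norm_norm,
        div_self (norm_ne_zero_iff.2 hz0), mul_one, Real.norm_of_nonneg hx.1]
    refine ⟨(x : ℂ) * (z / ‖z‖), ?_⟩
    rw [radialMap, hw, ← mul_assoc, ← Complex.ofReal_mul]
    simp only at hxz
    rw [hxz, mul_div_cancel₀ _ hzn]

/-- The radial contraction as an isotopy of the disk. -/
def radialIsotopy (h0 : 0 < ρ) (h1 : ρ < 1) (hσ : σ < 1) : DiskIsotopy where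
  homeo t := (isHomeomorph_radialMap h0 h1 hσ t.2).homeomorph
  continuous_homeo := (continuous_radialMap ρ σ).comp
    ((continuous_subtype_val.comp continuous_fst).prodMk continuous_snd)
  zero z := by
    change radialMap ρ σ 0 z = z
    simp [radialMap, radialFactor]
  supp := ⟨(1 + σ) / 2, by linarith, fun _ _ hz => radialMap_eq_self hσ hz⟩

theorem radialIsotopy_apply (h0 : 0 < ρ) (h1 : ρ < 1) (hσ : σ < 1) (t : unitInterval) (z : ℂ) :
    (radialIsotopy h0 h1 hσ).homeo t z = radialMap ρ σ t z := rfl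

/-- The subset `U` of the unit disk, shrunk by the factor `l` and extended radially to the unit
circle. -/
def shrink (k : ℕ) (l : ℝ) (U : Set ℂ) : Set ℂ :=
  {z | (‖z‖ ≤ l ∧ (l⁻¹ : ℝ) * z ∈ U) ∨ (l ≤ ‖z‖ ∧ ‖z‖ ≤ 1 ∧ z ∈ rays k)}

/-- Radial contraction shrinks a set that is radial outside the disk of radius `σ`; the result does
not depend on `σ`. -/
theorem radialMap_mem_shrink {k : ℕ} (h0 : 0 < ρ) (h1 : ρ < 1) (hσ : σ < 1)
    (ht : t ∈ Icc (0 : ℝ) 1) {U : Set ℂ} (hU : ∀ z ∈ U, ‖z‖ ≤ 1)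
    (hc : ∀ z : ℂ, σ ≤ ‖z‖ → ‖z‖ ≤ 1 → (z ∈ U ↔ z ∈ rays k)) (z : ℂ) :
    z ∈ U ↔ radialMap ρ σ t z ∈ shrink k (1 - t * (1 - ρ)) U := by
  have hl := scale_pos h0 h1 ht
  have hl1 : 1 - t * (1 - ρ) ≤ 1 := by nlinarith [ht.1]
  have hn := norm_radialMap (σ := σ) h0 h1 ht z
  have hlow := le_radialFactor (σ := σ) h1 ht.1 ‖z‖
  have hhigh := radialFactor_le_one (σ := σ) h1 ht.1 ‖z‖
  have heq : ‖z‖ ≤ σ → radialFactor ρ σ t ‖z‖ = 1 - t * (1 - ρ) := radialFactor_eq hσ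
  have hself : (1 + σ) / 2 ≤ ‖z‖ → radialMap ρ σ t z = z := radialMap_eq_self hσ
  have hray : radialMap ρ σ t z ∈ rays k ↔ z ∈ rays k := rays_smul (hl.trans_le hlow)
  have hdef : radialMap ρ σ t z = (radialFactor ρ σ t ‖z‖ : ℂ) * z := rfl
  have hz0 := norm_nonneg z
  generalize radialFactor ρ σ t ‖z‖ = m at *
  generalize 1 - t * (1 - ρ) = l at *
  simp only [shrink, mem_ofPred_eq]
  have hlc : (l : ℂ) ≠ 0 := by exact_mod_cast hl.ne'
  rcases lt_or_ge 1 ‖z‖ with hz1 | hz1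
  · rw [hself (by linarith)]
    refine iff_of_false (fun h => absurd (hU z h) hz1.not_ge) ?_
    rintro (⟨h, _⟩ | ⟨_, h, _⟩) <;> linarith
  rcases lt_or_ge ‖z‖ σ with hzσ | hzσ
  · obtain rfl := heq hzσ.le
    have e1 : ((m⁻¹ : ℝ) : ℂ) * radialMap ρ σ t z = z := by
      rw [hdef, Complex.ofReal_inv, inv_mul_cancel_left₀ hlc]
    rw [e1]
    constructor
    · intro h
      refine Or.inl ⟨?_, h⟩
      rw [hn]
      exact mul_le_of_le_one_right hl.le hz1
    · rintro (⟨_, h⟩ | ⟨h, _⟩)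
      · exact h
      · rw [hn] at h
        nlinarith
  · have hle : ‖radialMap ρ σ t z‖ ≤ 1 := by
      rw [hn]
      nlinarith
    rw [hc z hzσ hz1, ← hray]
    have key : ‖radialMap ρ σ t z‖ ≤ l →
        (((l⁻¹ : ℝ) : ℂ) * radialMap ρ σ t z ∈ U ↔ radialMap ρ σ t z ∈ rays k) := by
      intro h
      have e2 : ‖((l⁻¹ : ℝ) : ℂ) * radialMap ρ σ t z‖ = l⁻¹ * ‖radialMap ρ σ t z‖ := by
        rw [norm_mul, Complex.norm_real, Real.norm_of_nonneg (inv_nonneg.2 hl.le)]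
      rw [hc, rays_smul (inv_pos.2 hl)]
      · rw [e2, hn, inv_mul_eq_div, le_div_iff₀ hl]
        nlinarith
      · rw [e2, inv_mul_eq_div, div_le_one hl]
        exact h
    constructor
    · intro h
      rcases le_total ‖radialMap ρ σ t z‖ l with h2 | h2
      · exact Or.inl ⟨h2, (key h2).2 h⟩
      · exact Or.inr ⟨h2, hle, h⟩
    · rintro (⟨h2, h⟩ | ⟨_, _, h⟩)
      · exact (key h2).1 h
      · exact h

theorem track_radialIsotopy {k : ℕ} (h0 : 0 < ρ) (h1 : ρ < 1) (hσ : σ < 1) {T : Smoothing k}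
    (hc : ∀ z : ℂ, σ ≤ ‖z‖ → ‖z‖ ≤ 1 → (z ∈ T.carrier ↔ z ∈ rays k)) :
    (radialIsotopy h0 h1 hσ).track DiskIsotopy.profile '' (T.carrier ×ˢ Icc 0 1) =
      {p | p.1 ∈ shrink k (1 - DiskIsotopy.profile p.2 * (1 - ρ)) T.carrier ∧
        p.2 ∈ Icc (0 : ℝ) 1} := by
  ext ⟨z, s⟩
  rw [DiskIsotopy.mem_track, mem_prod]
  refine and_congr_left fun _ => ?_
  simp only
  rw [radialMap_mem_shrink h0 h1 hσ (DiskIsotopy.profile s).2 T.norm_le hc,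
    ← radialIsotopy_apply h0 h1 hσ, Homeomorph.apply_symm_apply]

end Radial

namespace PlanarArcDiagram

open Kob

variable {k : ℕ} {D : PlanarArcDiagram (fun _ : Fin 1 => k) k}

theorem fill_radial {ρ : ℝ} (h0 : 0 < ρ) (hc : D.c 0 = 0) (hw : D.w 0 = ρ)
    (ha : D.arcs = {z ∈ rays k | ρ ≤ ‖z‖ ∧ ‖z‖ ≤ 1}) {U : Fin 1 → Set ℂ}
    (hU : ∀ z ∈ U 0, ‖z‖ ≤ 1) : D.fill U = shrink k ρ (U 0) := by
  ext z
  rw [mem_fill, ha, or_comm]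
  simp only [shrink, mem_ofPred_eq]
  refine or_congr ?_ ?_
  · rw [Fin.exists_fin_one, hc, hw, sub_zero, div_eq_inv_mul, ← Complex.ofReal_inv]
    refine (and_iff_right_of_imp fun h => ?_).symm
    have := hU _ h
    rwa [norm_mul, Complex.norm_real, Real.norm_of_nonneg (inv_nonneg.2 h0.le), inv_mul_eq_div,
      div_le_one h0] at this
  · rw [and_comm, and_assoc]

/-- Radial diagrams act as identities: the traces of radial contractions are natural isomorphisms
from a smoothing to the result of placing it in the hole. -/
theorem exists_radial_natural (h : D.IsRadial) :
    ∃ η : ∀ T : Fin 1 → Cobl k, T 0 ≅ D.obj T, ∀ (T T' : Fin 1 → Cobl k) (f : ∀ i, T i ⟶ T' i),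
      f 0 ≫ (η T').hom = (η T).hom ≫ D.map f := by
  obtain ⟨ρ, h0, hc, hw, ha⟩ := h
  have h1 : ρ < 1 := by
    have := D.inside 0
    rw [hw, Complex.norm_real, Real.norm_of_nonneg h0.le] at this
    linarith [norm_nonneg (D.c 0)]
  have h11 : (1 : ℝ) - ((1 : unitInterval) : ℝ) * (1 - ρ) = ρ := by
    rw [Set.Icc.coe_one]
    ring
  choose σ _ hσ hcol using fun T : Smoothing k => T.collar_eps
  have hobj : ∀ T : Fin 1 → Cobl k, (D.obj T).carrier =
      (radialIsotopy h0 h1 (hσ (T 0))).homeo 1 '' (T 0).carrier := by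
    intro T
    ext z
    rw [Homeomorph.image_eq_preimage_symm, mem_preimage,
      radialMap_mem_shrink h0 h1 (hσ (T 0)) (1 : unitInterval).2 (T 0).norm_le (hcol (T 0)),
      ← radialIsotopy_apply h0 h1 (hσ (T 0)), Homeomorph.apply_symm_apply, h11]
    exact Set.ext_iff.1 (fill_radial h0 hc hw ha (T 0).norm_le) z
  let η : ∀ T : Fin 1 → Cobl k, T 0 ≅ D.obj T := fun T =>
    (radialIsotopy h0 h1 (hσ (T 0))).traceIso (hobj T)
  refine ⟨η, fun T T' f => ?_⟩
  let ev : MultilinearMap ℤ (fun i => CobHom (T i) (T' i)) (CobHom (T 0) (T' 0)) :=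
    { toFun := fun f => f 0
      map_update_add' := fun {_} x i a b => by
        obtain rfl : i = 0 := Subsingleton.elim _ _
        simp only [Function.update_self]
      map_update_smul' := fun {_} x i n a => by
        obtain rfl : i = 0 := Subsingleton.elim _ _
        simp only [Function.update_self] }
  have key : (CobHom.comp.flip (η T').hom).compMultilinearMap ev =
      (CobHom.comp (η T).hom).compMultilinearMap (D.multi T T') := by
    refine CobHom.multi_ext fun S => ?_
    simp only [LinearMap.compMultilinearMap_apply, multi_cls, LinearMap.flip_apply]
    refine (CobHom.comp_cls _ _).trans (Eq.trans ?_ (CobHom.comp_cls _ _).symm)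
    obtain ⟨u, hu, hS⟩ := mem_nhdsLE_iff_exists_Icc_subset.1 (S 0).side
    have hu1 : u < 1 := hu
    have hS' : ∀ z : ℂ, u ≤ ‖z‖ → ‖z‖ ≤ 1 → ∀ s ∈ Icc (0 : ℝ) 1,
        ((z, s) ∈ (S 0).carrier ↔ z ∈ rays k) := fun z hz hz1 s hs => hS ⟨hz, hz1⟩ z rfl s hs
    have hT : ∀ z : ℂ, u ≤ ‖z‖ → ‖z‖ ≤ 1 → (z ∈ (T 0).carrier ↔ z ∈ rays k) := by
      intro z hz hz1
      obtain ⟨ε, e0, _, he⟩ := (S 0).bottom_eps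
      rw [← he 0 le_rfl e0.le, hS' z hz hz1 0 ⟨le_rfl, zero_le_one⟩]
    have hT' : ∀ z : ℂ, u ≤ ‖z‖ → ‖z‖ ≤ 1 → (z ∈ (T' 0).carrier ↔ z ∈ rays k) := by
      intro z hz hz1
      obtain ⟨ε, e0, _, he⟩ := (S 0).top_eps
      rw [← he 1 (by linarith) le_rfl, hS' z hz hz1 1 ⟨zero_le_one, le_rfl⟩]
    -- The trace does not depend on the width of the collar, which is now taken to suit `S`.
    refine Cobordism.cls_eq ((radialIsotopy h0 h1 hu1).trace_natural (S 0) ?_ ?_ fun z s => ?_)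
    · exact (track_radialIsotopy h0 h1 _ (hcol (T 0))).trans
        (track_radialIsotopy h0 h1 hu1 hT).symm
    · exact (track_radialIsotopy h0 h1 _ (hcol (T' 0))).trans
        (track_radialIsotopy h0 h1 hu1 hT').symm
    · change _ ↔ (_, s) ∈ D.fillCyl _
      rw [mem_fillCyl_cob]
      by_cases hs : s ∈ Icc (0 : ℝ) 1
      · rw [and_iff_right hs, fill_radial h0 hc hw ha fun x hx => ((S 0).mem_bounds hx).1]
        have := radialMap_mem_shrink h0 h1 hu1 (1 : unitInterval).2
          (U := {x | (x, s) ∈ (S 0).carrier}) (fun x hx => ((S 0).mem_bounds hx).1)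
          (fun x hx hx1 => hS' x hx hx1 s hs) z
        rwa [h11] at this
      · exact iff_of_false (fun hh => hs ((S 0).mem_bounds hh).2) fun hh => hs hh.1
  exact congrArg (fun F => F f) key

theorem tensor_iso_of_radial (h : D.IsRadial) (Ω : Kob k) :
    Nonempty (D.tensor (fun _ => Ω) ≅ Ω) := by
  obtain ⟨η, hη⟩ := exists_radial_natural h
  refine ⟨(Nonempty.some (nonempty_iso_of_summands (Ω := Ω) (Ω' := D.tensor fun _ => Ω)
    ((Equiv.funUnique (Fin 1) Ω.Summand).symm.trans (D.tensorEquiv fun _ => Ω).symm) (fun x => ?_)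
    (fun x => η fun _ => x.sm) fun x y => ?_)).symm⟩
  · change ∑ _ : Fin 1, x.1 = x.1
    rw [Fin.sum_univ_one]
  · change _ = _ ≫ D.tensorEntry (fun _ => x) (fun _ => y)
    unfold tensorEntry
    rw [Fin.sum_univ_one]
    have hs : sign (Ω := fun _ : Fin 1 => Ω) (fun _ => x) 0 = 1 := by
      simp [sign]
    rw [hs, one_smul]
    refine Eq.trans ?_ (hη (fun _ => x.sm) (fun _ => y.sm)
      (slot (Ω := fun _ : Fin 1 => Ω) 0 (fun _ => x) (fun _ => y)))
    rfl

end PlanarArcDiagram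

/-! ### Transport of morphisms along equalities of smoothings -/

theorem Smoothing.ext_carrier {k : ℕ} {O P : Smoothing k} (h : O.carrier = P.carrier) : O = P := by
  cases O
  cases P
  simp only at h
  subst h
  rfl

/-- A cobordism between smoothings, regarded as a cobordism between equal smoothings. -/
def Cobordism.cast {k : ℕ} {O O' P P' : Smoothing k} (h : O = P) (h' : O' = P')
    (S : Cobordism O O') : Cobordism P P' := h ▸ h' ▸ S

theorem Cobordism.cast_carrier {k : ℕ} {O O' P P' : Smoothing k} (h : O = P) (h' : O' = P')
    (S : Cobordism O O') : (S.cast h h').carrier = S.carrier := by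
  subst h h'
  rfl

/-- A morphism between smoothings, regarded as a morphism between equal smoothings. -/
def CobHom.cast {k : ℕ} {O O' P P' : Smoothing k} (h : O = P) (h' : O' = P') :
    CobHom O O' →ₗ[ℤ] CobHom P P' := by
  subst h h'
  exact LinearMap.id

theorem CobHom.cast_cls {k : ℕ} {O O' P P' : Smoothing k} (h : O = P) (h' : O' = P')
    (S : Cobordism O O') : CobHom.cast h h' S.cls = (S.cast h h').cls := by
  subst h h'
  rfl

theorem CobHom.comp_eqToHom {k : ℕ} {O O' P P' : Cobl k} (h : O = P) (h' : O' = P')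
    (f : O ⟶ O') : f ≫ eqToHom h' = eqToHom h ≫ (CobHom.cast h h' f : P ⟶ P') := by
  subst h h'
  rw [eqToHom_refl, eqToHom_refl, Category.comp_id, Category.id_comp]
  rfl

/-- A property of tuples of morphisms holds if it holds for tuples of cobordisms and, in each slot,
passes from cobordisms to all morphisms. -/
theorem CobHom.multi_induction {ι : Type} [Fintype ι] [DecidableEq ι] {κ : ι → ℕ}
    {T T' : ∀ i, Smoothing (κ i)} {Q : (∀ i, CobHom (T i) (T' i)) → Prop}
    (h0 : ∀ S : ∀ i, Cobordism (T i) (T' i), Q fun i => (S i).cls)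
    (h1 : ∀ f s, (∀ S : Cobordism (T s) (T' s), Q (Function.update f s S.cls)) →
      ∀ v, Q (Function.update f s v)) (f : ∀ i, CobHom (T i) (T' i)) : Q f := by
  have key : ∀ A : Finset ι, ∀ f : ∀ i, CobHom (T i) (T' i),
      (∀ i, i ∉ A → ∃ S : Cobordism (T i) (T' i), f i = S.cls) → Q f := by
    intro A
    induction A using Finset.induction_on with
    | empty =>
      intro f hf
      choose S hS using fun i => hf i (Finset.notMem_empty i)
      rw [funext hS]
      exact h0 S
    | insert s A _ ih =>
      intro f hf
      rw [← Function.update_eq_self s f]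
      refine h1 f s (fun S => ih _ fun l hl => ?_) _
      by_cases hls : l = s
      · subst hls
        exact ⟨S, Function.update_self _ _ _⟩
      · rw [Function.update_of_ne hls]
        exact hf l (by simp [hl, hls])
  exact key Finset.univ f fun i hi => absurd (Finset.mem_univ i) hi

/-! ### Insertion of diagrams, for smoothings and cobordisms -/

namespace PlanarArcDiagram

variable {d : ℕ} {κ : Fin d → ℕ} {k : ℕ} (D : PlanarArcDiagram κ k) (i : Fin d) {d' : ℕ}
  {κ' : Fin d' → ℕ} (D' : PlanarArcDiagram κ' (κ i)) {n : ℕ} (e : Fin n ≃ {j // j ≠ i} ⊕ Fin d')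

theorem fill_insert {U : Fin d → Set ℂ} {V : {j // j ≠ i} ⊕ Fin d' → Set ℂ}
    (hV : ∀ j : {j // j ≠ i}, V (Sum.inl j) = U j)
    (hU : U i = D'.fill fun a => V (Sum.inr a)) :
    (D.insert i D' e).fill (fun m => V (e m)) = D.fill U := by
  ext y
  rw [mem_fill, mem_fill]
  have h1 : y ∈ (D.insert i D' e).arcs ↔ y ∈ D.arcs ∨ (y - D.c i) / D.w i ∈ D'.arcs := by
    change y ∈ D.arcs ∪ _ ↔ _
    refine or_congr_right ⟨?_, fun h => ⟨_, h, ?_⟩⟩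
    · rintro ⟨z, hz, rfl⟩
      simpa [D.w_ne i] using hz
    · simp [mul_div_cancel₀ _ (D.w_ne i)]
  have h2 : (∃ m, (y - (D.insert i D' e).c m) / (D.insert i D' e).w m ∈ V (e m)) ↔
      ∃ s, (y - D.insC i D' s) / D.insW i D' s ∈ V s :=
    (e.surjective.exists (p := fun s => (y - D.insC i D' s) / D.insW i D' s ∈ V s)).symm
  have h3 : (∃ j, (y - D.c j) / D.w j ∈ U j) ↔
      (∃ j : {j // j ≠ i}, (y - D.c j) / D.w j ∈ U j) ∨ (y - D.c i) / D.w i ∈ U i := by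
    constructor
    · rintro ⟨j, hj⟩
      by_cases hji : j = i
      · subst hji
        exact Or.inr hj
      · exact Or.inl ⟨⟨j, hji⟩, hj⟩
    · rintro (⟨j, hj⟩ | hj)
      · exact ⟨j, hj⟩
      · exact ⟨i, hj⟩
  have h4 : ∀ a, (y - (D.c i + D.w i * D'.c a)) / (D.w i * D'.w a) =
      ((y - D.c i) / D.w i - D'.c a) / D'.w a := fun a => by
    rw [ins_sub, mul_div_mul_left _ _ (D.w_ne i)]
  rw [h1, h2, h3, hU, mem_fill, Sum.exists]
  simp only [insC, insW, Sum.elim_inl, Sum.elim_inr, hV, h4]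
  tauto

variable {T T₂ : ∀ j, Cobl (κ j)}
  {V V₂ : ∀ s : {j // j ≠ i} ⊕ Fin d', Cobl (Sum.elim (fun j : {j // j ≠ i} => κ j) κ' s)}

/-- The smoothings `V` consist of the smoothings `T` outside the `i`-th hole of `D` and of
smoothings for the holes of `D'` that combine to the smoothing in the `i`-th hole of `D`. -/
structure Splits (T : ∀ j, Cobl (κ j))
    (V : ∀ s : {j // j ≠ i} ⊕ Fin d', Cobl (Sum.elim (fun j : {j // j ≠ i} => κ j) κ' s)) :
    Prop where
  left : ∀ j : {j // j ≠ i}, V (Sum.inl j) = T j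
  right : D'.obj (fun a => V (Sum.inr a)) = T i

variable {i D'}

theorem Splits.obj_eq (h : Splits i D' T V) :
    D.obj T = (D.insert i D' e).obj (fun m => V (e m)) := by
  refine Smoothing.ext_carrier ?_
  refine (D.fill_insert i D' e (U := fun j => (T j).carrier) (V := fun s => (V s).carrier)
    (fun j => ?_) ?_).symm
  · exact congrArg Smoothing.carrier (h.left j)
  · exact (congrArg Smoothing.carrier h.right).symm

/-- The morphisms `g` consist of the morphisms `f` outside the `i`-th hole of `D` and of morphisms
for the holes of `D'` that combine to the morphism in the `i`-th hole of `D`. -/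
structure SplitsHom (hT : Splits i D' T V) (hT₂ : Splits i D' T₂ V₂) (f : ∀ j, T j ⟶ T₂ j)
    (g : ∀ s, V s ⟶ V₂ s) : Prop where
  left : ∀ j : {j // j ≠ i}, f j = CobHom.cast (hT.left j) (hT₂.left j) (g (Sum.inl j))
  right : f i = CobHom.cast hT.right hT₂.right (D'.map fun a => g (Sum.inr a))

theorem SplitsHom.cob_eq {hT : Splits i D' T V} {hT₂ : Splits i D' T₂ V₂} {f : ∀ j, T j ⟶ T₂ j}
    {S : ∀ s, Cobordism (V s) (V₂ s)} (h : SplitsHom hT hT₂ f fun s => (S s).cls) :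
    CobHom.cast (hT.obj_eq D e) (hT₂.obj_eq D e) (D.map f) =
      (D.insert i D' e).map fun m => ((S (e m)).cls : V (e m) ⟶ V₂ (e m)) := by
  have h1 : ∀ j, ∃ R : Cobordism (T j) (T₂ j), f j = R.cls ∧
      (∀ hj : j ≠ i, R.carrier = (S (Sum.inl ⟨j, hj⟩)).carrier) ∧
      (j = i → R.carrier = (D'.cob fun a => S (Sum.inr a)).carrier) := by
    intro j
    by_cases hj : j = i
    · subst hj
      refine ⟨(D'.cob fun a => S (Sum.inr a)).cast hT.right hT₂.right, ?_,
        fun hh => absurd rfl hh, fun _ => Cobordism.cast_carrier _ _ _⟩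
      rw [h.right, ← CobHom.cast_cls]
      exact congrArg (CobHom.cast hT.right hT₂.right) (D'.multi_cls _)
    · refine ⟨(S (Sum.inl ⟨j, hj⟩)).cast (hT.left ⟨j, hj⟩) (hT₂.left ⟨j, hj⟩), ?_,
        fun _ => Cobordism.cast_carrier _ _ _, fun hh => absurd hh hj⟩
      exact (h.left ⟨j, hj⟩).trans (CobHom.cast_cls _ _ _)
  choose R hR hRl hRi using h1
  obtain rfl : f = fun j => (R j).cls := funext hR
  have e1 : D.map (fun j => ((R j).cls : T j ⟶ T₂ j)) = (D.cob R).cls := D.multi_cls R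
  have e2 : (D.insert i D' e).map (fun m => ((S (e m)).cls : V (e m) ⟶ V₂ (e m))) =
      ((D.insert i D' e).cob fun m => S (e m)).cls := multi_cls _ _
  rw [e1, e2, CobHom.cast_cls]
  congr 1
  refine Cobordism.ext ?_
  rw [Cobordism.cast_carrier]
  ext ⟨z, s⟩
  change (z, s) ∈ D.fillCyl _ ↔ (z, s) ∈ (D.insert i D' e).fillCyl _
  rw [mem_fillCyl_cob, mem_fillCyl_cob]
  refine and_congr_right fun hs => ?_
  rw [D.fill_insert i D' e (U := fun j => {x | (x, s) ∈ (R j).carrier})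
    (V := fun t => {x | (x, s) ∈ (S t).carrier})]
  · intro j
    ext x
    change _ ↔ (x, s) ∈ (R j).carrier
    rw [hRl j j.2]
    rfl
  · ext x
    change (x, s) ∈ (R i).carrier ↔ _
    rw [hRi i rfl]
    exact (D'.mem_fillCyl_cob (S := fun a => S (Sum.inr a))).trans (and_iff_right hs)

/-- The image under `D` depends linearly on each slot of the refined tuple of morphisms. -/
theorem SplitsHom.exists_linear {hT : Splits i D' T V} {hT₂ : Splits i D' T₂ V₂}
    {f : ∀ j, T j ⟶ T₂ j} {g : ∀ s, V s ⟶ V₂ s} (s : {j // j ≠ i} ⊕ Fin d') {v : V s ⟶ V₂ s}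
    (h : SplitsHom hT hT₂ f (Function.update g s v)) :
    ∃ L : CobHom (V s) (V₂ s) →ₗ[ℤ] CobHom (D.obj T) (D.obj T₂), L v = D.map f ∧
      ∀ u, ∃ f', SplitsHom hT hT₂ f' (Function.update g s u) ∧ L u = D.map f' := by
  rcases s with j | a
  · let L₁ : CobHom (V (Sum.inl j)) (V₂ (Sum.inl j)) →ₗ[ℤ] CobHom (T j) (T₂ j) :=
      CobHom.cast (hT.left j) (hT₂.left j)
    refine ⟨((D.multi T T₂).toLinearMap f j).comp L₁, ?_, fun u => ?_⟩
    · change D.map (Function.update f j (L₁ v)) = _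
      have := h.left j
      rw [Function.update_self] at this
      congr 1
      rw [Function.update_eq_iff]
      exact ⟨this.symm, fun _ _ => rfl⟩
    · refine ⟨Function.update f j (L₁ u), ⟨fun l => ?_, ?_⟩, rfl⟩
      · by_cases hl : l = j
        · subst hl
          rw [Function.update_self, Function.update_self]
          rfl
        · rw [Function.update_of_ne fun hh => hl (Subtype.ext hh), Function.update_of_ne (by simpa),
            h.left l, Function.update_of_ne (by simpa)]
      · rw [Function.update_of_ne j.2.symm, h.right]
        rfl
  · let L₂ : CobHom (D'.obj fun a => V (Sum.inr a)) (D'.obj fun a => V₂ (Sum.inr a)) →ₗ[ℤ]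
        CobHom (T i) (T₂ i) := CobHom.cast hT.right hT₂.right
    let L₁ : CobHom (V (Sum.inr a)) (V₂ (Sum.inr a)) →ₗ[ℤ]
        CobHom (D'.obj fun a => V (Sum.inr a)) (D'.obj fun a => V₂ (Sum.inr a)) :=
      (D'.multi (fun a => V (Sum.inr a)) fun a => V₂ (Sum.inr a)).toLinearMap
        (fun a => g (Sum.inr a)) a
    have hL₁ : ∀ u, L₁ u = D'.map fun b => Function.update g (Sum.inr a) u (Sum.inr b) := by
      intro u
      refine congrArg D'.map ?_
      exact (Function.update_comp_eq_of_injective' g Sum.inr_injective a u).symm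
    refine ⟨((D.multi T T₂).toLinearMap f i).comp (L₂.comp L₁), ?_, fun u => ?_⟩
    · change D.map (Function.update f i (L₂ (L₁ v))) = _
      congr 1
      rw [Function.update_eq_iff]
      refine ⟨?_, fun _ _ => rfl⟩
      rw [h.right, hL₁]
    · refine ⟨Function.update f i (L₂ (L₁ u)), ⟨fun l => ?_, ?_⟩, rfl⟩
      · rw [Function.update_of_ne l.2, h.left l]
        rfl
      · rw [Function.update_self, hL₁]

/-- Placing `D'` into the `i`-th hole of `D` composes the actions on morphisms. -/
theorem SplitsHom.map_eq {hT : Splits i D' T V} {hT₂ : Splits i D' T₂ V₂} {f : ∀ j, T j ⟶ T₂ j}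
    {g : ∀ s, V s ⟶ V₂ s} (h : SplitsHom hT hT₂ f g) :
    CobHom.cast (hT.obj_eq D e) (hT₂.obj_eq D e) (D.map f) =
      (D.insert i D' e).map fun m => g (e m) := by
  refine CobHom.multi_induction (T := V) (T' := V₂) (Q := fun g => ∀ f : ∀ j, T j ⟶ T₂ j,
    SplitsHom hT hT₂ f g → CobHom.cast (hT.obj_eq D e) (hT₂.obj_eq D e) (D.map f) =
      (D.insert i D' e).map fun m => g (e m)) (fun S f hf => hf.cob_eq D e) ?_ g f h
  clear h f g
  intro g s hS v f hf
  obtain ⟨m, rfl⟩ := e.surjective s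
  obtain ⟨L, hLv, hL⟩ := hf.exists_linear D (e m)
  let R : CobHom (V (e m)) (V₂ (e m)) →ₗ[ℤ] CobHom ((D.insert i D' e).obj fun m => V (e m))
      ((D.insert i D' e).obj fun m => V₂ (e m)) :=
    ((D.insert i D' e).multi (fun m => V (e m)) fun m => V₂ (e m)).toLinearMap (fun m => g (e m)) m
  have hR : ∀ u, R u = (D.insert i D' e).map fun l => Function.update g (e m) u (e l) := by
    intro u
    refine congrArg (D.insert i D' e).map ?_
    exact (Function.update_comp_eq_of_injective' g e.injective m u).symm
  have key : (CobHom.cast (hT.obj_eq D e) (hT₂.obj_eq D e)).comp L = R := by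
    refine CobHom.lin_ext fun S => ?_
    obtain ⟨f', hf', hLf⟩ := hL S.cls
    rw [LinearMap.comp_apply, hLf, hR]
    exact hS S f' hf'
  rw [← hLv, ← hR, ← key]
  rfl

end PlanarArcDiagram

/-! ### Koszul signs -/

section Koszul

variable {S : Type} [Fintype S] (lt₁ lt₂ : S → S → Prop)

open Classical in
/-- The sign `(-1) ^ ∑ r s` over all `s` preceding `u`. -/
def precSign (lt : S → S → Prop) (r : S → ℤ) (u : S) : ℤ :=
  ((∑ s, if lt s u then r s else 0).negOnePow : ℤˣ)

open Classical in
/-- The Koszul sign of rearranging factors of degrees `r s` from one order to another: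
`(-1) ^ ∑ r s * r t`, over all pairs that occur in opposite orders. -/
def koszul (r : S → ℤ) : ℤ :=
  ((∑ s, ∑ t, if lt₁ s t ∧ lt₂ t s then r s * r t else 0).negOnePow : ℤˣ)

theorem koszul_mul_self (r : S → ℤ) : koszul lt₁ lt₂ r * koszul lt₁ lt₂ r = 1 := by
  rw [koszul, ← Units.val_mul, ← Int.negOnePow_add, Int.negOnePow_even _ ⟨_, rfl⟩, Units.val_one]

variable {lt₁ lt₂}

/-- Raising the degree of one factor changes the Koszul sign by the ratio of the two signs of moving
an operator of degree one to this factor. -/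
theorem koszul_succ [DecidableEq S] (h₁ : ∀ s t, s ≠ t → (lt₁ s t ↔ ¬lt₁ t s))
    (h₂ : ∀ s t, s ≠ t → (lt₂ s t ↔ ¬lt₂ t s)) (i₁ : ∀ s, ¬lt₁ s s) (i₂ : ∀ s, ¬lt₂ s s)
    {r r' : S → ℤ} {u : S} (h : ∀ s, r' s = r s + if s = u then 1 else 0) :
    precSign lt₂ r u * koszul lt₁ lt₂ r' = precSign lt₁ r u * koszul lt₁ lt₂ r := by
  classical
  have h3 : (∑ s, ∑ t, if lt₁ s t ∧ lt₂ t s then r' s * r' t else 0) =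
      (∑ s, ∑ t, if lt₁ s t ∧ lt₂ t s then r s * r t else 0) +
        ((∑ s, if lt₁ s u ∧ lt₂ u s then r s else 0) +
          ∑ t, if lt₁ u t ∧ lt₂ t u then r t else 0) := by
    have : ∀ s t, (if lt₁ s t ∧ lt₂ t s then r' s * r' t else 0) =
        (if lt₁ s t ∧ lt₂ t s then r s * r t else 0) +
          ((if t = u then (if lt₁ s t ∧ lt₂ t s then r s else 0) else 0) +
            if s = u then (if lt₁ s t ∧ lt₂ t s then r t else 0) else 0) := by
      intro s t
      rw [h, h]
      by_cases hs : s = u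
      · by_cases ht : t = u
        · subst hs ht
          simp [i₁]
        · simp only [hs, ht, if_true, if_false]
          split_ifs <;> ring
      · by_cases ht : t = u
        · simp only [hs, ht, if_true, if_false]
          split_ifs <;> ring
        · simp only [hs, ht, if_false]
          split_ifs <;> ring
    simp only [this, Finset.sum_add_distrib]
    congr 2
    · simp
    · rw [Finset.sum_comm]
      simp
  unfold precSign koszul
  rw [h3, ← Units.val_mul, ← Units.val_mul, ← Int.negOnePow_add, ← Int.negOnePow_add]
  congr 1
  rw [Int.negOnePow_eq_iff]
  have h4 : ∀ a b c e x : ℤ, a + (x + (b + c)) - (e + x) = a + b + c - e := fun a b c e x => by ring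
  rw [h4, ← Finset.sum_add_distrib, ← Finset.sum_add_distrib, ← Finset.sum_sub_distrib]
  refine Finset.even_sum _ fun s _ => ?_
  by_cases hs : s = u
  · subst hs
    simp [i₁, i₂]
  · have a1 := h₁ s u hs
    have a2 := h₂ s u hs
    by_cases b1 : lt₁ s u <;> by_cases b2 : lt₂ s u
    · have c1 := a1.1 b1
      have c2 := a2.1 b2
      simp [b1, b2, c1, c2]
    · have c1 := a1.1 b1
      have c2 : lt₂ u s := by_contra fun hh => b2 (a2.2 hh)
      simp [b1, b2, c1, c2]
    · have c1 : lt₁ u s := by_contra fun hh => b1 (a1.2 hh)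
      have c2 := a2.1 b2
      simp [b1, b2, c1, c2]
    · simp [b1, b2]

end Koszul

/-! ### Insertion of diagrams, for complexes -/

namespace PlanarArcDiagram

open Kob

variable {d : ℕ} {κ : Fin d → ℕ} {k : ℕ} (D : PlanarArcDiagram κ k) {i : Fin d} {d' : ℕ}
  {κ' : Fin d' → ℕ} {D' : PlanarArcDiagram κ' (κ i)} {n : ℕ}

/-- An identification of the complex `X` with `D'(Ω'₁, …)`, on the level of summands. -/
structure TensorData (D' : PlanarArcDiagram κ' (κ i)) (Ω' : ∀ a, Kob (κ' a)) (X : Kob (κ i)) where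
  equiv : X.Summand ≃ ∀ a, (Ω' a).Summand
  sm_eq : ∀ x, D'.obj (fun a => (equiv x a).sm) = x.sm
  deg_eq : ∀ x, x.1 = ∑ a, (equiv x a).1
  dEntry_eq : ∀ x y, dEntry x y =
    CobHom.cast (sm_eq x) (sm_eq y) (D'.tensorEntry (equiv x) (equiv y))
  idEntry_eq : ∀ x y, idEntry x y =
    CobHom.cast (sm_eq x) (sm_eq y) (D'.map fun a => idEntry (equiv x a) (equiv y a))

/-- The tautological identification. -/
def tensorData (D' : PlanarArcDiagram κ' (κ i)) (Ω' : ∀ a, Kob (κ' a)) :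
    TensorData D' Ω' (D'.tensor Ω') where
  equiv := D'.tensorEquiv Ω'
  sm_eq _ := rfl
  deg_eq := D'.tensor_deg
  dEntry_eq _ _ := rfl
  idEntry_eq := D'.tensor_idEntry

variable {Θ : ∀ j, Kob (κ j)} {Ω' : ∀ a, Kob (κ' a)} (H : TensorData D' Ω' (Θ i))

/-- The summands of the `Θ_j`, for `j ≠ i`, and of the `Ω'_a` that make up a tuple of summands of
the `Θ_j`. -/
def refineTuple (q : ∀ j, (Θ j).Summand) : ∀ s, (combine i Θ Ω' s).Summand
  | Sum.inl j => q j
  | Sum.inr a => H.equiv (q i) a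

/-- `refineTuple` as a bijection. -/
def refineEquiv : (∀ j, (Θ j).Summand) ≃ ∀ s, (combine i Θ Ω' s).Summand where
  toFun := refineTuple H
  invFun P j := if h : j = i then h ▸ H.equiv.symm fun a => P (Sum.inr a) else P (Sum.inl ⟨j, h⟩)
  left_inv q := by
    ext1 j
    by_cases h : j = i
    · subst h
      simp [refineTuple]
    · simp [refineTuple, h]
  right_inv P := by
    ext1 s
    rcases s with j | a
    · exact dif_neg j.2
    · exact (congrFun (congrArg H.equiv (dif_pos rfl)) a).trans
        (congrFun (H.equiv.apply_symm_apply fun b => P (Sum.inr b)) a)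

variable (e : Fin n ≃ {j // j ≠ i} ⊕ Fin d')

theorem splits_refineTuple (q : ∀ j, (Θ j).Summand) :
    Splits i D' (fun j => (q j).sm) (fun s => (refineTuple H q s).sm) where
  left _ := rfl
  right := H.sm_eq (q i)

/-- The degrees of the summands of a refined tuple. -/
def refDeg (q : ∀ j, (Θ j).Summand) (s : {j // j ≠ i} ⊕ Fin d') : ℤ := (refineTuple H q s).1

theorem sum_refDeg (q : ∀ j, (Θ j).Summand) : ∑ s, refDeg H q s = ∑ j, (q j).1 := by
  rw [Fintype.sum_sum_type, Fintype.sum_eq_add_sum_subtype_ne _ i, H.deg_eq, add_comm]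
  rfl

/-- The order of the input disks in the composite of two operations: those of `D'` take the place of
the `i`-th input disk of `D`. -/
def lexLt (i : Fin d) (d' : ℕ) : {j // j ≠ i} ⊕ Fin d' → {j // j ≠ i} ⊕ Fin d' → Prop
  | Sum.inl j, Sum.inl l => (j : Fin d) < l
  | Sum.inl j, Sum.inr _ => (j : Fin d) < i
  | Sum.inr _, Sum.inl l => i < l
  | Sum.inr a, Sum.inr b => a < b

theorem lexLt_irrefl (s : {j // j ≠ i} ⊕ Fin d') : ¬lexLt i d' s s := by
  rcases s with j | a
  · exact lt_irrefl _
  · exact lt_irrefl _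

theorem lexLt_iff (s t : {j // j ≠ i} ⊕ Fin d') (h : s ≠ t) : lexLt i d' s t ↔ ¬lexLt i d' t s := by
  rcases s with j | a <;> rcases t with l | b <;> simp only [lexLt, not_lt]
  · have : (j : Fin d) ≠ l := fun hh => h (by rw [Subtype.ext hh])
    exact ⟨le_of_lt, fun hh => lt_of_le_of_ne hh this⟩
  · exact ⟨le_of_lt, fun hh => lt_of_le_of_ne hh j.2⟩
  · exact ⟨le_of_lt, fun hh => lt_of_le_of_ne hh l.2.symm⟩
  · have : a ≠ b := fun hh => h (by rw [hh])
    exact ⟨le_of_lt, fun hh => lt_of_le_of_ne hh this⟩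

/-- The order of the input disks in the numbering `e`. -/
def numLt (e : Fin n ≃ {j // j ≠ i} ⊕ Fin d') (s t : {j // j ≠ i} ⊕ Fin d') : Prop :=
  e.symm s < e.symm t

theorem numLt_iff (s t : {j // j ≠ i} ⊕ Fin d') (h : s ≠ t) : numLt e s t ↔ ¬numLt e t s := by
  have : e.symm s ≠ e.symm t := e.symm.injective.ne h
  unfold numLt
  rw [not_lt]
  exact ⟨le_of_lt, fun hh => lt_of_le_of_ne hh this⟩

theorem sign_eq_inl (q : ∀ j, (Θ j).Summand) (j : {j // j ≠ i}) :
    sign q j = precSign (lexLt i d') (refDeg H q) (Sum.inl j) := by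
  classical
  unfold sign precSign
  congr 2
  rw [Finset.sum_filter, Fintype.sum_sum_type, Fintype.sum_eq_add_sum_subtype_ne _ i, add_comm]
  refine congrArg₂ _ (Finset.sum_congr rfl fun l _ => if_congr Iff.rfl rfl rfl) ?_
  by_cases h : i < j
  · rw [if_pos h, H.deg_eq]
    exact Finset.sum_congr rfl fun a _ => (if_pos h).symm
  · rw [if_neg h]
    exact (Finset.sum_eq_zero fun a _ => if_neg h).symm

theorem sign_eq_inr (q : ∀ j, (Θ j).Summand) (a : Fin d') :
    sign q i * sign (H.equiv (q i)) a = precSign (lexLt i d') (refDeg H q) (Sum.inr a) := by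
  classical
  unfold sign precSign
  rw [← Units.val_mul, ← Int.negOnePow_add]
  congr 2
  rw [Finset.sum_filter, Finset.sum_filter, Fintype.sum_sum_type,
    Fintype.sum_eq_add_sum_subtype_ne _ i, if_neg (lt_irrefl i), zero_add]
  exact congrArg₂ _ (Finset.sum_congr rfl fun _ _ => if_congr Iff.rfl rfl rfl)
    (Finset.sum_congr rfl fun _ _ => if_congr Iff.rfl rfl rfl)

theorem sign_eq_num (q : ∀ j, (Θ j).Summand) (m : Fin n) :
    sign (Ω := fun m => combine i Θ Ω' (e m)) (fun m => refineTuple H q (e m)) m =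
      precSign (numLt e) (refDeg H q) (e m) := by
  classical
  unfold sign precSign
  congr 2
  rw [Finset.sum_filter, ← Equiv.sum_comp e]
  refine Finset.sum_congr rfl fun l _ => ?_
  simp only [numLt, Equiv.symm_apply_apply]
  rfl

/-- The family of entries with the differential in place `s₀` and identities in all other places. -/
def refSlot (q q₂ : ∀ j, (Θ j).Summand) (s₀ s : {j // j ≠ i} ⊕ Fin d') :
    (refineTuple H q s).sm ⟶ (refineTuple H q₂ s).sm :=
  open Classical in
  if s = s₀ then dEntry (refineTuple H q s) (refineTuple H q₂ s)
  else idEntry (refineTuple H q s) (refineTuple H q₂ s)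

theorem refSlot_num (q q₂ : ∀ j, (Θ j).Summand) (m : Fin n) :
    (fun l => refSlot H q q₂ (e m) (e l)) =
      slot (Ω := fun m => combine i Θ Ω' (e m)) m (fun m => refineTuple H q (e m))
        (fun m => refineTuple H q₂ (e m)) := by
  ext1 l
  unfold refSlot slot
  by_cases h : l = m
  · rw [if_pos h, if_pos (congrArg e h)]
  · rw [if_neg h, if_neg fun hh => h (e.injective hh)]

theorem splitsHom_inl (q q₂ : ∀ j, (Θ j).Summand) (j : {j // j ≠ i}) :
    SplitsHom (splits_refineTuple H q) (splits_refineTuple H q₂) (slot (j : Fin d) q q₂)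
      (refSlot H q q₂ (Sum.inl j)) where
  left l := by
    unfold slot refSlot
    by_cases h : l = j
    · rw [if_pos (congrArg Subtype.val h), if_pos (congrArg Sum.inl h)]
      rfl
    · rw [if_neg fun hh => h (Subtype.ext hh), if_neg fun hh => h (Sum.inl_injective hh)]
      rfl
  right := by
    have h : (fun a => refSlot H q q₂ (Sum.inl j) (Sum.inr a)) =
        fun a => idEntry (refineTuple H q (Sum.inr a)) (refineTuple H q₂ (Sum.inr a)) :=
      funext fun a => if_neg (by simp)
    rw [h]
    unfold slot
    rw [if_neg j.2.symm, H.idEntry_eq]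
    rfl

theorem splitsHom_inr (q q₂ : ∀ j, (Θ j).Summand) (a : Fin d') :
    SplitsHom (splits_refineTuple H q) (splits_refineTuple H q₂)
      (Function.update (slot i q q₂) i (CobHom.cast (H.sm_eq (q i)) (H.sm_eq (q₂ i))
        (D'.map (slot a (H.equiv (q i)) (H.equiv (q₂ i))))))
      (refSlot H q q₂ (Sum.inr a)) where
  left l := by
    rw [Function.update_of_ne l.2]
    unfold slot refSlot
    rw [if_neg l.2, if_neg (by simp)]
    rfl
  right := by
    rw [Function.update_self]
    congr 2
    ext1 b
    unfold slot refSlot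
    by_cases h : b = a
    · rw [if_pos h, if_pos (congrArg Sum.inr h)]
      rfl
    · rw [if_neg h, if_neg fun hh => h (Sum.inr_injective hh)]
      rfl

theorem map_slot_expand (q q₂ : ∀ j, (Θ j).Summand) :
    D.map (slot i q q₂) = ∑ a, sign (H.equiv (q i)) a •
      D.map (Function.update (slot i q q₂) i (CobHom.cast (H.sm_eq (q i)) (H.sm_eq (q₂ i))
        (D'.map (slot a (H.equiv (q i)) (H.equiv (q₂ i)))))) := by
  let L : CobHom (q i).sm (q₂ i).sm →ₗ[ℤ] CobHom (D.obj fun j => (q j).sm)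
      (D.obj fun j => (q₂ j).sm) :=
    (D.multi (fun j => (q j).sm) fun j => (q₂ j).sm).toLinearMap (slot i q q₂) i
  let C : CobHom (D'.obj fun a => (H.equiv (q i) a).sm) (D'.obj fun a => (H.equiv (q₂ i) a).sm)
      →ₗ[ℤ] CobHom (q i).sm (q₂ i).sm := CobHom.cast (H.sm_eq (q i)) (H.sm_eq (q₂ i))
  have h1 : D.map (slot i q q₂) = L (C (D'.tensorEntry (H.equiv (q i)) (H.equiv (q₂ i)))) := by
    change _ = D.map (Function.update (slot i q q₂) i _)
    congr 1
    symm
    rw [Function.update_eq_iff]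
    refine ⟨?_, fun _ _ => rfl⟩
    unfold slot
    rw [if_pos rfl]
    exact (H.dEntry_eq _ _).symm
  rw [h1]
  change (L.comp C) (∑ a, sign (H.equiv (q i)) a •
    D'.map (slot a (H.equiv (q i)) (H.equiv (q₂ i)))) = _
  rw [_root_.map_sum]
  refine Finset.sum_congr rfl fun a _ => ?_
  rw [map_zsmul]
  rfl

/-- The differential of the composite, expressed by the inserted diagram: the same terms as in the
differential for the inserted diagram, with signs for the order of insertion. -/
theorem cast_tensorEntry (q q₂ : ∀ j, (Θ j).Summand) :
    CobHom.cast ((splits_refineTuple H q).obj_eq D e) ((splits_refineTuple H q₂).obj_eq D e)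
        (D.tensorEntry q q₂) =
      ∑ m, precSign (lexLt i d') (refDeg H q) (e m) •
        (D.insert i D' e).map (slot (Ω := fun m => combine i Θ Ω' (e m)) m
          (fun m => refineTuple H q (e m)) fun m => refineTuple H q₂ (e m)) := by
  let C : CobHom (D.obj fun j => (q j).sm) (D.obj fun j => (q₂ j).sm) →ₗ[ℤ]
      CobHom ((D.insert i D' e).obj fun m => (refineTuple H q (e m)).sm)
        ((D.insert i D' e).obj fun m => (refineTuple H q₂ (e m)).sm) :=
    CobHom.cast ((splits_refineTuple H q).obj_eq D e) ((splits_refineTuple H q₂).obj_eq D e)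
  let G : {j // j ≠ i} ⊕ Fin d' → CobHom ((D.insert i D' e).obj fun m => (refineTuple H q (e m)).sm)
      ((D.insert i D' e).obj fun m => (refineTuple H q₂ (e m)).sm) := fun s =>
    precSign (lexLt i d') (refDeg H q) s •
      (D.insert i D' e).map fun l => refSlot H q q₂ s (e l)
  have h1 : (∑ m, precSign (lexLt i d') (refDeg H q) (e m) •
      (D.insert i D' e).map (slot (Ω := fun m => combine i Θ Ω' (e m)) m
        (fun m => refineTuple H q (e m)) fun m => refineTuple H q₂ (e m))) = ∑ s, G s := by
    rw [← Equiv.sum_comp e]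
    refine Finset.sum_congr rfl fun m _ => ?_
    rw [← refSlot_num]
  have h2 : D.tensorEntry q q₂ = ∑ j, sign q j • D.map (slot j q q₂) := rfl
  rw [h1, Fintype.sum_sum_type]
  change C (D.tensorEntry q q₂) = _
  rw [h2, Fintype.sum_eq_add_sum_subtype_ne _ i, add_comm]
  refine (map_add C _ _).trans (congrArg₂ (· + ·) ?_ ?_)
  · refine (_root_.map_sum C _ _).trans (Finset.sum_congr rfl fun j _ => ?_)
    refine (map_zsmul C _ _).trans ?_
    rw [sign_eq_inl H]
    exact congrArg _ ((splitsHom_inl H q q₂ j).map_eq D e)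
  · rw [D.map_slot_expand H, Finset.smul_sum]
    refine (_root_.map_sum C _ _).trans (Finset.sum_congr rfl fun a _ => ?_)
    rw [smul_smul, sign_eq_inr H]
    refine (map_zsmul C _ _).trans ?_
    exact congrArg _ ((splitsHom_inr H q q₂ a).map_eq D e)

/-- Koszul signs translate the differential of the composite to the differential for the inserted
diagram. -/
theorem tensorEntry_comp_koszul (q q₂ : ∀ j, (Θ j).Summand) :
    D.tensorEntry q q₂ ≫ (koszul (numLt e) (lexLt i d') (refDeg H q₂) •
        eqToHom ((splits_refineTuple H q₂).obj_eq D e)) =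
      (koszul (numLt e) (lexLt i d') (refDeg H q) •
        eqToHom ((splits_refineTuple H q).obj_eq D e)) ≫
        (D.insert i D' e).tensorEntry (Ω := fun m => combine i Θ Ω' (e m))
          (fun m => refineTuple H q (e m)) fun m => refineTuple H q₂ (e m) := by
  rw [Preadditive.comp_zsmul, Preadditive.zsmul_comp,
    CobHom.comp_eqToHom ((splits_refineTuple H q).obj_eq D e),
    ← Preadditive.comp_zsmul, ← Preadditive.comp_zsmul]
  congr 1
  rw [D.cast_tensorEntry H e]
  change _ • _ = _ • ∑ m, sign (Ω := fun m => combine i Θ Ω' (e m))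
    (fun m => refineTuple H q (e m)) m • _
  rw [Finset.smul_sum, Finset.smul_sum]
  refine Finset.sum_congr rfl fun m _ => ?_
  rw [sign_eq_num, smul_smul, smul_smul]
  by_cases h : ∀ l, refDeg H q₂ (e l) = refDeg H q (e l) + if l = m then 1 else 0
  · have h' : ∀ s, refDeg H q₂ s = refDeg H q s + if s = e m then 1 else 0 :=
      e.surjective.forall.2 fun l => by simpa using h l
    have := koszul_succ (numLt_iff e) lexLt_iff (fun s => lt_irrefl (e.symm s)) lexLt_irrefl h'
    rw [mul_comm, this, mul_comm]
  · have h0 := (D.insert i D' e).map_slot_eq_zero (Ω := fun m => combine i Θ Ω' (e m))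
      (p := fun m => refineTuple H q (e m)) (q := fun m => refineTuple H q₂ (e m)) h
    rw [h0, smul_zero, smul_zero]

/-- An isomorphism multiplied by a sign. -/
def signIso {C : Type*} [Category C] [Preadditive C] {A B : C} (c : ℤ) (hc : c * c = 1)
    (f : A ≅ B) : A ≅ B where
  hom := c • f.hom
  inv := c • f.inv
  hom_inv_id := by
    rw [Preadditive.zsmul_comp, Preadditive.comp_zsmul, smul_smul, hc, one_smul, f.hom_inv_id]
  inv_hom_id := by
    rw [Preadditive.zsmul_comp, Preadditive.comp_zsmul, smul_smul, hc, one_smul, f.inv_hom_id]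

/-- Placing `D'` into the `i`-th hole of `D` composes the actions on complexes. The isomorphism
multiplies a summand by the Koszul sign of its tuple of degrees, for the rearrangement of the input
disks from the order of insertion to the given numbering. -/
theorem tensor_iso_insert (H : TensorData D' Ω' (Θ i)) (e : Fin n ≃ {j // j ≠ i} ⊕ Fin d') :
    Nonempty (D.tensor Θ ≅ (D.insert i D' e).tensor fun m => combine i Θ Ω' (e m)) := by
  let E : (∀ j, (Θ j).Summand) ≃ ∀ m, (combine i Θ Ω' (e m)).Summand :=
    (refineEquiv H).trans (Equiv.piCongrLeft (fun s => (combine i Θ Ω' s).Summand) e).symm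
  refine nonempty_iso_of_summands ((D.tensorEquiv Θ).trans
    (E.trans ((D.insert i D' e).tensorEquiv fun m => combine i Θ Ω' (e m)).symm))
    (fun x => ?_) (fun x => signIso (koszul (numLt e) (lexLt i d') (refDeg H (D.tensorEquiv Θ x)))
      (koszul_mul_self _ _ _)
      (eqToIso ((splits_refineTuple H (D.tensorEquiv Θ x)).obj_eq D e))) fun x y => ?_
  · rw [D.tensor_deg x, ← sum_refDeg H, ← Equiv.sum_comp e]
    rfl
  · exact D.tensorEntry_comp_koszul H e (D.tensorEquiv Θ x) (D.tensorEquiv Θ y)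

end PlanarArcDiagram

/-! ### The planar algebras of complexes -/

/-- The action of planar arc diagrams on complexes descends to a planar algebra on the classes of an
equivalence relation that contains isomorphism and is respected by the action. An operation is
applied to chosen representatives. -/
def kobPlanarAlgebra (Q : ∀ k, Setoid (Kob k))
    (hQ : ∀ k (Ω Ω' : Kob k), Nonempty (Ω ≅ Ω') → (Q k).r Ω Ω')
    (hD : ∀ {d : ℕ} {κ : Fin d → ℕ} {k : ℕ} (D : PlanarArcDiagram κ k) (Ω Ω' : ∀ i, Kob (κ i)),
      (∀ i, (Q (κ i)).r (Ω i) (Ω' i)) → (Q k).r (D.tensor Ω) (D.tensor Ω')) :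
    PlanarAlgebra fun k => Quotient (Q k) where
  op D x := Quotient.mk _ (D.tensor fun i => (x i).out)
  isotopy D D' h := funext fun x =>
    Quotient.sound (hQ _ _ _ (PlanarArcDiagram.tensor_iso_of_isotopic h _))
  radial D h x := (Quotient.sound (hQ _ _ _ (PlanarArcDiagram.tensor_iso_of_radial h _))).trans
    (Quotient.out_eq x)
  assoc {d d' κ κ' k} D i D' {n} e x x' := by
    let Ω' : ∀ a, Kob (κ' a) := fun a => (x' a).out
    let Θ : ∀ j, Kob (κ j) := Function.update (fun j => (x j).out) i (D'.tensor Ω')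
    have hΘ : Θ i = D'.tensor Ω' := Function.update_self _ _ _
    have H : PlanarArcDiagram.TensorData D' Ω' (Θ i) :=
      hΘ.symm ▸ PlanarArcDiagram.tensorData D' Ω'
    refine Quotient.sound ((Q k).trans (hD _ _ _ fun m => ?_)
      ((Q k).trans ((Q k).symm (hQ _ _ _ (D.tensor_iso_insert H e))) (hD D Θ _ fun j => ?_)))
    · have key : ∀ s, (Q _).r
          (Quotient.out (combine (P := fun k => Quotient (Q k)) i x x' s)) (combine i Θ Ω' s) := ?_
      · exact key (e m)
      rintro (j | a)
      · change (Q (κ j)).r _ (Θ j)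
        rw [show Θ j = (x j).out from Function.update_of_ne j.2 _ _]
        exact (Q _).refl _
      · exact (Q _).refl _
    · by_cases h : j = i
      · subst h
        rw [hΘ, Function.update_self]
        exact (Q _).symm (Quotient.mk_out (s := Q _) _)
      · rw [show Θ j = (x j).out from Function.update_of_ne h _ _, Function.update_of_ne h]

end BarNatan

end

theorem mainTheorem3 :
    (∃ P : BarNatan.PlanarAlgebra BarNatan.KobClass,
      ∀ {d : ℕ} {κ : Fin d → ℕ} {k : ℕ} (D : BarNatan.PlanarArcDiagram κ k)
        (Ω : ∀ i, BarNatan.Kob (κ i)), P.op D (fun i => (Ω i).cls) = (D.tensor Ω).cls) ∧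
    (∀ {d : ℕ} {κ : Fin d → ℕ} {k : ℕ} (D : BarNatan.PlanarArcDiagram κ k)
        (Ω Ω' : ∀ i, BarNatan.Kob (κ i)), (∀ i, BarNatan.HtpyEquiv (Ω i) (Ω' i)) →
        BarNatan.HtpyEquiv (D.tensor Ω) (D.tensor Ω')) ∧
    (∃ Q : BarNatan.PlanarAlgebra BarNatan.KobHtpyClass,
      ∀ {d : ℕ} {κ : Fin d → ℕ} {k : ℕ} (D : BarNatan.PlanarArcDiagram κ k)
        (Ω : ∀ i, BarNatan.Kob (κ i)),
        Q.op D (fun i => (Ω i).htpyCls) = (D.tensor Ω).htpyCls) := by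
  refine ⟨⟨BarNatan.kobPlanarAlgebra (fun k => isIsomorphicSetoid (BarNatan.Kob k))
      (fun _ _ _ h => h) fun D _ _ h => D.tensor_iso h, fun D Ω => ?_⟩,
    fun D _ _ h => D.tensor_htpyEquiv h,
    ⟨BarNatan.kobPlanarAlgebra BarNatan.htpySetoid
      (fun _ _ _ h => BarNatan.Kob.htpyEquiv_of_iso h) fun D _ _ h => D.tensor_htpyEquiv h,
      fun D Ω => ?_⟩⟩
  · exact Quotient.sound (D.tensor_iso fun i => Quotient.mk_out (s := isIsomorphicSetoid _) (Ω i))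
  · exact Quotient.sound (D.tensor_htpyEquiv fun i =>
      Quotient.mk_out (s := BarNatan.htpySetoid _) (Ω i))
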